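/- Let $p$ be a prime and $\alpha\ge 1$. Let $P\in\mathbb{Z}_p[x,y]$ be a polynomial with $P(0,0)=0$ and $\frac{\partial P}{\partial y}(0,0)\not\equiv 0 \pmod p$, and let $F=\sum_{n\ge 0}a(n)x^n\in\mathbb{Z}_p[[x]]$ be its Furstenberg series, that is, the unique power series with $F(0)=0$ and $P(x,F)=0$. Let $h=\deg_x(P\bmod p)$ and $d=\deg_y(P\bmod p)$, and assume $h\ge 1$. Set $$N=\tfrac16\,\alpha(\alpha+1)\bigl((2hd-1)\alpha+hd+1\bigr),$$ $$u=\Bigl\lfloor \log_p\max\bigl(\alpha(\deg_x(P\bmod p^\alpha)-h),\ \alpha(\deg_y(P\bmod p^\alpha)-d)+1\bigr)\Bigr\rfloor+1.$$ Let $Q\in(\mathbb{Z}/p^\alpha\mathbb{Z})[x,y,y^{-1}]$ be a lift of $P/y\bmod p$ with the same monomial support as $P/y\bmod p$. Let $\pi_{x,i}(Q)$, a Laurent polynomial in $y$, be the coefficient of $x^i$ in $Q$, and let $\pi_{y,j}(Q)$, a polynomial in $x$, be the coefficient of $y^j$ in $Q$. The degree of a nonzero Laurent polynomial is the largest exponent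 with a nonzero coefficient (it may be negative). Set $$u_\ell=\bigl\lfloor\log_p\max\bigl(p^{\alpha-1}(d-1-\deg\pi_{x,0}(Q)),1\bigr)\bigr\rfloor+1,$$ $$u_{\mathrm r}=\bigl\lfloor\log_p\max\bigl(p^{\alpha-1}(d-1-\deg\pi_{x,h}(Q)),1\bigr)\bigr\rfloor+1,$$ $$u_{\mathrm t}=\bigl\lfloor\log_p\max\bigl(p^{\alpha-1}(h-\deg\pi_{y,d-1}(Q)),1\bigr)\bigr\rfloor+1.$$ For $l,m,n\ge1$ let $\mathcal L(l,m,n)$ be the maximum of $\mathrm{lcm}(\mathrm{lcm}(\sigma_1),\mathrm{lcm}(\sigma_2),\mathrm{lcm}(\sigma_3))$ over all integers $1\le i\le l$, $1\le j\le m$, $1\le k\le n$ and all integer partitions $\sigma_1$ of $i$, $\sigma_2$ of $j$, $\sigma_3$ of $k$. Call a finite deterministic automaton with output, with input alphabet $\{0,\dots,p-1\}$, a $p$-automaton generating a sequence if, for every $n\ge 0$, it outputs the $n$th term of the sequence when fed the standard base-$p$ representation of $n$, least significant digit first. The minimal $p$-automaton of a sequence is the one with the fewest states among those that generate the sequence and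 whose output is not affected by leading zeros. The $p$-kernel of a sequence $(b(n))_{n\ge0}$ is the set of sequences $\{(b(p^en+r))_{n\ge0} : e\ge 0,\ 0\le r\le p^e-1\}$. Then the minimal $p$-automaton generating $(a(n)\bmod p^\alpha)_{n\ge0}$ exists, the $p$-kernel of this sequence is finite, and the number of states of this automaton and the number of elements of this $p$-kernel are each at most $$p^N+p^{\,N-\alpha(\alpha+1)(h+d-1)/2}\,\mathcal L(h,d,d)+\max(u_\ell,u_{\mathrm r},u_{\mathrm t})+\lceil\log_p\max(h,d-1)\rceil+\max(\alpha,2(\alpha-1))+\frac{p^u-1}{p-1}.$$ -/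

import Mathlib

open Polynomial

/-- Polynomials in two variables over `R`. The outer variable is `y` and the inner one is `x`, so
that `(P.coeff j).coeff i` is the coefficient of `x ^ i * y ^ j` in `P`. -/
abbrev BiPoly (R : Type*) [CommRing R] := Polynomial (Polynomial R)

/-- The ring `R[x, y, y⁻¹]`, with the convention that `(Q.coeff j).coeff i` is the coefficient of
`x ^ i * y ^ j` in `Q`, for `i : ℕ` and `j : ℤ`. -/
abbrev BiLaurent (R : Type*) [CommRing R] := LaurentPolynomial (Polynomial R)

namespace BiPoly

variable {R S : Type*} [CommRing R] [CommRing S]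

/-- Apply a ring homomorphism to all coefficients of a bivariate polynomial. -/
noncomputable def mapCoeff (φ : R →+* S) (P : BiPoly R) : BiPoly S :=
  P.map (Polynomial.mapRingHom φ)

/-- The degree in `x`. -/
noncomputable def degX (P : BiPoly R) : ℕ := P.support.sup fun j => (P.coeff j).natDegree

/-- The degree in `y`. -/
noncomputable def degY (P : BiPoly R) : ℕ := P.natDegree

/-- The Laurent polynomial `P / y`. -/
noncomputable def divY (P : BiPoly R) : BiLaurent R :=
  Polynomial.toLaurent P * LaurentPolynomial.T (-1)

/-- The power series `P(x, F)`. -/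
noncomputable def evalSeries (P : BiPoly R) (F : PowerSeries R) : PowerSeries R :=
  Polynomial.eval₂ (Polynomial.coeToPowerSeries.ringHom (R := R)) F P

end BiPoly

namespace BiLaurent

variable {R S : Type*} [CommRing R] [CommRing S]

/-- `Q` is a lift of `G` along `φ` that has the same monomial support as `G`. -/
def IsSupportPreservingLift (φ : R →+* S) (Q : BiLaurent R) (G : BiLaurent S) : Prop :=
  ∀ (i : ℕ) (j : ℤ),
    φ ((Q.coeff j).coeff i) = (G.coeff j).coeff i ∧
      ((Q.coeff j).coeff i ≠ 0 ↔ (G.coeff j).coeff i ≠ 0)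

/-- The coefficient of `x ^ i`, a Laurent polynomial in `y`. -/
noncomputable def projX (i : ℕ) (Q : BiLaurent R) : LaurentPolynomial R :=
  AddMonoidAlgebra.ofCoeff
    (Q.coeff.mapRange (fun f : Polynomial R => f.coeff i) (Polynomial.coeff_zero i))

/-- The coefficient of `y ^ j`, a polynomial in `x`. -/
noncomputable def projY (j : ℤ) (Q : BiLaurent R) : Polynomial R := Q.coeff j

end BiLaurent

/-- The integer degree of a nonzero univariate Laurent polynomial: the largest exponent with a
nonzero coefficient. It can be negative. -/
def laurentDeg {R : Type*} [CommRing R] (f : LaurentPolynomial R) : ℤ :=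
  (LaurentPolynomial.degree f).unbotD 0

/-- The `p`-adic polynomials `P` that have an associated Furstenberg series: `P(0, 0) = 0`, and
`∂P/∂y (0, 0)` is nonzero modulo `p`. -/
def IsFurstenbergPoly (p : ℕ) [Fact p.Prime] (P : BiPoly ℤ_[p]) : Prop :=
  P.evalEval 0 0 = 0 ∧ PadicInt.toZMod ((Polynomial.derivative P).evalEval 0 0) ≠ 0

/-- The defining property of the Furstenberg series associated with `P`:
`F(0) = 0` and `P(x, F) = 0`. -/
def IsFurstenbergSeries (p : ℕ) [Fact p.Prime] (P : BiPoly ℤ_[p]) (F : PowerSeries ℤ_[p]) :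
    Prop :=
  PowerSeries.constantCoeff F = 0 ∧ P.evalSeries F = 0

/-- The maximum of `lcm (lcm σ₁) (lcm σ₂) (lcm σ₃)` over all integer partitions `σ₁` of some
`i ∈ [1, l]`, `σ₂` of some `j ∈ [1, m]`, and `σ₃` of some `k ∈ [1, n]`. -/
def landauL (l m n : ℕ) : ℕ :=
  (Finset.Icc 1 l).sup fun i => (Finset.Icc 1 m).sup fun j => (Finset.Icc 1 n).sup fun k =>
    (Finset.univ : Finset (Nat.Partition i)).sup fun σ₁ =>
      (Finset.univ : Finset (Nat.Partition j)).sup fun σ₂ =>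
        (Finset.univ : Finset (Nat.Partition k)).sup fun σ₃ =>
          Nat.lcm (Nat.lcm σ₁.parts.lcm σ₂.parts.lcm) σ₃.parts.lcm

/-- The `p`-kernel of a sequence. -/
def pKernel {Δ : Type*} (p : ℕ) (a : ℕ → Δ) : Set (ℕ → Δ) :=
  {b | ∃ e r : ℕ, r < p ^ e ∧ b = fun n => a (p ^ e * n + r)}

/-- Deterministic automata with output, with input alphabet `{0, …, p - 1}`, output alphabet `Δ`
and state set `σ`. -/
structure DFAO (p : ℕ) (Δ σ : Type*) where
  /-- the transition function -/
  step : σ → Fin p → σ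
  /-- the initial state -/
  start : σ
  /-- the output function -/
  output : σ → Δ

namespace DFAO

variable {p : ℕ} {Δ σ : Type*}

/-- The output of the automaton when it is fed the word `w`, from left to right. -/
def run (M : DFAO p Δ σ) (w : List (Fin p)) : Δ := M.output (w.foldl M.step M.start)

/-- The automaton generates `a`: fed the standard base-`p` representation of `n`, least
significant digit first, it outputs `a n`. -/
def Generates (M : DFAO p Δ σ) (a : ℕ → Δ) : Prop :=
  ∀ (n : ℕ) (w : List (Fin p)), w.map Fin.val = Nat.digits p n → M.run w = a n

/-- The output is not affected by leading zeros, which are read last. -/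
def IgnoresLeadingZeros (M : DFAO p Δ σ) : Prop :=
  ∀ (w : List (Fin p)) (z : Fin p), z.val = 0 → M.run (w ++ [z]) = M.run w

/-- `M` is a minimal automaton of `a`: it has the fewest states among the finite automata that
generate `a` and are not affected by leading zeros. -/
def IsMinimalFor {m : ℕ} (M : DFAO p Δ (Fin m)) (a : ℕ → Δ) : Prop :=
  (M.Generates a ∧ M.IgnoresLeadingZeros) ∧
    ∀ (m' : ℕ) (M' : DFAO p Δ (Fin m')), M'.Generates a → M'.IgnoresLeadingZeros → m ≤ m'

end DFAO

/-! By Furstenberg's theorem (`cf_theta_ofDivY`), a(n) is the coefficient of x^n y^0 in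
y·θ(P/y)/(P/y), where θ = y∂/∂y. The quotient is taken in a ring of Hahn series in which x is
infinitely small compared with y. Modulo p^α one has P/y = Q + pE with Q of bidegree governed by h
and d. Expanding in powers of the nilpotent pE turns the quotient into yθ(Q)/Q plus fractions with
denominators Q^K whose numerators have larger degrees, by an excess bounded in terms of α
(`exists_fraction`).

The kernel element n ↦ a(p^e n + r) is the row y^0 of a section (Cartier operator) of this fraction.
With q = p^e one has Q^q ≡ Q(x^q, y^q) mod p, so a section of p^k S/Q^(k+1) is a combination of
fractions p^(k+i) S_i/Q^(k+1+i), while the excess degrees get divided by q (`sect_mem_iSup_fracs`).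
Hence the excess is gone once e ≥ u. There are at most (p^u - 1)/(p - 1) kernel elements with e < u;
the others are treated according to r.

If r > 0, the section of the main term has numerators off the right edge of the polygon. At level k
(scalar p^k, denominator Q^(k+1)) these involve `boxCount h d (k + 1)` monomials. As p times level k
lies in level k + 1, each level multiplies the number of rows only by p to the number of its
monomials, and these numbers add up to N. The excess part can still reach the right edge. This is
offset by relations: θ kills the row y^0, so the exact fractions θ(x^i y^j/Q^k) have rows equal to
zero, and there are enough of them, independent modulo p, to pay for the edge
(`card_map_levelFracs_sup_excessFracs_le`). So these kernel elements number at most p^N.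

If r = 0, the coefficients of a numerator on the left, right and top edges evolve by themselves:
taking the part on a face is multiplicative, so there the section acts on a univariate rational
function whose denominator is a power of the edge polynomial f of Q. If m is a multiple of the
degrees of the irreducible factors of f mod p, then f^(p^(α-1)) divides X^(p^(e+m)) - X^(p^e) for
large e, and the edge parts become periodic with period m. The degrees of the factors are the parts
of a partition, so m ≤ L(h,d,d) works for the three edges together (`exists_period`). Two sections
one period apart differ by a fraction with interior numerators, and such fractions have at most p^(N
- α(α+1)(h+d-1)/2) rows (`card_map_innerBox_le`); this gives the second summand and a preperiod.

The kernel itself is the state set of an automaton, which bounds the minimal one. -/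

/-! ### The lexicographic lattice of exponents -/

/-- The lattice of exponents `(i, j)` of monomials `x ^ i * y ^ j`, ordered lexicographically. -/
abbrev ExpLattice := ℤ ×ₗ ℤ

/-- The ring of series in `x` and `y` whose exponents form a well-ordered set for the
lexicographic order. -/
abbrev BiSeries (R : Type*) [CommRing R] := HahnSeries ExpLattice R

/-- The exponent of `x ^ i * y ^ j`. -/
def expo (i j : ℤ) : ExpLattice := toLex (i, j)

@[simp] lemma expo_add (a b c d : ℤ) : expo a b + expo c d = expo (a + c) (b + d) := rfl
@[simp] lemma expo_sub (a b c d : ℤ) : expo a b - expo c d = expo (a - c) (b - d) := rfl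
lemma expo_zero : expo 0 0 = 0 := rfl

lemma expo_inj {a b c d : ℤ} : expo a b = expo c d ↔ a = c ∧ b = d := by
  simp [expo]

lemma expo_surj (g : ExpLattice) : ∃ i j, g = expo i j := ⟨(ofLex g).1, (ofLex g).2, rfl⟩

lemma expo_lt {a b c d : ℤ} : expo a b < expo c d ↔ a < c ∨ a = c ∧ b < d := by
  simp [expo, Prod.Lex.toLex_lt_toLex]

lemma expo_le {a b c d : ℤ} : expo a b ≤ expo c d ↔ a < c ∨ a = c ∧ b ≤ d := by
  simp [expo, Prod.Lex.toLex_le_toLex]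

lemma nsmul_expo (n : ℕ) (a b : ℤ) : n • expo a b = expo (n * a) (n * b) := by
  induction n with
  | zero => simp [expo_zero]
  | succ n ih => rw [succ_nsmul, ih, expo_add]; push_cast; ring_nf

/-! ### Series in x and y: supports, inverses, the derivation θ, sections -/

namespace BiSeries

variable {R S : Type*} [CommRing R] [CommRing S]

/-- The coefficient of `x ^ i * y ^ j`. -/
def cf (f : BiSeries R) (i j : ℤ) : R := f.coeff (expo i j)

lemma ext_cf {f g : BiSeries R} (h : ∀ i j, cf f i j = cf g i j) : f = g := by
  apply HahnSeries.ext
  funext e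
  obtain ⟨i, j, rfl⟩ := expo_surj e
  exact h i j

@[simp] lemma cf_zero (i j : ℤ) : cf (0 : BiSeries R) i j = 0 := rfl
@[simp] lemma cf_add (f g : BiSeries R) (i j : ℤ) : cf (f + g) i j = cf f i j + cf g i j := rfl
@[simp] lemma cf_neg (f : BiSeries R) (i j : ℤ) : cf (-f) i j = -cf f i j := rfl
@[simp] lemma cf_sub (f g : BiSeries R) (i j : ℤ) : cf (f - g) i j = cf f i j - cf g i j := rfl
@[simp] lemma cf_smul (c : R) (f : BiSeries R) (i j : ℤ) : cf (c • f) i j = c * cf f i j := rfl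

lemma cf_sum {ι : Type*} (s : Finset ι) (f : ι → BiSeries R) (i j : ℤ) :
    cf (∑ k ∈ s, f k) i j = ∑ k ∈ s, cf (f k) i j := by
  classical
  induction s using Finset.induction_on with
  | empty => simp
  | insert a s ha ih => simp [Finset.sum_insert ha, ih]

lemma natCast_mul_eq_smul (n : ℕ) (f : BiSeries R) : (n : BiSeries R) * f = (n : R) • f := by
  rw [← HahnSeries.single_zero_mul_eq_smul, HahnSeries.single_zero_natCast]

lemma intCast_mul_eq_smul (n : ℤ) (f : BiSeries R) : (n : BiSeries R) * f = (n : R) • f := by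
  rw [← HahnSeries.single_zero_mul_eq_smul, HahnSeries.single_zero_intCast]

lemma cf_natCast_mul (n : ℕ) (f : BiSeries R) (i j : ℤ) :
    cf ((n : BiSeries R) * f) i j = (n : R) * cf f i j := by
  rw [natCast_mul_eq_smul, cf_smul]

lemma cf_intCast_mul (n : ℤ) (f : BiSeries R) (i j : ℤ) :
    cf ((n : BiSeries R) * f) i j = (n : R) * cf f i j := by
  rw [intCast_mul_eq_smul, cf_smul]

/-- The monomial `x ^ i * y ^ j`. -/
noncomputable def mono (i j : ℤ) : BiSeries R := HahnSeries.single (expo i j) 1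

lemma mono_mul_mono (a b c d : ℤ) :
    (mono a b : BiSeries R) * mono c d = mono (a + c) (b + d) := by
  simp [mono, HahnSeries.single_mul_single]

lemma mono_zero : (mono 0 0 : BiSeries R) = 1 := by
  rw [mono, expo_zero]; rfl

lemma cf_mono (a b i j : ℤ) : cf (mono a b : BiSeries R) i j = if i = a ∧ j = b then 1 else 0 := by
  simp only [cf, mono, HahnSeries.coeff_single, expo_inj]

lemma mono_pow (a b : ℤ) (n : ℕ) : (mono a b : BiSeries R) ^ n = mono (n * a) (n * b) := by
  rw [mono, HahnSeries.single_pow, nsmul_expo, one_pow]; rfl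

lemma cf_mono_mul (a b : ℤ) (f : BiSeries R) (i j : ℤ) :
    cf (mono a b * f) i j = cf f (i - a) (j - b) := by
  simp [cf, mono, HahnSeries.coeff_single_mul]

lemma finite_mul_support (f g : BiSeries R) (a : ExpLattice) :
    {b : ExpLattice | f.coeff b * g.coeff (a - b) ≠ 0}.Finite := by
  refine ((Finset.antidiagonal f.isPWO_support g.isPWO_support a).image Prod.fst).finite_toSet.subset
    ?_
  intro b hb
  simp only [Finset.coe_image, Set.mem_image, Finset.mem_coe, Finset.mem_antidiagonal]
  refine ⟨(b, a - b), ⟨?_, ?_, by simp⟩, rfl⟩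
  · exact left_ne_zero_of_mul hb
  · exact right_ne_zero_of_mul hb

lemma coeff_mul_eq_finsum (f g : BiSeries R) (a : ExpLattice) :
    (f * g).coeff a = ∑ᶠ b, f.coeff b * g.coeff (a - b) := by
  classical
  rw [HahnSeries.coeff_mul]
  rw [finsum_eq_sum_of_support_subset (s := (Finset.antidiagonal f.isPWO_support
    g.isPWO_support a).image Prod.fst)]
  · rw [Finset.sum_image]
    · refine Finset.sum_congr rfl fun x hx => ?_
      have := (Finset.mem_antidiagonal.mp hx).2.2
      rw [← this, add_sub_cancel_left]
    · intro x hx y hy hxy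
      have h1 := (Finset.mem_antidiagonal.mp hx).2.2
      have h2 := (Finset.mem_antidiagonal.mp hy).2.2
      refine Prod.ext hxy ?_
      have h3 : x.1 + x.2 = x.1 + y.2 := by rw [h1, hxy, h2]
      exact add_left_cancel h3
  · intro b hb
    simp only [Finset.coe_image, Set.mem_image, Finset.mem_coe, Finset.mem_antidiagonal]
    refine ⟨(b, a - b), ⟨?_, ?_, by simp⟩, rfl⟩
    · exact left_ne_zero_of_mul hb
    · exact right_ne_zero_of_mul hb

/-- All monomials of `f` have their exponents in `A`. -/
def SuppIn (A : Set (ℤ × ℤ)) (f : BiSeries R) : Prop := ∀ i j, cf f i j ≠ 0 → (i, j) ∈ A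

lemma SuppIn.mono {A B : Set (ℤ × ℤ)} {f : BiSeries R} (h : SuppIn A f) (hAB : A ⊆ B) :
    SuppIn B f := fun i j hij => hAB (h i j hij)

lemma suppIn_zero (A : Set (ℤ × ℤ)) : SuppIn A (0 : BiSeries R) := fun _ _ h => absurd rfl h

lemma SuppIn.add {A : Set (ℤ × ℤ)} {f g : BiSeries R} (hf : SuppIn A f) (hg : SuppIn A g) :
    SuppIn A (f + g) := by
  intro i j h
  by_contra hA
  have h1 : cf f i j = 0 := by_contra fun h => hA (hf i j h)
  have h2 : cf g i j = 0 := by_contra fun h => hA (hg i j h)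
  exact h (by simp [h1, h2])

lemma SuppIn.smul {A : Set (ℤ × ℤ)} {f : BiSeries R} (hf : SuppIn A f) (c : R) :
    SuppIn A (c • f) := fun i j h => hf i j (right_ne_zero_of_mul h)

lemma SuppIn.neg {A : Set (ℤ × ℤ)} {f : BiSeries R} (hf : SuppIn A f) : SuppIn A (-f) :=
  fun i j h => hf i j (fun h0 => h (by simp [h0]))

lemma SuppIn.sub {A : Set (ℤ × ℤ)} {f g : BiSeries R} (hf : SuppIn A f) (hg : SuppIn A g) :
    SuppIn A (f - g) := by
  rw [sub_eq_add_neg]; exact hf.add hg.neg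

lemma SuppIn.natCast_mul {A : Set (ℤ × ℤ)} {f : BiSeries R} (hf : SuppIn A f) (n : ℕ) :
    SuppIn A ((n : BiSeries R) * f) := by
  rw [natCast_mul_eq_smul]; exact hf.smul _

lemma SuppIn.intCast_mul {A : Set (ℤ × ℤ)} {f : BiSeries R} (hf : SuppIn A f) (n : ℤ) :
    SuppIn A ((n : BiSeries R) * f) := by
  rw [intCast_mul_eq_smul]; exact hf.smul _

lemma suppIn_mono {A : Set (ℤ × ℤ)} {a b : ℤ} (h : (a, b) ∈ A) : SuppIn A (mono a b : BiSeries R) := by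
  intro i j hij
  rw [cf_mono] at hij
  have : i = a ∧ j = b := by by_contra h; simp [h] at hij
  rw [this.1, this.2]; exact h

lemma SuppIn.mul {A B C : Set (ℤ × ℤ)} {f g : BiSeries R} (hf : SuppIn A f) (hg : SuppIn B g)
    (hC : ∀ a b a' b', (a, b) ∈ A → (a', b') ∈ B → (a + a', b + b') ∈ C) : SuppIn C (f * g) := by
  intro i j h
  have h1 : expo i j ∈ (f * g).support := h
  obtain ⟨u, hu, v, hv, huv⟩ := HahnSeries.support_mul_subset h1
  obtain ⟨a, b, rfl⟩ := expo_surj u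
  obtain ⟨a', b', rfl⟩ := expo_surj v
  have h2 : expo (a + a') (b + b') = expo i j := huv
  rw [expo_inj] at h2
  rw [← h2.1, ← h2.2]
  exact hC _ _ _ _ (hf a b hu) (hg a' b' hv)

lemma suppIn_one {A : Set (ℤ × ℤ)} (h : (0, 0) ∈ A) : SuppIn A (1 : BiSeries R) := by
  rw [← mono_zero]; exact suppIn_mono h

/-- In the lexicographic order every monomial x^i y^j with i > 0 is positive, whatever the sign of
j. This makes series such as 1 - x/y invertible. -/
lemma isUnit_of_cf_zero_zero {f : BiSeries R} (hf : ∀ i j, cf f i j ≠ 0 → 0 ≤ expo i j)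
    (h0 : IsUnit (cf f 0 0)) : IsUnit f := by
  rcases subsingleton_or_nontrivial R with hR | hR
  · exact isUnit_of_subsingleton f
  have hne : f.coeff 0 ≠ 0 := h0.ne_zero
  have hf0 : f ≠ 0 := by rintro rfl; exact hne rfl
  have ho : f.order = 0 := by
    apply le_antisymm
    · exact HahnSeries.order_le_of_coeff_ne_zero hne
    · rw [HahnSeries.le_order_iff_forall hf0]
      intro e he
      obtain ⟨i, j, rfl⟩ := expo_surj e
      by_contra hc
      exact absurd (hf i j hc) (not_le.mpr he)
  apply HahnSeries.isUnit_of_isUnit_leadingCoeff_AddUnitOrder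
  · rw [HahnSeries.leadingCoeff_eq, ho]; exact h0
  · rw [ho]; exact isAddUnit_zero

/-- The inverse of a series with unit coefficient of lowest order is supported in every
submonoid that contains its support. -/
lemma SuppIn.of_mul_eq_one {A : Set (ℤ × ℤ)} {f g : BiSeries R} (hfg : f * g = 1)
    (hf : ∀ i j, cf f i j ≠ 0 → 0 ≤ expo i j) (h0 : IsUnit (cf f 0 0)) (hfA : SuppIn A f)
    (hA0 : (0, 0) ∈ A) (hA : ∀ a b a' b', (a, b) ∈ A → (a', b') ∈ A → (a + a', b + b') ∈ A) :
    SuppIn A g := by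
  by_contra hcon
  set s : Set ExpLattice := {e | g.coeff e ≠ 0 ∧ ofLex e ∉ A} with hs
  have hsne : s.Nonempty := by
    simp only [SuppIn, not_forall] at hcon
    obtain ⟨i, j, h1, h2⟩ := hcon
    exact ⟨expo i j, h1, h2⟩
  have hwf : s.IsWF := g.isWF_support.mono fun e he => he.1
  obtain ⟨i, j, hm⟩ := expo_surj (hwf.min hsne)
  have hmem := hwf.min_mem hsne
  rw [hm] at hmem
  -- (i, j) is the least exponent of g outside A. Any further term of the convolution would use a
  -- smaller exponent of g, which lies in A, and its sum with an exponent of f would put (i, j) into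
  -- A.
  have hcoef : (f * g).coeff (expo i j) = f.coeff 0 * g.coeff (expo i j) := by
    rw [coeff_mul_eq_finsum, finsum_eq_single _ 0]
    · simp
    · intro b hb
      obtain ⟨a, c, rfl⟩ := expo_surj b
      by_contra hne
      have h1 := left_ne_zero_of_mul hne
      have h2 := right_ne_zero_of_mul hne
      have hpos : 0 < expo a c := lt_of_le_of_ne (hf a c h1) (Ne.symm hb)
      have h3 : ofLex (expo i j - expo a c) ∈ A := by
        by_contra h3
        have := hwf.min_le hsne (show expo i j - expo a c ∈ s from ⟨h2, h3⟩)
        rw [hm] at this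
        exact absurd this (not_le.mpr (sub_lt_self _ hpos))
      have h4 := hA _ _ _ _ h3 (hfA a c h1)
      apply hmem.2
      have : ofLex (expo i j) = ((i - a) + a, (j - c) + c) := by simp [expo]
      rw [this]; exact h4
  rw [hfg, HahnSeries.coeff_one] at hcoef
  split_ifs at hcoef with h
  · apply hmem.2; rw [h]; exact hA0
  · exact hmem.1 ((h0.mul_right_eq_zero).mp hcoef.symm)

/-- The part of `f` with exponents in `A`. -/
noncomputable def restrict (A : Set (ℤ × ℤ)) : BiSeries R →ₗ[R] BiSeries R := by
  classical
  exact
  { toFun := fun f => ⟨fun e => if ofLex e ∈ A then f.coeff e else 0,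
      f.isPWO_support.mono fun e he => by
        simp only [Function.mem_support, ne_eq, ite_eq_right_iff, not_forall] at he
        exact he.2⟩
    map_add' := fun f g => by
      ext e; by_cases h : ofLex e ∈ A <;> simp [h]
    map_smul' := fun c f => by
      ext e; by_cases h : ofLex e ∈ A <;> simp [h] }

open Classical in
lemma cf_restrict (A : Set (ℤ × ℤ)) (f : BiSeries R) (i j : ℤ) :
    cf (restrict A f) i j = if (i, j) ∈ A then cf f i j else 0 := by
  simp only [restrict, cf, expo]
  rfl

lemma cf_restrict_of_mem {A : Set (ℤ × ℤ)} (f : BiSeries R) {i j : ℤ} (h : (i, j) ∈ A) :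
    cf (restrict A f) i j = cf f i j := by simp [cf_restrict, h]

lemma cf_restrict_of_notMem {A : Set (ℤ × ℤ)} (f : BiSeries R) {i j : ℤ} (h : (i, j) ∉ A) :
    cf (restrict A f) i j = 0 := by simp [cf_restrict, h]

lemma suppIn_restrict (A : Set (ℤ × ℤ)) (f : BiSeries R) : SuppIn A (restrict A f) := by
  intro i j h
  by_contra hA
  exact h (cf_restrict_of_notMem f hA)

lemma suppIn_restrict_inter {A B : Set (ℤ × ℤ)} {f : BiSeries R} (hf : SuppIn B f) :
    SuppIn (A ∩ B) (restrict A f) := by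
  intro i j h
  have hA := suppIn_restrict A f i j h
  rw [cf_restrict_of_mem f hA] at h
  exact ⟨hA, hf i j h⟩

/-- Among sums of exponents of f and g, those in C are exactly the sums of an element of A' and one
of B'. For faces of polygons this expresses the multiplicativity of leading forms. -/
lemma restrict_mul {A B A' B' C : Set (ℤ × ℤ)} {f g : BiSeries R} (hf : SuppIn A f)
    (hg : SuppIn B g)
    (h : ∀ a b a' b', (a, b) ∈ A → (a', b') ∈ B →
      ((a + a', b + b') ∈ C ↔ (a, b) ∈ A' ∧ (a', b') ∈ B')) :
    restrict C (f * g) = restrict A' f * restrict B' g := by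
  classical
  apply ext_cf
  intro i j
  rw [cf_restrict]
  have key : ∀ e : ExpLattice, (restrict A' f).coeff e * (restrict B' g).coeff (expo i j - e) =
      if (i, j) ∈ C then f.coeff e * g.coeff (expo i j - e) else 0 := by
    intro e
    obtain ⟨a, b, rfl⟩ := expo_surj e
    rw [expo_sub]
    change cf (restrict A' f) a b * cf (restrict B' g) (i - a) (j - b) =
      if (i, j) ∈ C then cf f a b * cf g (i - a) (j - b) else 0
    by_cases hz : cf f a b = 0
    · simp [cf_restrict, hz]
    by_cases hz' : cf g (i - a) (j - b) = 0
    · simp [cf_restrict, hz']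
    have h1 := h a b _ _ (hf a b hz) (hg _ _ hz')
    simp only [add_sub_cancel] at h1
    simp only [cf_restrict]
    by_cases h2 : (i, j) ∈ C
    · rw [if_pos h2, if_pos (h1.mp h2).1, if_pos (h1.mp h2).2]
    · rw [if_neg h2]
      by_cases h3 : (a, b) ∈ A'
      · rw [if_neg (c := (i - a, j - b) ∈ B') (fun h4 => h2 (h1.mpr ⟨h3, h4⟩))]; simp
      · rw [if_neg h3]; simp
  simp only [cf]
  rw [coeff_mul_eq_finsum, coeff_mul_eq_finsum, finsum_congr key]
  split_ifs <;> simp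

/-- The derivation `y * ∂/∂y`. -/
noncomputable def theta : Derivation R (BiSeries R) (BiSeries R) :=
  Derivation.mk'
    { toFun := fun f => ⟨fun e => ((ofLex e).2 : R) * f.coeff e,
        f.isPWO_support.mono fun e he => right_ne_zero_of_mul he⟩
      map_add' := fun f g => by ext e; simp [mul_add]
      map_smul' := fun c f => by ext e; simp [mul_left_comm] }
    (by
      intro f g
      ext e
      have h1 : ∀ b : ExpLattice, f.coeff b * (((ofLex (e - b)).2 : R) * g.coeff (e - b)) ≠ 0 →
          f.coeff b * g.coeff (e - b) ≠ 0 := fun b hb h0 => hb (by rw [mul_left_comm, h0, mul_zero])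
      have h2 : ∀ b : ExpLattice, g.coeff (e - b) * (((ofLex b).2 : R) * f.coeff b) ≠ 0 →
          f.coeff b * g.coeff (e - b) ≠ 0 := fun b hb h0 => hb (by
            rw [mul_left_comm, mul_comm (g.coeff _), h0, mul_zero])
      simp only [LinearMap.coe_mk, AddHom.coe_mk, smul_eq_mul, HahnSeries.coeff_add]
      rw [coeff_mul_eq_finsum, coeff_mul_eq_finsum, mul_comm g, coeff_mul_eq_finsum]
      simp only
      rw [← finsum_add_distrib ((finite_mul_support f g e).subset h1)
        ((finite_mul_support f g e).subset fun b hb => h2 b (by rwa [mul_comm])), 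
        ← smul_eq_mul, smul_finsum' _ (finite_mul_support f g e)]
      refine finsum_congr fun b => ?_
      have : ((ofLex e).2 : R) = ((ofLex b).2 : R) + ((ofLex (e - b)).2 : R) := by
        rw [← Int.cast_add]; congr 1; simp
      rw [smul_eq_mul, this]; ring)

@[simp] lemma cf_theta (f : BiSeries R) (i j : ℤ) : cf (theta f) i j = (j : R) * cf f i j := rfl

lemma SuppIn.theta {A : Set (ℤ × ℤ)} {f : BiSeries R} (hf : SuppIn A f) : SuppIn A (theta f) :=
  fun i j h => hf i j (right_ne_zero_of_mul h)

lemma theta_mono (a b : ℤ) : theta (mono a b : BiSeries R) = (b : BiSeries R) * mono a b := by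
  apply ext_cf
  intro i j
  rw [cf_theta, cf_intCast_mul, cf_mono]
  split_ifs with h
  · rw [h.2]
  · simp

lemma expo_mul_strictMono {q : ℕ} (hq : 0 < q) (r : ℤ) :
    StrictMono fun e : ExpLattice => expo (q * (ofLex e).1 + r) (q * (ofLex e).2) := by
  intro e e' h
  obtain ⟨a, b, rfl⟩ := expo_surj e
  obtain ⟨a', b', rfl⟩ := expo_surj e'
  rw [expo_lt] at h
  simp only [expo, ofLex_toLex]
  change expo _ _ < expo _ _
  rw [expo_lt]
  have hq' : (0 : ℤ) < q := by exact_mod_cast hq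
  rcases h with h | ⟨h, h'⟩
  · left; nlinarith
  · right; exact ⟨by rw [h], by nlinarith⟩

/-- The section operator: the coefficient of `x ^ i * y ^ j` in `sect q r f` is the coefficient
of `x ^ (q * i + r) * y ^ (q * j)` in `f`. -/
noncomputable def sect (q : ℕ) [NeZero q] (r : ℤ) : BiSeries R →ₗ[R] BiSeries R where
  toFun f := ⟨fun e => f.coeff (expo (q * (ofLex e).1 + r) (q * (ofLex e).2)), by
    have hm := expo_mul_strictMono (NeZero.pos q) r
    intro u
    obtain ⟨m, n, hmn, hle⟩ := f.isPWO_support (fun k => ⟨expo (q * (ofLex (u k).1).1 + r)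
      (q * (ofLex (u k).1).2), (u k).2⟩)
    exact ⟨m, n, hmn, hm.le_iff_le.mp hle⟩⟩
  map_add' f g := by ext e; simp
  map_smul' c f := by ext e; simp

@[simp] lemma cf_sect (q : ℕ) [NeZero q] (r : ℤ) (f : BiSeries R) (i j : ℤ) :
    cf (sect q r f) i j = cf f (q * i + r) (q * j) := rfl

/-- The substitution of `x ^ q` for `x` and of `y ^ q` for `y`. -/
noncomputable def expand (q : ℕ) [NeZero q] : BiSeries R →+* BiSeries R :=
  HahnSeries.embDomainRingHom (nsmulAddMonoidHom q : ExpLattice →+ ExpLattice)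
    (by
      intro a b h
      obtain ⟨i, j, rfl⟩ := expo_surj a
      obtain ⟨i', j', rfl⟩ := expo_surj b
      change q • expo i j = q • expo i' j' at h
      rw [nsmul_expo, nsmul_expo, expo_inj] at h
      have : (q : ℤ) ≠ 0 := by exact_mod_cast NeZero.ne q
      rw [mul_right_inj' this, mul_right_inj' this] at h
      rw [h.1, h.2])
    (by
      intro a b
      obtain ⟨i, j, rfl⟩ := expo_surj a
      obtain ⟨i', j', rfl⟩ := expo_surj b
      have := (expo_mul_strictMono (NeZero.pos q) 0).le_iff_le (a := expo i j) (b := expo i' j')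
      simp only [add_zero] at this
      change q • expo i j ≤ q • expo i' j' ↔ _
      rw [nsmul_expo, nsmul_expo]
      exact this)

lemma cf_expand_mul (q : ℕ) [NeZero q] (f : BiSeries R) (i j : ℤ) :
    cf (expand q f) (q * i) (q * j) = cf f i j := by
  have : expo (q * i) (q * j) = q • expo i j := (nsmul_expo q i j).symm
  rw [cf, this]
  exact HahnSeries.embDomain_coeff ..

lemma coeff_expand_of_notMem (q : ℕ) [NeZero q] (f : BiSeries R) {e : ExpLattice}
    (h : ∀ i j : ℤ, expo (q * i) (q * j) ≠ e) : (expand q f).coeff e = 0 := by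
  apply HahnSeries.embDomain_of_notMem_range
  rintro ⟨e', he'⟩
  obtain ⟨i, j, rfl⟩ := expo_surj e'
  apply h i j
  rw [← nsmul_expo]
  exact he'

lemma expand_single (q : ℕ) [NeZero q] (i j : ℤ) (c : R) :
    expand q (HahnSeries.single (expo i j) c) = HahnSeries.single (expo (q * i) (q * j)) c := by
  rw [← nsmul_expo]
  exact HahnSeries.embDomain_single

/-- The projection formula for Cartier operators: a series in x^q and y^q only shifts exponents by
multiples of q, so it leaves the section unharmed. -/
lemma sect_expand_mul (q : ℕ) [NeZero q] (r : ℤ) (f g : BiSeries R) :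
    sect q r (expand q f * g) = f * sect q r g := by
  apply ext_cf
  intro i j
  rw [cf_sect]
  simp only [cf]
  rw [coeff_mul_eq_finsum, coeff_mul_eq_finsum]
  have hq : (q : ℤ) ≠ 0 := by exact_mod_cast NeZero.ne q
  let ψ : ExpLattice → ExpLattice := fun e => q • e
  have hψ : Function.Injective ψ := by
    intro a b h
    obtain ⟨i, j, rfl⟩ := expo_surj a
    obtain ⟨i', j', rfl⟩ := expo_surj b
    simp only [ψ] at h
    rw [nsmul_expo, nsmul_expo, expo_inj] at h
    rw [mul_right_inj' hq, mul_right_inj' hq] at h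
    rw [h.1, h.2]
  have h1 : (Function.support fun b => (expand q f).coeff b *
      g.coeff (expo (q * i + r) (q * j) - b)) ⊆ Set.range ψ := by
    intro e he
    by_contra hne
    apply left_ne_zero_of_mul he
    apply coeff_expand_of_notMem
    intro a b hab
    exact hne ⟨expo a b, by simp only [ψ]; rw [nsmul_expo]; exact hab⟩
  rw [← finsum_mem_univ, finsum_mem_inter_support_eq _ _ (Set.range ψ) (by rw [Set.univ_inter, Set.inter_eq_right.mpr h1]),
    finsum_mem_range hψ]
  refine finsum_congr fun e => ?_
  obtain ⟨a, b, rfl⟩ := expo_surj e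
  simp only [ψ]
  rw [nsmul_expo, expo_sub, expo_sub,
    show q * i + r - q * a = q * (i - a) + r by ring, show q * j - q * b = q * (j - b) by ring]
  congr 1
  exact cf_expand_mul q f a b

/-- The map on series induced by a ring homomorphism of the coefficients. -/
noncomputable def mapHom (φ : R →+* S) : BiSeries R →+* BiSeries S where
  toFun f := f.map φ
  map_zero' := by ext; simp
  map_one' := by
    ext e
    simp only [HahnSeries.map_coeff, HahnSeries.coeff_one]
    split_ifs <;> simp
  map_add' f g := by ext; simp
  map_mul' f g := HahnSeries.map_mul (φ : R →ₙ+* S)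

@[simp] lemma cf_mapHom (φ : R →+* S) (f : BiSeries R) (i j : ℤ) :
    cf (mapHom φ f) i j = φ (cf f i j) := rfl

lemma SuppIn.mapHom {A : Set (ℤ × ℤ)} {f : BiSeries R} (hf : SuppIn A f) (φ : R →+* S) :
    SuppIn A (mapHom φ f) :=
  fun i j h => hf i j (fun h0 => h (by rw [cf_mapHom, h0, map_zero]))

lemma mapHom_mono (φ : R →+* S) (a b : ℤ) : mapHom φ (mono a b) = mono a b := by
  apply ext_cf
  intro i j
  rw [cf_mapHom, cf_mono, cf_mono]
  split_ifs <;> simp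

lemma mapHom_theta (φ : R →+* S) (f : BiSeries R) : mapHom φ (theta f) = theta (mapHom φ f) := by
  apply ext_cf
  intro i j
  simp

/-- A series all of whose coefficients are multiples of `c` is a multiple of `c`. -/
lemma exists_eq_smul {c : R} {f : BiSeries R} (h : ∀ i j, c ∣ cf f i j) :
    ∃ g : BiSeries R, f = c • g ∧ ∀ A, SuppIn A f → SuppIn A g := by
  classical
  choose k hk using h
  refine ⟨⟨fun e => if f.coeff e = 0 then 0 else k (ofLex e).1 (ofLex e).2,
    f.isPWO_support.mono fun e he => ?_⟩, ?_, ?_⟩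
  · intro h0; simp [h0] at he
  · apply ext_cf
    intro i j
    rw [cf_smul]
    simp only [cf]
    split_ifs with h0
    · simp [h0]
    · exact hk i j
  · intro A hA i j hij
    apply hA i j
    intro h0
    apply hij
    simp only [cf] at h0 ⊢
    simp [h0]

end BiSeries

/-! ### Fractions with denominator a power of Q, and their sections -/

namespace BiSeries

variable {R : Type*} [CommRing R]

lemma SuppIn.finite {A : Set (ℤ × ℤ)} (hA : A.Finite) {f : BiSeries R} (hf : SuppIn A f) :
    f.support.Finite := by
  refine (hA.image toLex).subset fun e he => ?_
  obtain ⟨i, j, rfl⟩ := expo_surj e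
  exact ⟨(i, j), hf i j he, rfl⟩

lemma eq_sum_single {f : BiSeries R} (hf : f.support.Finite) :
    f = ∑ e ∈ hf.toFinset, HahnSeries.single e (f.coeff e) := by
  classical
  ext e
  rw [HahnSeries.coeff_sum]
  simp only [HahnSeries.coeff_single]
  refine ((Finset.sum_eq_single e (fun b _ hb => if_neg (Ne.symm hb))
    (fun h => ?_)).trans (if_pos rfl)).symm
  rw [if_pos rfl]
  simpa using h

/-- Frobenius is additive in characteristic p and fixes the coefficients in the prime field. -/
lemma pow_eq_expand {p : ℕ} [Fact p.Prime] (t : ℕ) [NeZero (p ^ t)] {f : BiSeries (ZMod p)}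
    (hf : f.support.Finite) : f ^ p ^ t = expand (p ^ t) f := by
  have : CharP (BiSeries (ZMod p)) p := by
    refine ⟨fun x => ?_⟩
    rw [← CharP.cast_eq_zero_iff (ZMod p) p, ← HahnSeries.single_zero_natCast,
      HahnSeries.single_eq_zero_iff]
  conv_lhs => rw [eq_sum_single hf]
  conv_rhs => rw [eq_sum_single hf]
  rw [sum_pow_char_pow, map_sum]
  refine Finset.sum_congr rfl fun e _ => ?_
  obtain ⟨i, j, rfl⟩ := expo_surj e
  rw [HahnSeries.single_pow, expand_single, nsmul_expo, ZMod.pow_card_pow]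

lemma mapHom_expand {S : Type*} [CommRing S] (φ : R →+* S) (q : ℕ) [NeZero q] (f : BiSeries R) :
    mapHom φ (expand q f) = expand q (mapHom φ f) := by
  ext e
  change φ ((expand q f).coeff e) = _
  by_cases h : ∃ i j : ℤ, expo (q * i) (q * j) = e
  · obtain ⟨i, j, rfl⟩ := h
    change φ (cf (expand q f) _ _) = cf (expand q _) _ _
    rw [cf_expand_mul, cf_expand_mul, cf_mapHom]
  · push Not at h
    rw [coeff_expand_of_notMem q f h, coeff_expand_of_notMem q _ h, map_zero]

/-- The lattice points of the `n`th dilate of the polygon of the monomials `x ^ a * y ^ b` with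
`0 ≤ a ≤ h`, `-1 ≤ b ≤ d - 1` and `0 ≤ a + b`. -/
def newt (h d n : ℤ) : Set (ℤ × ℤ) :=
  {e | 0 ≤ e.1 ∧ e.1 ≤ n * h ∧ -n ≤ e.2 ∧ e.2 ≤ n * (d - 1) ∧ 0 ≤ e.1 + e.2}

/-- The exponents of the numerators of the fractions with denominator `Q ^ K`, for degrees that
exceed the regular ones by `ε` in `x` and by `η` in `y`. -/
def box (h d K ε η : ℤ) : Set (ℤ × ℤ) :=
  {e | 0 ≤ e.1 ∧ e.1 ≤ K * h + ε ∧ -K < e.2 ∧ e.2 ≤ K * (d - 1) + η ∧ 0 ≤ e.1 + e.2}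

lemma newt_finite (h d n : ℤ) : (newt h d n).Finite := by
  refine ((Set.finite_Icc 0 (n * h)).prod (Set.finite_Icc (-n) (n * (d - 1)))).subset ?_
  rintro ⟨a, b⟩ ⟨h1, h2, h3, h4, -⟩
  exact ⟨⟨h1, h2⟩, ⟨h3, h4⟩⟩

lemma box_finite (h d K ε η : ℤ) : (box h d K ε η).Finite := by
  refine ((Set.finite_Icc 0 (K * h + ε)).prod (Set.finite_Icc (-K) (K * (d - 1) + η))).subset ?_
  rintro ⟨a, b⟩ ⟨h1, h2, h3, h4, -⟩
  exact ⟨⟨h1, h2⟩, ⟨h3.le, h4⟩⟩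

lemma SuppIn.pow_newt {h d m : ℤ} {f : BiSeries R} (hf : SuppIn (newt h d m) f) (n : ℕ) :
    SuppIn (newt h d (n * m)) (f ^ n) := by
  induction n with
  | zero => rw [pow_zero]; exact suppIn_one (by simp [newt])
  | succ n ih =>
    rw [pow_succ]
    refine ih.mul hf ?_
    rintro a b a' b' ⟨h1, h2, h3, h4, h5⟩ ⟨g1, g2, g3, g4, g5⟩
    simp only at *
    push_cast
    refine ⟨by omega, ?_, ?_, ?_, by simp only; omega⟩
    · simp only; rw [add_mul, one_mul, add_mul]; omega
    · simp only; rw [add_mul, one_mul]; omega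
    · simp only; rw [add_mul, one_mul, add_mul]; omega

lemma SuppIn.mul_newt {h d m n : ℤ} {f g : BiSeries R} (hf : SuppIn (newt h d m) f)
    (hg : SuppIn (newt h d n) g) : SuppIn (newt h d (m + n)) (f * g) := by
  refine hf.mul hg ?_
  rintro a b a' b' ⟨h1, h2, h3, h4, h5⟩ ⟨g1, g2, g3, g4, g5⟩
  simp only at *
  refine ⟨by simp only; omega, ?_, by simp only; omega, ?_, by simp only; omega⟩
  · simp only; rw [add_mul]; omega
  · simp only; rw [add_mul]; omega

lemma SuppIn.box_mul_newt {h d K ε η n : ℤ} {f g : BiSeries R} (hf : SuppIn (box h d K ε η) f)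
    (hg : SuppIn (newt h d n) g) : SuppIn (box h d (K + n) ε η) (f * g) := by
  refine hf.mul hg ?_
  rintro a b a' b' ⟨h1, h2, h3, h4, h5⟩ ⟨g1, g2, g3, g4, g5⟩
  simp only at *
  refine ⟨by simp only; omega, ?_, by simp only; omega, ?_, by simp only; omega⟩
  · simp only; rw [add_mul]; omega
  · simp only; rw [add_mul]; omega

lemma SuppIn.expand_newt {h d : ℤ} {f : BiSeries R} (hf : SuppIn (newt h d 1) f) (q : ℕ)
    [NeZero q] : SuppIn (newt h d q) (expand q f) := by
  intro i j hij
  by_cases hc : ∃ a b : ℤ, expo (q * a) (q * b) = expo i j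
  · obtain ⟨a, b, hab⟩ := hc
    rw [expo_inj] at hab
    rw [← hab.1, ← hab.2, cf_expand_mul] at hij
    obtain ⟨h1, h2, h3, h4, h5⟩ := hf a b hij
    simp only at *
    rw [← hab.1, ← hab.2]
    have hq : (0 : ℤ) ≤ q := by positivity
    refine ⟨by positivity, ?_, ?_, ?_, ?_⟩
    · simp only; nlinarith
    · simp only; nlinarith
    · simp only; nlinarith
    · simp only; nlinarith
  · push Not at hc
    exact absurd (coeff_expand_of_notMem q f hc) hij

lemma SuppIn.sect_box {h d K ε η : ℤ} (q : ℕ) [NeZero q] {r : ℤ} (hrq : r < q)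
    {f : BiSeries R} (hf : SuppIn {e | 0 ≤ e.1 ∧ e.1 ≤ q * K * h + ε ∧ -(q * K) < e.2 ∧
      e.2 ≤ q * K * (d - 1) + η ∧ 0 ≤ e.1 + e.2} f) :
    SuppIn (box h d K ((ε - r) / q) (η / q)) (sect q r f) := by
  intro i j hij
  rw [cf_sect] at hij
  obtain ⟨h1, h2, h3, h4, h5⟩ := hf _ _ hij
  simp only at h1 h2 h3 h4 h5
  have hq : (0 : ℤ) < q := by exact_mod_cast NeZero.pos q
  refine ⟨?_, ?_, ?_, ?_, ?_⟩
  · simp only; by_contra hn; nlinarith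
  · simp only
    have : i - K * h ≤ (ε - r) / q := by
      rw [Int.le_ediv_iff_mul_le hq]; nlinarith
    linarith
  · simp only; by_contra hn; nlinarith
  · simp only
    have : j - K * (d - 1) ≤ η / q := by
      rw [Int.le_ediv_iff_mul_le hq]; nlinarith
    linarith
  · simp only; by_contra hn; nlinarith

/-- The fractions `c * S / Q ^ K` with numerators `S` supported in `B`; here `Qi` is the inverse
of `Q`. -/
def fracs (Qi : BiSeries R) (c : R) (K : ℕ) (B : Set (ℤ × ℤ)) : Submodule R (BiSeries R) where
  carrier := {f | ∃ S, SuppIn B S ∧ f = c • (S * Qi ^ K)}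
  zero_mem' := ⟨0, suppIn_zero B, by simp⟩
  add_mem' := by
    rintro _ _ ⟨S, hS, rfl⟩ ⟨T, hT, rfl⟩
    exact ⟨S + T, hS.add hT, by rw [add_mul, smul_add]⟩
  smul_mem' := by
    rintro a _ ⟨S, hS, rfl⟩
    exact ⟨a • S, hS.smul a, by rw [smul_mul_assoc, smul_comm]⟩

lemma fracs_mono (Qi : BiSeries R) (c : R) (K : ℕ) {A B : Set (ℤ × ℤ)} (h : A ⊆ B) :
    fracs Qi c K A ≤ fracs Qi c K B := by
  rintro _ ⟨S, hS, rfl⟩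
  exact ⟨S, hS.mono h, rfl⟩

/-- The fractions with denominator `Q ^ K` are fractions with denominator `Q ^ (K + n)`. -/
lemma fracs_le_add {h d : ℤ} {Q Qi : BiSeries R} (hQ : SuppIn (newt h d 1) Q) (hQi : Q * Qi = 1)
    (c : R) (K n : ℕ) (ε η : ℤ) :
    fracs Qi c K (box h d K ε η) ≤ fracs Qi c (K + n) (box h d (K + n : ℕ) ε η) := by
  rintro _ ⟨S, hS, rfl⟩
  refine ⟨S * Q ^ n, ?_, ?_⟩
  · have := hS.box_mul_newt (hQ.pow_newt n)
    rw [mul_one] at this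
    exact_mod_cast this
  · rw [pow_add, ← mul_assoc, mul_assoc S, mul_comm (Q ^ n), ← mul_assoc, mul_assoc (S * Qi ^ K),
      ← mul_pow, hQi, one_pow, mul_one]

section ZModPow

variable {p : ℕ} [hp : Fact p.Prime] {α : ℕ}

lemma dvd_iff_castHom_eq_zero (hα : α ≠ 0) (x : ZMod (p ^ α)) :
    (p : ZMod (p ^ α)) ∣ x ↔ ZMod.castHom (dvd_pow_self p hα) (ZMod p) x = 0 := by
  constructor
  · rintro ⟨y, rfl⟩
    rw [map_mul, map_natCast, ZMod.natCast_self, zero_mul]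
  · intro hx
    obtain ⟨n, rfl⟩ := ZMod.natCast_zmod_surjective x
    rw [map_natCast, ZMod.natCast_eq_zero_iff] at hx
    exact_mod_cast Nat.cast_dvd_cast (α := ZMod (p ^ α)) hx

/-- The Frobenius congruence. -/
lemma exists_pow_eq_expand_add (hα : α ≠ 0) (t : ℕ) [NeZero (p ^ t)] {h d : ℤ}
    {Q : BiSeries (ZMod (p ^ α))} (hQ : SuppIn (newt h d 1) Q) :
    ∃ M : BiSeries (ZMod (p ^ α)), SuppIn (newt h d (p ^ t : ℕ)) M ∧
      Q ^ p ^ t = expand (p ^ t) Q + (p : BiSeries (ZMod (p ^ α))) * M := by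
  have h1 : mapHom (ZMod.castHom (dvd_pow_self p hα) (ZMod p)) (Q ^ p ^ t - expand (p ^ t) Q) = 0 := by
    rw [map_sub, map_pow, mapHom_expand, pow_eq_expand t ((hQ.mapHom _).finite (newt_finite h d 1)),
      sub_self]
  obtain ⟨M, hM, hMA⟩ := exists_eq_smul (c := (p : ZMod (p ^ α)))
    (f := Q ^ p ^ t - expand (p ^ t) Q) (fun i j => by
      rw [dvd_iff_castHom_eq_zero hα, ← cf_mapHom, h1, cf_zero])
  refine ⟨M, ?_, ?_⟩
  · apply hMA
    refine SuppIn.sub ?_ (hQ.expand_newt _)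
    have := hQ.pow_newt (p ^ t)
    rwa [mul_one] at this
  · rw [natCast_mul_eq_smul, ← hM]; ring

/-- Elements congruent modulo p have p^(α-1)-th powers congruent modulo p^α, and p^α = 0 here. -/
lemma pow_eq_expand_pow (hα : α ≠ 0) (t : ℕ) [NeZero (p ^ t)] {h d : ℤ}
    {Q : BiSeries (ZMod (p ^ α))} (hQ : SuppIn (newt h d 1) Q) :
    Q ^ (p ^ t * p ^ (α - 1)) = expand (p ^ t) Q ^ p ^ (α - 1) := by
  obtain ⟨M, -, hM⟩ := exists_pow_eq_expand_add hα t hQ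
  have h1 : (p : BiSeries (ZMod (p ^ α))) ∣ Q ^ p ^ t - expand (p ^ t) Q := ⟨M, by rw [hM]; ring⟩
  have h2 := dvd_sub_pow_of_dvd_sub h1 (α - 1)
  rw [Nat.sub_add_cancel (Nat.pos_of_ne_zero hα)] at h2
  have h3 : (p : BiSeries (ZMod (p ^ α))) ^ α = 0 := by
    rw [← Nat.cast_pow, ← HahnSeries.single_zero_natCast]; simp
  rw [h3, zero_dvd_iff, sub_eq_zero, ← pow_mul] at h2
  exact h2

/-- Sections of fractions are combinations of fractions with smaller excess degrees. -/
lemma sect_mem_iSup_fracs (hα : α ≠ 0) (t : ℕ) [NeZero (p ^ t)] {h d : ℤ}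
    {Q Qi : BiSeries (ZMod (p ^ α))} (hQ : SuppIn (newt h d 1) Q) (hQi : Q * Qi = 1)
    {K : ℕ} (hK : K ≤ p ^ (α - 1)) {r : ℤ} (hrq : r < (p ^ t : ℕ))
    (c : ℕ) (ε η : ℤ) {f : BiSeries (ZMod (p ^ α))}
    (hf : f ∈ fracs Qi ((p : ZMod (p ^ α)) ^ c) K (box h d K ε η)) :
    sect (p ^ t) r f ∈ ⨆ i : ℕ, fracs Qi ((p : ZMod (p ^ α)) ^ (c + i)) (K + i)
      (box h d (K + i : ℕ) ((ε - r) / (p ^ t : ℕ)) (η / (p ^ t : ℕ))) := by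
  obtain ⟨S, hS, rfl⟩ := hf
  obtain ⟨M, hM, hQM⟩ := exists_pow_eq_expand_add hα t hQ
  have hQD := pow_eq_expand_pow hα t hQ
  generalize p ^ t = q at *
  generalize p ^ (α - 1) = D at *
  obtain ⟨n, hn⟩ := Nat.exists_eq_add_of_le hK
  have hq1 : 1 ≤ q := NeZero.pos q
  have hEE : expand q Q * expand q Qi = 1 := by rw [← map_mul, hQi, map_one]
  -- With D = p^(α-1), Qi^K equals Q^(qD-K) divided by Q(x^q, y^q)^D. Since qD - K = q(D - K) + (q -
  -- 1)K, the numerator is (Q(x^q, y^q) + pM)^(D-K) Q^((q-1)K), and the binomial theorem applies.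
  have h1 : Qi ^ K = (∑ i ∈ Finset.range (n + 1),
      expand q (Qi ^ (K + i)) * ((n.choose i : BiSeries (ZMod (p ^ α))) * (p : BiSeries (ZMod (p ^ α))) ^ i
        * (M ^ i * Q ^ ((q - 1) * K)))) := by
    have h2 : Q ^ (q * D - K) = (expand q Q + (p : BiSeries (ZMod (p ^ α))) * M) ^ n * Q ^ ((q - 1) * K) := by
      rw [← hQM, ← pow_mul Q q n, ← pow_add]
      congr 1
      rw [hn, Nat.sub_mul, mul_add, one_mul]
      have : K ≤ q * K := Nat.le_mul_of_pos_left _ hq1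
      omega
    have h3 : Qi ^ K = Q ^ (q * D - K) * expand q Qi ^ D := by
      have h4 : expand q Qi ^ D = Qi ^ (q * D) := by
        have h5 : Q ^ (q * D) * Qi ^ (q * D) = 1 := by rw [← mul_pow, hQi, one_pow]
        have h6 : Q ^ (q * D) * expand q Qi ^ D = 1 := by rw [hQD, ← mul_pow, hEE, one_pow]
        calc expand q Qi ^ D = (Q ^ (q * D) * Qi ^ (q * D)) * expand q Qi ^ D := by
              rw [h5, one_mul]
          _ = (Q ^ (q * D) * expand q Qi ^ D) * Qi ^ (q * D) := by ring
          _ = Qi ^ (q * D) := by rw [h6, one_mul]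
      rw [h4]
      have h7 : q * D = (q * D - K) + K := by
        have : K ≤ q * D := hK.trans (Nat.le_mul_of_pos_left _ hq1)
        omega
      conv_rhs => rw [h7]
      rw [Nat.add_sub_cancel, pow_add, ← mul_assoc, ← mul_pow, hQi, one_pow, one_mul]
    rw [h3, h2, add_comm, add_pow, Finset.sum_mul, Finset.sum_mul]
    refine Finset.sum_congr rfl fun i hi => ?_
    have hi' : i ≤ n := Nat.lt_succ_iff.mp (Finset.mem_range.mp hi)
    have h8 : expand q Q ^ (n - i) * expand q Qi ^ D = expand q (Qi ^ (K + i)) := by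
      rw [show D = (n - i) + (K + i) by omega, pow_add, ← mul_assoc, ← mul_pow, hEE, one_pow,
        one_mul, map_pow]
    rw [← h8]; ring
  rw [h1, Finset.mul_sum, Finset.smul_sum, map_sum]
  refine Submodule.sum_mem _ fun i _ => ?_
  refine Submodule.mem_iSup_of_mem i ?_
  have h2 : (p : ZMod (p ^ α)) ^ c • (S * (expand q (Qi ^ (K + i)) * ((n.choose i : BiSeries (ZMod (p ^ α)))
      * (p : BiSeries (ZMod (p ^ α))) ^ i * (M ^ i * Q ^ ((q - 1) * K))))) =
      ((n.choose i : ZMod (p ^ α)) * (p : ZMod (p ^ α)) ^ (c + i)) •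
        (expand q (Qi ^ (K + i)) * (S * (M ^ i * Q ^ ((q - 1) * K)))) := by
    have h5 : ∀ (m : ℕ) (g : BiSeries (ZMod (p ^ α))), (p : ZMod (p ^ α)) ^ m • g =
        (p : BiSeries (ZMod (p ^ α))) ^ m * g := fun m g => by
      rw [← Nat.cast_pow, ← natCast_mul_eq_smul, Nat.cast_pow]
    rw [← smul_smul, h5, h5, ← natCast_mul_eq_smul, pow_add _ c i]
    ring
  rw [h2, map_smul, sect_expand_mul, mul_smul]
  refine Submodule.smul_mem _ _ ⟨_, SuppIn.sect_box q hrq ?_, by rw [mul_comm]⟩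
  have h3 := hS.box_mul_newt ((hM.pow_newt i).mul_newt (hQ.pow_newt ((q - 1) * K)))
  refine h3.mono ?_
  -- The dilation factors add up to K + iq + (q - 1)K = q(K + i), so that the section of the
  -- numerator lands in the box of Q^(K+i).
  have h4 : (K : ℤ) + ((i : ℤ) * (q : ℕ) + (((q - 1) * K : ℕ) : ℤ) * 1) = q * (K + i : ℕ) := by
    push_cast [Nat.cast_sub hq1]; ring
  rw [h4]
  rintro ⟨a, b⟩ ⟨g1, g2, g3, g4, g5⟩
  exact ⟨g1, g2, g3, g4, g5⟩

end ZModPow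

end BiSeries

/-! ### Furstenberg's theorem -/

namespace BiSeries

variable {R : Type*} [CommRing R]

/-- The exponents of the powers of `x`. -/
def xExpo : ℕ →+ ExpLattice where
  toFun n := expo n 0
  map_zero' := rfl
  map_add' a b := by simp

/-- The inclusion of the power series in `x`. -/
noncomputable def ofPowerSeries : PowerSeries R →+* BiSeries R :=
  (HahnSeries.embDomainRingHom xExpo
    (fun a b h => by
      change expo a 0 = expo b 0 at h
      rw [expo_inj] at h
      exact_mod_cast h.1)
    (fun a b => by
      change expo a 0 ≤ expo b 0 ↔ _
      rw [expo_le]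
      omega)).comp
    (HahnSeries.toPowerSeries (R := R)).symm.toRingHom

lemma cf_ofPowerSeries_natCast (F : PowerSeries R) (n : ℕ) :
    cf (ofPowerSeries F) n 0 = PowerSeries.coeff n F :=
  (HahnSeries.embDomain_coeff ..).trans (HahnSeries.coeff_toPowerSeries_symm ..)

lemma cf_ofPowerSeries_of_ne (F : PowerSeries R) {i j : ℤ} (h : ¬ (0 ≤ i ∧ j = 0)) :
    cf (ofPowerSeries F) i j = 0 := by
  apply HahnSeries.embDomain_of_notMem_range
  rintro ⟨n, hn⟩
  change expo n 0 = expo i j at hn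
  rw [expo_inj] at hn
  omega

lemma suppIn_ofPowerSeries (F : PowerSeries R) :
    SuppIn {e | 0 ≤ e.1 ∧ e.2 = 0} (ofPowerSeries F) := by
  intro i j h
  by_contra hc
  exact h (cf_ofPowerSeries_of_ne F hc)

/-- The inclusion of the polynomials in `y` over the power series in `x`. -/
noncomputable def ofPolynomial : Polynomial (PowerSeries R) →+* BiSeries R :=
  Polynomial.eval₂RingHom ofPowerSeries (mono 0 1)

lemma ofPolynomial_eq_sum (U : Polynomial (PowerSeries R)) :
    ofPolynomial U = ∑ m ∈ U.support, mono 0 m * ofPowerSeries (U.coeff m) := by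
  rw [ofPolynomial, Polynomial.coe_eval₂RingHom, Polynomial.eval₂_eq_sum, Polynomial.sum]
  refine Finset.sum_congr rfl fun m _ => ?_
  rw [mono_pow, mul_comm]
  simp

lemma cf_ofPolynomial_natCast (U : Polynomial (PowerSeries R)) (n m : ℕ) :
    cf (ofPolynomial U) n m = PowerSeries.coeff n (U.coeff m) := by
  rw [ofPolynomial_eq_sum, cf_sum, Finset.sum_eq_single m]
  · rw [cf_mono_mul, sub_zero, sub_self, cf_ofPowerSeries_natCast]
  · intro k _ hk
    rw [cf_mono_mul, cf_ofPowerSeries_of_ne]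
    omega
  · intro hm
    rw [Polynomial.notMem_support_iff.mp hm, map_zero, mul_zero, cf_zero]

lemma suppIn_ofPolynomial (U : Polynomial (PowerSeries R)) :
    SuppIn {e | 0 ≤ e.1 ∧ 0 ≤ e.2} (ofPolynomial U) := by
  intro i j h
  by_contra hc
  apply h
  rw [ofPolynomial_eq_sum, cf_sum]
  refine Finset.sum_eq_zero fun k _ => ?_
  rw [cf_mono_mul, cf_ofPowerSeries_of_ne]
  simp only [Set.mem_ofPred_eq] at hc
  omega

/-- The Laurent polynomial `P / y` as a series. -/
noncomputable def ofDivY (P : BiPoly R) : BiSeries R :=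
  mono 0 (-1) * ofPolynomial (P.map Polynomial.coeToPowerSeries.ringHom)

lemma cf_ofDivY (P : BiPoly R) (i : ℕ) (j : ℕ) :
    cf (ofDivY P) i ((j : ℤ) - 1) = (P.coeff j).coeff i := by
  rw [ofDivY, cf_mono_mul, sub_zero, sub_neg_eq_add, sub_add_cancel, cf_ofPolynomial_natCast,
    Polynomial.coeff_map]
  simp

lemma suppIn_ofDivY (P : BiPoly R) : SuppIn {e | 0 ≤ e.1 ∧ -1 ≤ e.2} (ofDivY P) := by
  intro i j h
  rw [ofDivY, cf_mono_mul] at h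
  have := suppIn_ofPolynomial _ _ _ h
  simp only [Set.mem_ofPred_eq] at this ⊢
  omega

lemma theta_eq_zero {f : BiSeries R} (hf : SuppIn {e | e.2 = 0} f) : theta f = 0 := by
  apply ext_cf
  intro i j
  rw [cf_theta, cf_zero]
  by_cases h : cf f i j = 0
  · rw [h, mul_zero]
  · have : j = 0 := hf i j h
    rw [this, Int.cast_zero, zero_mul]

/-- **Furstenberg's theorem**: the series `F` is the diagonal of a rational function. -/
theorem cf_theta_ofDivY (P : BiPoly R) (F : PowerSeries R) (hF0 : PowerSeries.constantCoeff F = 0)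
    (hPF : P.evalSeries F = 0) (hu : IsUnit ((P.coeff 1).coeff 0)) {G : BiSeries R}
    (hG : ofDivY P * G = 1) (n : ℕ) :
    cf (mono 0 1 * theta (ofDivY P) * G) n 0 = PowerSeries.coeff n F := by
  have hroot : (P.map Polynomial.coeToPowerSeries.ringHom).IsRoot F := by
    rw [Polynomial.IsRoot, Polynomial.eval_map]
    exact hPF
  obtain ⟨U, hU⟩ := Polynomial.dvd_iff_isRoot.mpr hroot
  set Uh := ofPolynomial U with hUh
  set Fh := ofPowerSeries F with hFh
  have hFs : SuppIn {e | 1 ≤ e.1 ∧ e.2 = 0} Fh := by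
    intro i j hij
    have h1 := suppIn_ofPowerSeries F i j hij
    simp only [Set.mem_ofPred_eq] at h1 ⊢
    refine ⟨?_, h1.2⟩
    by_contra hc
    have h2 : i = ((0 : ℕ) : ℤ) := by push_cast; omega
    apply hij
    rw [h2, h1.2, hFh, cf_ofPowerSeries_natCast, PowerSeries.coeff_zero_eq_constantCoeff, hF0]
  set w : BiSeries R := mono 0 (-1) * Fh with hw
  have hws : SuppIn {e | 1 ≤ e.1 ∧ e.2 = -1} w := by
    intro i j hij
    rw [hw, cf_mono_mul] at hij
    have := hFs _ _ hij
    simp only [Set.mem_ofPred_eq] at this ⊢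
    omega
  -- P = (y - F)U gives P/y = (1 - w)U with w = F/y. The inverse of 1 - w has no positive powers of
  -- y and that of U has no negative ones.
  have hQ : ofDivY P = (1 - w) * Uh := by
    rw [ofDivY, hU, map_mul, hw, map_sub]
    have h1 : ofPolynomial (Polynomial.X : Polynomial (PowerSeries R)) = mono 0 1 := by
      simp [ofPolynomial]
    have h2 : ofPolynomial (Polynomial.C F) = Fh := by
      simp [ofPolynomial, hFh]
    rw [h1, h2, ← mul_assoc, mul_sub, mono_mul_mono]
    norm_num [mono_zero]
    rfl
  have h1w : SuppIn {e : ℤ × ℤ | 0 ≤ e.1 ∧ e.2 ≤ 0 ∧ (e.1 = 0 → e.2 = 0)} (1 - w) := by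
    refine (suppIn_one (by simp)).sub (hws.mono ?_)
    rintro ⟨a, b⟩ ⟨h1, h2⟩
    simp only [Set.mem_ofPred_eq] at *
    omega
  have hwU : IsUnit (1 - w) := by
    refine isUnit_of_cf_zero_zero ?_ ?_
    · intro i j hij
      have := h1w i j hij
      simp only [Set.mem_ofPred_eq] at this
      rw [← expo_zero, expo_le]
      omega
    · have : cf w 0 0 = 0 := by
        by_contra hc
        have := hws _ _ hc
        simp at this
      rw [cf_sub, this, ← mono_zero, cf_mono]
      simp
  have hUs := suppIn_ofPolynomial U
  have hU0 : IsUnit (cf Uh 0 0) := by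
    have h1 := congrArg (fun V => PowerSeries.coeff 0 (V.coeff 1)) hU
    simp only [Polynomial.coeff_map] at h1
    rw [Polynomial.coeff_X_sub_C_mul] at h1
    have h2 : PowerSeries.coeff 0 (U.coeff 0) = (P.coeff 1).coeff 0 := by
      have h3 : PowerSeries.coeff 0 (Polynomial.coeToPowerSeries.ringHom (P.coeff 1))
        = (P.coeff 1).coeff 0 := by simp
      rw [← h3, h1, map_sub, PowerSeries.coeff_zero_eq_constantCoeff, map_mul, hF0, zero_mul,
        sub_zero]
    have h4 := cf_ofPolynomial_natCast U 0 0
    rw [h2] at h4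
    rw [hUh]
    rw [← h4] at hu
    exact_mod_cast hu
  have hU00 : ∀ i j, cf Uh i j ≠ 0 → 0 ≤ expo i j := by
    intro i j hij
    have := hUs i j hij
    simp only [Set.mem_ofPred_eq] at this
    rw [← expo_zero, expo_le]
    omega
  have hUU : IsUnit Uh := isUnit_of_cf_zero_zero hU00 hU0
  obtain ⟨wi, hwi⟩ := hwU.exists_right_inv
  obtain ⟨Ui, hUi⟩ := hUU.exists_right_inv
  have hUis : SuppIn {e | 0 ≤ e.1 ∧ 0 ≤ e.2} Ui := by
    refine SuppIn.of_mul_eq_one hUi hU00 hU0 hUs (by simp) ?_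
    intro a b a' b' h1 h2
    simp only [Set.mem_ofPred_eq] at *
    omega
  have hwis : SuppIn {e : ℤ × ℤ | 0 ≤ e.1 ∧ e.2 ≤ 0 ∧ (e.1 = 0 → e.2 = 0)} wi := by
    refine SuppIn.of_mul_eq_one hwi ?_ ?_ h1w (by simp) ?_
    · intro i j hij
      have := h1w i j hij
      simp only [Set.mem_ofPred_eq] at this
      rw [← expo_zero, expo_le]
      omega
    · have : cf w 0 0 = 0 := by
        by_contra hc
        have := hws _ _ hc
        simp at this
      rw [cf_sub, this, ← mono_zero, cf_mono]
      simp
    · intro a b a' b' h1 h2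
      simp only [Set.mem_ofPred_eq] at *
      omega
  have hGe : G = wi * Ui := by
    have h1 : ofDivY P * (wi * Ui) = 1 := by
      rw [hQ]
      linear_combination (1 - w) * wi * hUi + hwi
    calc G = (ofDivY P * (wi * Ui)) * G := by rw [h1, one_mul]
      _ = (ofDivY P * G) * (wi * Ui) := by ring
      _ = wi * Ui := by rw [hG, one_mul]
  have hthF : theta Fh = 0 := theta_eq_zero (hFs.mono fun e he => he.2)
  have hthw : theta w = -w := by
    rw [hw, Derivation.leibniz, hthF, theta_mono]
    simp
    ring
  have hth : theta (ofDivY P) = w * Uh + (1 - w) * theta Uh := by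
    rw [hQ, Derivation.leibniz, map_sub, hthw, Derivation.map_one_eq_zero]
    simp only [smul_eq_mul]
    ring
  have hyw : mono 0 1 * w = Fh := by
    rw [hw, ← mul_assoc, mono_mul_mono]
    norm_num [mono_zero]
  -- Since θ(w) = -w, the quotient is F/(1 - w) + yθ(U)/U. In F/(1 - w) = F + Fw/(1 - w) the second
  -- term has only negative powers of y, and yθ(U)/U has only positive ones.
  have hfin : mono 0 1 * theta (ofDivY P) * G =
      Fh + Fh * w * wi + mono 0 1 * (theta Uh * Ui) := by
    rw [hth, hGe]
    have e1 : wi = 1 + w * wi := by linear_combination hwi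
    calc mono 0 1 * (w * Uh + (1 - w) * theta Uh) * (wi * Ui)
        = (mono 0 1 * w) * wi * (Uh * Ui) + mono 0 1 * (theta Uh * Ui) * ((1 - w) * wi) := by ring
      _ = Fh * wi + mono 0 1 * (theta Uh * Ui) := by rw [hyw, hUi, hwi]; ring
      _ = Fh * (1 + w * wi) + mono 0 1 * (theta Uh * Ui) := by rw [← e1]
      _ = _ := by ring
  have z1 : cf (Fh * w * wi) n 0 = 0 := by
    by_contra hc
    have h1 : SuppIn {e : ℤ × ℤ | e.2 ≤ -1} (Fh * w * wi) := by
      refine SuppIn.mul (A := {e : ℤ × ℤ | e.2 ≤ -1}) (hFs.mul hws ?_) hwis ?_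
      · intro a b a' b' h1 h2
        simp only [Set.mem_ofPred_eq] at *
        omega
      · intro a b a' b' h1 h2
        simp only [Set.mem_ofPred_eq] at *
        omega
    have := h1 _ _ hc
    simp at this
  have z2 : cf (mono 0 1 * (theta Uh * Ui)) n 0 = 0 := by
    by_contra hc
    rw [cf_mono_mul] at hc
    have h1 : SuppIn {e : ℤ × ℤ | 0 ≤ e.2} (theta Uh * Ui) := by
      refine hUs.theta.mul hUis ?_
      intro a b a' b' h1 h2
      simp only [Set.mem_ofPred_eq] at *
      omega
    have := h1 _ _ hc
    simp at this
  rw [hfin, cf_add, cf_add, z1, z2, add_zero, add_zero, hFh, cf_ofPowerSeries_natCast]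

end BiSeries

/-! ### The representing fraction modulo p^α -/

namespace BiSeries

section

variable {R : Type*} [CommRing R]

/-- The module of the combinations of fractions `c ^ k * S / Q ^ (k + 1)`. -/
noncomputable def levelFracs (Qi : BiSeries R) (c : R) (h d ε η : ℤ) : Submodule R (BiSeries R) :=
  ⨆ k : ℕ, fracs Qi (c ^ k) (k + 1) (box h d (k + 1 : ℕ) ε η)

/-- The module of the combinations of fractions `c * S / Q` and `c ^ k * S / Q ^ (k + 1)` with
`k ≥ 2`. -/
noncomputable def excessFracs (Qi : BiSeries R) (c : R) (h d ε η : ℤ) : Submodule R (BiSeries R) :=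
  fracs Qi c 1 (box h d 1 ε η) ⊔
    ⨆ k : ℕ, fracs Qi (c ^ (k + 2)) (k + 3) (box h d (k + 3 : ℕ) ε η)

lemma eq_zero_of_mem_fracs_zero {Qi : BiSeries R} {K : ℕ} {B : Set (ℤ × ℤ)} {f : BiSeries R}
    (hf : f ∈ fracs Qi 0 K B) : f = 0 := by
  obtain ⟨S, -, rfl⟩ := hf
  rw [zero_smul]

lemma excessFracs_le_levelFracs {h d : ℤ} {Q Qi : BiSeries R} (hQ : SuppIn (newt h d 1) Q)
    (hQi : Q * Qi = 1) (c : R) (ε η : ℤ) :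
    excessFracs Qi c h d ε η ≤ levelFracs Qi c h d ε η := by
  refine sup_le ?_ (iSup_le fun k => ?_)
  · have h1 := fracs_le_add hQ hQi c 1 1 ε η
    refine le_trans ?_ (le_iSup _ 1)
    rw [pow_one]
    exact_mod_cast h1
  · exact le_iSup (fun k : ℕ => fracs Qi (c ^ k) (k + 1) (box h d (k + 1 : ℕ) ε η)) (k + 2)

lemma theta_inv {Q Qi : BiSeries R} (hQi : Q * Qi = 1) : theta Qi = -(Qi ^ 2 * theta Q) := by
  have h1 : theta (Q * Qi) = 0 := by rw [hQi, Derivation.map_one_eq_zero]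
  rw [Derivation.leibniz] at h1
  simp only [smul_eq_mul] at h1
  have h2 := congrArg (fun f => Qi * f) h1
  simp only [mul_zero] at h2
  linear_combination h2 - theta Qi * hQi

/-- The part of the representing fraction of a Furstenberg series that depends on the difference
`c * E` between the denominators. -/
noncomputable def excessPart (Q Qi E : BiSeries R) (c : R) (n : ℕ) : BiSeries R :=
  -(c • (mono 0 1 * E * Qi)) +
    (∑ k ∈ Finset.Ico 2 (n + 1), (-c) ^ k • (mono 0 1 * E ^ k * theta Q * Qi ^ (k + 1)) +
      ∑ k ∈ Finset.Ico 1 (n + 1), ((-1) ^ k * c ^ (k + 1)) • (mono 0 1 * E ^ k * theta E * Qi ^ (k + 1)))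

lemma cf_theta_zero (f : BiSeries R) (n : ℤ) : cf (theta f) n 0 = 0 := by
  rw [cf_theta, Int.cast_zero, zero_mul]

/-- The inverse G is a finite geometric series because c is nilpotent. The terms of order c in the
result would require the denominator Q^2, but modulo the image of θ, which has zero row, they reduce
to the single fraction -c·yE/Q. This saving is the reason for the special shape of `excessFracs`. -/
lemma cf_add_smul_theta {Q Qi E G : BiSeries R} {c : R} {n : ℕ} (hn : 1 ≤ n) (hc : c ^ n = 0)
    (hQi : Q * Qi = 1) (hG : (Q + c • E) * G = 1) (i : ℤ) :
    cf (mono 0 1 * theta (Q + c • E) * G) i 0 =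
      cf (mono 0 1 * theta Q * Qi + excessPart Q Qi E c n) i 0 := by
  have hGe : G = ∑ k ∈ Finset.range (n + 1), (-c) ^ k • (E ^ k * Qi ^ (k + 1)) := by
    have h1 : (Q + c • E) * ∑ k ∈ Finset.range (n + 1), (-c) ^ k • (E ^ k * Qi ^ (k + 1)) = 1 := by
      have h2 : ∀ k, (-c) ^ k • (E ^ k * Qi ^ (k + 1)) = Qi * ((-c) • (E * Qi)) ^ k := fun k => by
        rw [_root_.smul_pow, mul_pow, pow_succ, mul_smul_comm]; congr 1; ring
      rw [Finset.sum_congr rfl fun k _ => h2 k, ← Finset.mul_sum]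
      have h3 := mul_neg_geom_sum ((-c) • (E * Qi)) (n + 1)
      have h4 : ((-c) • (E * Qi)) ^ (n + 1) = 0 := by
        rw [_root_.smul_pow, neg_pow, pow_succ c, hc]; simp
      rw [h4, sub_zero] at h3
      have h5 : (Q + c • E) * Qi = 1 - (-c) • (E * Qi) := by
        rw [add_mul, hQi, neg_smul, sub_neg_eq_add, smul_mul_assoc]
      rw [← mul_assoc, h5, h3]
    set G' := ∑ k ∈ Finset.range (n + 1), (-c) ^ k • (E ^ k * Qi ^ (k + 1))
    calc G = ((Q + c • E) * G') * G := by rw [h1, one_mul]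
      _ = ((Q + c • E) * G) * G' := by ring
      _ = G' := by rw [hG, one_mul]
  have hsplit : mono 0 1 * theta (Q + c • E) * G =
      (∑ k ∈ Finset.range (n + 1), (-c) ^ k • (mono 0 1 * E ^ k * theta Q * Qi ^ (k + 1))) +
      ∑ k ∈ Finset.range (n + 1),
        ((-1) ^ k * c ^ (k + 1)) • (mono 0 1 * E ^ k * theta E * Qi ^ (k + 1)) := by
    rw [hGe, map_add, Derivation.map_smul, mul_add, add_mul, Finset.mul_sum, Finset.mul_sum]
    congr 1
    · refine Finset.sum_congr rfl fun k _ => ?_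
      rw [mul_smul_comm]; congr 1; ring
    · refine Finset.sum_congr rfl fun k _ => ?_
      rw [mul_smul_comm, mul_smul_comm, smul_mul_assoc, smul_smul, neg_pow]
      congr 1 <;> ring
  have e1 : Finset.range (n + 1) = insert 0 (insert 1 (Finset.Ico 2 (n + 1))) := by
    ext k; simp only [Finset.mem_range, Finset.mem_insert, Finset.mem_Ico]; omega
  have e2 : Finset.range (n + 1) = insert 0 (Finset.Ico 1 (n + 1)) := by
    ext k; simp only [Finset.mem_range, Finset.mem_insert, Finset.mem_Ico]; omega
  -- The term k = 1 of the first sum and the term k = 0 of the second make up c·yθ(E/Q) = θ(c·yE/Q)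
  -- - c·yE/Q.
  have hfirst : mono 0 1 * theta (Q + c • E) * G = mono 0 1 * theta Q * Qi + excessPart Q Qi E c n +
      theta (c • (mono 0 1 * E * Qi)) := by
    rw [hsplit, excessPart]
    conv_lhs => rw [e1, Finset.sum_insert (by simp), Finset.sum_insert (by simp), ← e1]
    rw [e2, Finset.sum_insert (by simp), Derivation.map_smul, Derivation.leibniz,
      Derivation.leibniz, theta_inv hQi, theta_mono]
    simp only [smul_eq_mul, pow_zero, one_smul, mul_one, zero_add, pow_one, neg_smul, one_mul,
      Int.cast_one]
    have h1 : ∀ f : BiSeries R, c • f = HahnSeries.C c * f := fun f =>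
      (HahnSeries.C_mul_eq_smul).symm
    simp only [h1]
    ring
  rw [hfirst, cf_add, cf_theta_zero, add_zero]

end

section ZModPow

lemma mul_theta_mul_mem_fracs {R : Type*} [CommRing R] {h d : ℤ} {Q Qi : BiSeries R}
    (hQ : SuppIn (newt h d 1) Q) :
    mono 0 1 * theta Q * Qi ∈ fracs Qi (1 : R) 1 (box h d 1 0 1) := by
  refine ⟨mono 0 1 * theta Q, ?_, by rw [one_smul, pow_one]⟩
  refine SuppIn.mul (A := {(0, 1)}) (suppIn_mono rfl) hQ.theta ?_
  rintro a b a' b' h0 ⟨h1, h2, h3, h4, h5⟩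
  simp only [Set.mem_singleton_iff, Prod.mk.injEq] at h0
  obtain ⟨rfl, rfl⟩ := h0
  simp only at h1 h2 h3 h4 h5
  refine ⟨?_, ?_, ?_, ?_, ?_⟩ <;> simp only <;> omega

variable {p : ℕ} {α : ℕ}

lemma natCast_pow_eq_zero {k : ℕ} (hk : α ≤ k) : (p : ZMod (p ^ α)) ^ k = 0 := by
  obtain ⟨m, rfl⟩ := Nat.exists_eq_add_of_le hk
  rw [pow_add, ← Nat.cast_pow, ZMod.natCast_self, zero_mul]

lemma SuppIn.mono_mul_box {h d K ε η ε' η' : ℤ} {R : Type*} [CommRing R] {f : BiSeries R}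
    (hf : SuppIn {e | 0 ≤ e.1 ∧ e.1 ≤ K * h + ε ∧ -K ≤ e.2 ∧ e.2 + 1 ≤ K * (d - 1) + η ∧
      0 ≤ e.1 + e.2} f) (hε : ε ≤ ε') (hη : η ≤ η') :
    SuppIn (box h d K ε' η') (BiSeries.mono 0 1 * f) := by
  intro i j hij
  rw [cf_mono_mul] at hij
  obtain ⟨h1, h2, h3, h4, h5⟩ := hf _ _ hij
  simp only at h1 h2 h3 h4 h5
  refine ⟨?_, ?_, ?_, ?_, ?_⟩ <;> simp only <;> omega

/-- Each factor E adds an excess of H - h in x and D - d in y, and at most α such factors occur in a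
nonzero term. The additional 1 in y comes from the factor y. -/
lemma excessPart_mem (hα : α ≠ 0) {h d : ℤ} {Q Qi : BiSeries (ZMod (p ^ α))}
    (hQ : SuppIn (newt h d 1) Q) (hQi : Q * Qi = 1)
    {H D : ℤ} (hH : h ≤ H) (hD : d ≤ D) {E : BiSeries (ZMod (p ^ α))}
    (hE : SuppIn (newt H D 1) E) :
    excessPart Q Qi E (p : ZMod (p ^ α)) α ∈ excessFracs Qi (p : ZMod (p ^ α)) h d
      (α * (H - h)) (α * (D - d) + 1) := by
  have hα1 : (1 : ℤ) ≤ α := by exact_mod_cast Nat.one_le_iff_ne_zero.mpr hα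
  refine Submodule.add_mem _ (Submodule.neg_mem _ ?_) (Submodule.add_mem _
    (Submodule.sum_mem _ fun k hk => ?_) (Submodule.sum_mem _ fun k hk => ?_))
  · refine Submodule.mem_sup_left ⟨mono 0 1 * E, ?_, by rw [pow_one]⟩
    refine SuppIn.mono_mul_box (ε := H - h) (η := D - d + 1) (hE.mono ?_) (by nlinarith)
      (by nlinarith)
    rintro ⟨a, b⟩ ⟨h1, h2, h3, h4, h5⟩
    simp only at h1 h2 h3 h4 h5
    refine ⟨?_, ?_, ?_, ?_, ?_⟩ <;> simp only <;> linarith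
  · obtain ⟨h2k, hkα⟩ := Finset.mem_Ico.mp hk
    refine Submodule.mem_sup_right (Submodule.mem_iSup_of_mem (k - 2) ?_)
    rw [show k - 2 + 2 = k by omega, show k - 2 + 3 = k + 1 by omega]
    have hkα' : (k : ℤ) ≤ α := by exact_mod_cast Nat.lt_succ_iff.mp hkα
    rw [neg_pow, mul_smul]
    refine Submodule.smul_mem _ _ ⟨mono 0 1 * (E ^ k * theta Q), ?_, by rw [mul_assoc (mono 0 1)]⟩
    refine SuppIn.mono_mul_box (ε := k * (H - h)) (η := k * (D - d) + 1)
      ((hE.pow_newt k).mul hQ.theta ?_) (by nlinarith) (by nlinarith)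
    rintro a b a' b' ⟨h1, h2, h3, h4, h5⟩ ⟨g1, g2, g3, g4, g5⟩
    simp only at h1 h2 h3 h4 h5 g1 g2 g3 g4 g5
    push_cast
    refine ⟨?_, ?_, ?_, ?_, ?_⟩ <;> simp only <;> linarith
  · obtain ⟨h1k, hkα⟩ := Finset.mem_Ico.mp hk
    rw [mul_smul]
    refine Submodule.smul_mem _ _ ?_
    -- For k + 1 ≥ α the scalar p^(k+1) vanishes; otherwise E^k θ(E) counts as k + 1 ≤ α factors E.
    by_cases hk' : α ≤ k + 1
    · rw [natCast_pow_eq_zero hk', zero_smul]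
      exact Submodule.zero_mem _
    have hkα' : (k : ℤ) + 1 ≤ α := by push Not at hk'; exact_mod_cast hk'.le
    refine Submodule.mem_sup_right (Submodule.mem_iSup_of_mem (k - 1) ?_)
    rw [show k - 1 + 2 = k + 1 by omega, show k - 1 + 3 = k + 1 + 1 by omega]
    refine fracs_le_add hQ hQi _ (k + 1) 1 _ _ ⟨mono 0 1 * (E ^ k * theta E), ?_,
      by rw [mul_assoc (mono 0 1)]⟩
    refine SuppIn.mono_mul_box (ε := (k + 1) * (H - h)) (η := (k + 1) * (D - d) + 1)
      ((hE.pow_newt k).mul hE.theta ?_) (by nlinarith) (by nlinarith)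
    rintro a b a' b' ⟨h1, h2, h3, h4, h5⟩ ⟨g1, g2, g3, g4, g5⟩
    simp only at h1 h2 h3 h4 h5 g1 g2 g3 g4 g5
    push_cast
    refine ⟨?_, ?_, ?_, ?_, ?_⟩ <;> simp only <;> linarith

variable [hp : Fact p.Prime]

lemma le_pow_pred : α ≤ p ^ (α - 1) := by
  have := Nat.lt_pow_self (n := α - 1) hp.out.one_lt
  omega

variable {h d : ℤ} {Q Qi : BiSeries (ZMod (p ^ α))}

/-- The term with index i in the section of a fraction of level k has level k + i. Levels from α on
vanish, and below α the exponent k + 1 ≤ α is at most p^(α-1), as `sect_mem_iSup_fracs` requires. -/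
lemma sect_mem_levelFracs (hα : α ≠ 0) (t : ℕ) [NeZero (p ^ t)] (hQ : SuppIn (newt h d 1) Q)
    (hQi : Q * Qi = 1) {r : ℤ} (hrq : r < (p ^ t : ℕ)) (ε η : ℤ) {f : BiSeries (ZMod (p ^ α))}
    (hf : f ∈ levelFracs Qi (p : ZMod (p ^ α)) h d ε η) :
    sect (p ^ t) r f ∈ levelFracs Qi (p : ZMod (p ^ α)) h d ((ε - r) / (p ^ t : ℕ))
      (η / (p ^ t : ℕ)) := by
  have key : levelFracs Qi (p : ZMod (p ^ α)) h d ε η ≤ (levelFracs Qi (p : ZMod (p ^ α)) h d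
      ((ε - r) / (p ^ t : ℕ)) (η / (p ^ t : ℕ))).comap (sect (p ^ t) r) := by
    refine iSup_le fun k f hf => ?_
    rw [Submodule.mem_comap]
    by_cases hk : α ≤ k
    · rw [natCast_pow_eq_zero hk] at hf
      rw [eq_zero_of_mem_fracs_zero hf, map_zero]
      exact Submodule.zero_mem _
    · have h1 := sect_mem_iSup_fracs hα t hQ hQi (K := k + 1)
        (le_trans (by omega) le_pow_pred) hrq k ε η hf
      refine (iSup_le fun i => ?_ : _ ≤ levelFracs Qi (p : ZMod (p ^ α)) h d
        ((ε - r) / (p ^ t : ℕ)) (η / (p ^ t : ℕ))) h1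
      rw [show k + 1 + i = (k + i) + 1 by ring]
      exact le_iSup (fun k : ℕ => fracs Qi ((p : ZMod (p ^ α)) ^ k) (k + 1)
        (box h d (k + 1 : ℕ) _ _)) (k + i)
  exact key hf

/-- The section of pS/Q consists of terms p^(1+i) S_i/Q^(1+i). The one with i = 0 keeps its shape.
The others have a power of Q to spare and can be rewritten over Q^(2+i). -/
lemma sect_mem_excessFracs (hα : α ≠ 0) (t : ℕ) [NeZero (p ^ t)] (hQ : SuppIn (newt h d 1) Q)
    (hQi : Q * Qi = 1) {r : ℤ} (hrq : r < (p ^ t : ℕ)) (ε η : ℤ) {f : BiSeries (ZMod (p ^ α))}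
    (hf : f ∈ excessFracs Qi (p : ZMod (p ^ α)) h d ε η) :
    sect (p ^ t) r f ∈ excessFracs Qi (p : ZMod (p ^ α)) h d ((ε - r) / (p ^ t : ℕ))
      (η / (p ^ t : ℕ)) := by
  have key : excessFracs Qi (p : ZMod (p ^ α)) h d ε η ≤ (excessFracs Qi (p : ZMod (p ^ α)) h d
      ((ε - r) / (p ^ t : ℕ)) (η / (p ^ t : ℕ))).comap (sect (p ^ t) r) := by
    refine sup_le (fun f hf => ?_) (iSup_le fun k f hf => ?_) <;> rw [Submodule.mem_comap]
    · rw [← pow_one (p : ZMod (p ^ α))] at hf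
      have h1 := sect_mem_iSup_fracs hα t hQ hQi (K := 1) (Nat.one_le_pow _ _ hp.out.pos) hrq
        1 ε η (by exact_mod_cast hf)
      refine (iSup_le fun i => ?_ : _ ≤ excessFracs Qi (p : ZMod (p ^ α)) h d
        ((ε - r) / (p ^ t : ℕ)) (η / (p ^ t : ℕ))) h1
      cases i with
      | zero =>
        refine le_trans ?_ le_sup_left
        rw [add_zero, pow_one]
        exact_mod_cast le_rfl
      | succ i =>
        refine le_trans ?_ (le_trans (le_iSup _ i) le_sup_right)
        have h2 := fracs_le_add hQ hQi ((p : ZMod (p ^ α)) ^ (1 + (i + 1))) (1 + (i + 1)) 1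
          ((ε - r) / (p ^ t : ℕ)) (η / (p ^ t : ℕ))
        rw [show 1 + (i + 1) + 1 = i + 3 by ring] at h2
        refine h2.trans ?_
        rw [show 1 + (i + 1) = i + 2 by ring]
    · by_cases hk : α ≤ k + 2
      · rw [natCast_pow_eq_zero hk] at hf
        rw [eq_zero_of_mem_fracs_zero hf, map_zero]
        exact Submodule.zero_mem _
      · have h1 := sect_mem_iSup_fracs hα t hQ hQi (K := k + 3)
          (le_trans (by omega) le_pow_pred) hrq (k + 2) ε η hf
        refine (iSup_le fun i => ?_ : _ ≤ excessFracs Qi (p : ZMod (p ^ α)) h d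
          ((ε - r) / (p ^ t : ℕ)) (η / (p ^ t : ℕ))) h1
        rw [show k + 3 + i = (k + i) + 3 by ring, show k + 2 + i = (k + i) + 2 by ring]
        exact le_trans (le_iSup (fun k : ℕ => fracs Qi ((p : ZMod (p ^ α)) ^ (k + 2)) (k + 3)
          (box h d (k + 3 : ℕ) _ _)) (k + i)) le_sup_right
  exact key hf

end ZModPow

end BiSeries

/-! ### Counting with generators and relations -/

/-- Adjoining finitely many generators `g i`, whose multiples `p • g i` lie in `H`, increases the
cardinality of a submodule `H` by a factor of at most `p ^ (#generators - #relations)`. -/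
lemma Submodule.card_sup_span_range_mul_le {p α : ℕ} [Fact p.Prime] (hα : α ≠ 0) {M : Type*}
    [AddCommGroup M] [Module (ZMod (p ^ α)) M] (H : Submodule (ZMod (p ^ α)) M) [Finite H]
    {I τ : Type*} [Fintype I] [Fintype τ] (g : I → M) (hg : ∀ i, (p : ZMod (p ^ α)) • g i ∈ H)
    (r : τ → I → ZMod (p ^ α)) (hr : ∀ t, ∑ i, r t i • g i ∈ H)
    (hind : LinearIndependent (ZMod p) fun t i => ZMod.castHom (dvd_pow_self p hα) (ZMod p) (r t i)) :
    Finite ↥(H ⊔ Submodule.span (ZMod (p ^ α)) (Set.range g)) ∧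
      Nat.card ↥(H ⊔ Submodule.span (ZMod (p ^ α)) (Set.range g)) * p ^ Fintype.card τ ≤
        p ^ Fintype.card I * Nat.card H := by
  classical
  have : NeZero (p ^ α) := ⟨pow_ne_zero _ (Fact.out : p.Prime).ne_zero⟩
  set π := ZMod.castHom (dvd_pow_self p hα) (ZMod p)
  let ψ : (I → ZMod (p ^ α)) →ₗ[ZMod (p ^ α)] M ⧸ H := H.mkQ ∘ₗ Fintype.linearCombination _ g
  let πI : (I → ZMod (p ^ α)) →+ (I → ZMod p) := (π : ZMod (p ^ α) →+ ZMod p).compLeft I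
  have hπI : Function.Surjective πI := by
    intro c
    choose b hb using fun i => ZMod.castHom_surjective (dvd_pow_self p hα) (c i)
    exact ⟨b, funext hb⟩
  let V := Submodule.span (ZMod p) (Set.range fun t i => π (r t i))
  -- Multiples of p are sent to H, so the map to M/H depends only on the coefficients modulo p;
  -- there it kills the span V of the reduced relations, whose dimension is the number of relations.
  have hV : V.toAddSubgroup.comap πI ≤ ψ.ker.toAddSubgroup := by
    have hker : ∀ c, πI c = 0 → ψ c = 0 := by
      intro c hc
      have h1 : ∀ i, ∃ b, c i = b * (p : ZMod (p ^ α)) := fun i => by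
        obtain ⟨b, hb⟩ := (BiSeries.dvd_iff_castHom_eq_zero hα (c i)).mpr (congrFun hc i)
        exact ⟨b, by rw [hb, mul_comm]⟩
      choose b hb using h1
      simp only [ψ, LinearMap.comp_apply, Fintype.linearCombination_apply, Submodule.mkQ_apply,
        Submodule.Quotient.mk_eq_zero]
      refine Submodule.sum_mem _ fun i _ => ?_
      rw [hb i, mul_smul]
      exact H.smul_mem _ (hg i)
    have hspan : ∀ x ∈ V, ∀ c, πI c = x → ψ c = 0 := by
      intro x hx
      induction hx using Submodule.span_induction with
      | mem x hx =>
        obtain ⟨t, rfl⟩ := hx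
        intro c hc
        have h1 : ψ (c - r t) = 0 := hker _ (by rw [map_sub, hc]; exact sub_self _)
        rw [map_sub, sub_eq_zero] at h1
        rw [h1]
        simp only [ψ, LinearMap.comp_apply, Fintype.linearCombination_apply, Submodule.mkQ_apply,
          Submodule.Quotient.mk_eq_zero]
        exact hr t
      | zero => exact hker
      | add x y _ _ hx hy =>
        intro c hc
        obtain ⟨a, ha⟩ := hπI x
        have h1 := hx a ha
        have h2 := hy (c - a) (by rw [map_sub, hc, ha, add_sub_cancel_left])
        rw [map_sub, h1, sub_zero] at h2
        exact h2
      | smul k x _ hx =>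
        intro c hc
        obtain ⟨a, ha⟩ := hπI x
        obtain ⟨l, hl⟩ := ZMod.castHom_surjective (dvd_pow_self p hα) k
        have h1 : ψ (c - l • a) = 0 := hker _ (by
          rw [map_sub, hc, ← ha, sub_eq_zero]
          funext i
          change k * π (a i) = π (l * a i)
          rw [map_mul, ← hl])
        rw [map_sub, map_smul, hx a ha, smul_zero, sub_zero] at h1
        exact h1
    intro c hc
    exact hspan _ hc c rfl
  have hrange : Nat.card ψ.range * p ^ Fintype.card τ ≤ p ^ Fintype.card I := by
    have h1 : Nat.card ψ.range = ψ.ker.toAddSubgroup.index := by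
      rw [AddSubgroup.index]
      exact (Nat.card_congr ψ.quotKerEquivRange.toEquiv).symm
    have h2 : (V.toAddSubgroup.comap πI).index = V.toAddSubgroup.index :=
      AddSubgroup.index_comap_of_surjective _ hπI
    have h3 : ψ.ker.toAddSubgroup.index ≤ V.toAddSubgroup.index := by
      rw [← h2]
      exact Nat.le_of_dvd (Nat.pos_of_ne_zero (by
        rw [h2]; exact AddSubgroup.index_ne_zero_of_finite)) (AddSubgroup.index_dvd_of_le hV)
    have h4 : Nat.card V * V.toAddSubgroup.index = p ^ Fintype.card I := by
      have := V.toAddSubgroup.card_mul_index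
      rw [Nat.card_eq_fintype_card (α := I → ZMod p), Fintype.card_fun, ZMod.card] at this
      exact this
    have h5 : Nat.card V = p ^ Fintype.card τ := by
      rw [Module.natCard_eq_pow_finrank (K := ZMod p), finrank_span_eq_card hind, Nat.card_zmod]
    rw [h1, ← h4, h5, mul_comm]
    exact Nat.mul_le_mul_left _ h3
  have hfin : Finite ψ.range := Set.finite_range ψ
  have hlift : ∀ y : ψ.range, ∃ c, ψ c = y := fun y => y.2
  choose lift hl using hlift
  have hmem : ∀ c : I → ZMod (p ^ α), Fintype.linearCombination _ g c ∈
      Submodule.span (ZMod (p ^ α)) (Set.range g) := fun c => by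
    rw [Fintype.linearCombination_apply]
    exact Submodule.sum_mem _ fun i _ => Submodule.smul_mem _ _ (Submodule.subset_span ⟨i, rfl⟩)
  let F : ψ.range × H → ↥(H ⊔ Submodule.span (ZMod (p ^ α)) (Set.range g)) := fun x =>
    ⟨x.2 + Fintype.linearCombination _ g (lift x.1),
      Submodule.add_mem_sup x.2.2 (hmem _)⟩
  have hF : Function.Surjective F := by
    rintro ⟨x, hx⟩
    obtain ⟨y, hy, z, hz, rfl⟩ := Submodule.mem_sup.mp hx
    rw [← Fintype.range_linearCombination] at hz
    obtain ⟨c, rfl⟩ := hz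
    have h1 := hl ⟨ψ c, c, rfl⟩
    simp only [ψ, LinearMap.comp_apply, Submodule.mkQ_apply] at h1
    rw [eq_comm, Submodule.Quotient.eq] at h1
    refine ⟨⟨⟨ψ c, c, rfl⟩, ⟨_, H.add_mem hy h1⟩⟩, ?_⟩
    simp only [F, Subtype.mk.injEq]
    simp only [ψ, LinearMap.comp_apply, Submodule.mkQ_apply]
    abel
  refine ⟨Finite.of_surjective F hF, ?_⟩
  have h1 := Nat.card_le_card_of_surjective F hF
  rw [Nat.card_prod] at h1
  calc _ ≤ (Nat.card ψ.range * Nat.card H) * p ^ Fintype.card τ := Nat.mul_le_mul_right _ h1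
    _ = (Nat.card ψ.range * p ^ Fintype.card τ) * Nat.card H := by ring
    _ ≤ _ := Nat.mul_le_mul_right _ hrange

namespace BiSeries

/-- A family of series is linearly independent if each member has a pivot monomial that does not
occur in the other members of the same or of higher weight. -/
lemma linearIndependent_of_pivot {k : Type*} [Field k] {τ : Type*} [Fintype τ] (S : τ → BiSeries k)
    (ω : τ → ℤ) (e : τ → ℤ × ℤ) (h1 : ∀ t, cf (S t) (e t).1 (e t).2 ≠ 0)
    (h2 : ∀ t t', t' ≠ t → ω t ≤ ω t' → cf (S t') (e t).1 (e t).2 = 0) :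
    LinearIndependent k S := by
  classical
  rw [Fintype.linearIndependent_iff]
  intro c hc
  by_contra hne
  push Not at hne
  obtain ⟨t0, ht0⟩ := hne
  -- In a vanishing combination, the coefficient at the pivot of a member of least weight comes from
  -- this member alone.
  obtain ⟨t, ht, hmin⟩ := Finset.exists_min_image (Finset.univ.filter fun t => c t ≠ 0) ω
    ⟨t0, by simpa using ht0⟩
  have h3 := congrArg (fun f => cf f (e t).1 (e t).2) hc
  simp only [cf_sum, cf_smul, cf_zero] at h3
  rw [Finset.sum_eq_single t] at h3
  · exact mul_ne_zero (by simpa using ht) (h1 t) h3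
  · intro t' _ ht'
    by_cases hct : c t' = 0
    · rw [hct, zero_mul]
    · rw [h2 t t' ht' (hmin t' (by simpa using hct)), mul_zero]
  · intro h; exact absurd (Finset.mem_univ t) h

section ZModPow

variable {p α : ℕ} [Fact p.Prime]

lemma eq_sum_smul_mono {R : Type*} [CommRing R] {B : Set (ℤ × ℤ)} [Fintype B] {S : BiSeries R}
    (hS : SuppIn B S) : S = ∑ b : B, cf S b.1.1 b.1.2 • mono b.1.1 b.1.2 := by
  classical
  apply ext_cf
  intro i j
  rw [cf_sum]
  simp only [cf_smul, cf_mono]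
  by_cases h : cf S i j = 0
  · rw [h, Finset.sum_eq_zero]
    intro b _
    split_ifs with hb
    · rw [← hb.1, ← hb.2, h, zero_mul]
    · rw [mul_zero]
  · rw [Finset.sum_eq_single ⟨(i, j), hS i j h⟩]
    · simp
    · intro b _ hb
      rw [if_neg, mul_zero]
      rintro ⟨rfl, rfl⟩
      exact hb rfl
    · intro hc; exact absurd (Finset.mem_univ _) hc

/-- Adjoining the image of a module of fractions to a submodule `H`. -/
lemma card_sup_map_fracs_mul_le (hα : α ≠ 0) {M : Type*} [AddCommGroup M]
    [Module (ZMod (p ^ α)) M] (H : Submodule (ZMod (p ^ α)) M) [Finite H]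
    (Δ : BiSeries (ZMod (p ^ α)) →ₗ[ZMod (p ^ α)] M) (Qi : BiSeries (ZMod (p ^ α)))
    (c : ZMod (p ^ α)) (K : ℕ) {B : Set (ℤ × ℤ)} (hB : B.Finite)
    (hp : ∀ f ∈ fracs Qi (p * c) K B, Δ f ∈ H)
    {τ : Type*} [Fintype τ] (S : τ → BiSeries (ZMod (p ^ α))) (hS : ∀ t, SuppIn B (S t))
    (hr : ∀ t, Δ (c • (S t * Qi ^ K)) ∈ H)
    (hind : LinearIndependent (ZMod p) fun t =>
      mapHom (ZMod.castHom (dvd_pow_self p hα) (ZMod p)) (S t)) :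
    Finite ↥(H ⊔ (fracs Qi c K B).map Δ) ∧
      Nat.card ↥(H ⊔ (fracs Qi c K B).map Δ) * p ^ Fintype.card τ ≤ p ^ B.ncard * Nat.card H := by
  classical
  have := hB.fintype
  let g : B → M := fun b => Δ (c • (mono b.1.1 b.1.2 * Qi ^ K))
  have hcomb : ∀ T : BiSeries (ZMod (p ^ α)), SuppIn B T →
      Δ (c • (T * Qi ^ K)) = ∑ b : B, cf T b.1.1 b.1.2 • g b := by
    intro T hT
    conv_lhs => rw [eq_sum_smul_mono hT]
    rw [Finset.sum_mul, Finset.smul_sum, map_sum]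
    refine Finset.sum_congr rfl fun b _ => ?_
    rw [smul_mul_assoc, smul_comm, map_smul]
  have hspan : (fracs Qi c K B).map Δ = Submodule.span (ZMod (p ^ α)) (Set.range g) := by
    apply le_antisymm
    · rintro _ ⟨_, ⟨T, hT, rfl⟩, rfl⟩
      rw [hcomb T hT]
      exact Submodule.sum_mem _ fun b _ => Submodule.smul_mem _ _ (Submodule.subset_span ⟨b, rfl⟩)
    · rw [Submodule.span_le]
      rintro _ ⟨b, rfl⟩
      exact ⟨_, ⟨_, suppIn_mono b.2, rfl⟩, rfl⟩
  have hcard : Fintype.card B = B.ncard := by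
    rw [← Nat.card_coe_set_eq, Nat.card_eq_fintype_card]
  rw [hspan, ← hcard]
  refine Submodule.card_sup_span_range_mul_le hα H g ?_ (fun t b => cf (S t) b.1.1 b.1.2) ?_ ?_
  · intro b
    rw [← map_smul, smul_smul]
    exact hp _ ⟨_, suppIn_mono b.2, rfl⟩
  · intro t
    rw [← hcomb (S t) (hS t)]
    exact hr t
  -- All series are supported in B, so a combination whose coefficients vanish on B is zero.
  · rw [Fintype.linearIndependent_iff] at hind ⊢
    intro k hk
    apply hind
    apply ext_cf
    intro i j
    rw [cf_zero]
    by_contra hne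
    have h1 : ∃ t, cf (S t) i j ≠ 0 := by
      by_contra hall
      push Not at hall
      apply hne
      rw [cf_sum]
      refine Finset.sum_eq_zero fun t _ => ?_
      rw [cf_smul, cf_mapHom, hall t, map_zero, mul_zero]
    obtain ⟨t, ht⟩ := h1
    have h2 := congrFun hk ⟨(i, j), hS t i j ht⟩
    apply hne
    rw [cf_sum]
    simpa using h2

end ZModPow

end BiSeries

/-! ### Numerators whose row vanishes -/

namespace BiSeries

/-- The data of a bivariate Laurent polynomial `Q` with inverse `Qi` that has at least the
monomial `1`, whose monomials lie in a fixed polygon, and whose nonzero coefficients are units. -/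
structure IsDenominator {R : Type*} [CommRing R] (h d : ℕ) (Q Qi : BiSeries R) : Prop where
  suppIn : SuppIn (newt h d 1) Q
  mul_inv : Q * Qi = 1
  isUnit : ∀ i j, cf Q i j ≠ 0 → IsUnit (cf Q i j)
  ne_zero : cf Q 0 0 ≠ 0

/-- The numerators `S` of the fractions `S / Q ^ K` without monomials `x ^ n`. -/
def IsDead {R : Type*} [CommRing R] (Qi : BiSeries R) (K : ℕ) (S : BiSeries R) : Prop :=
  ∀ n : ℤ, cf (S * Qi ^ K) n 0 = 0

section Lift

variable {R S : Type*} [CommRing R] [CommRing S]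

lemma exists_mapHom_eq {φ : S →+* R} (hφ : Function.Surjective φ) (f : BiSeries R) :
    ∃ g : BiSeries S, mapHom φ g = f ∧ ∀ A, SuppIn A f → SuppIn A g := by
  classical
  choose s hs using hφ
  refine ⟨⟨fun e => if f.coeff e = 0 then 0 else s (f.coeff e), f.isPWO_support.mono fun e he => ?_⟩,
    ?_, ?_⟩
  · intro h0; simp [h0] at he
  · apply ext_cf
    intro i j
    rw [cf_mapHom]
    simp only [cf]
    split_ifs with h0
    · rw [h0, map_zero]
    · exact hs _
  · intro A hA i j hij
    apply hA i j
    intro h0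
    apply hij
    simp only [cf] at h0 ⊢
    simp [h0]

/-- θ(x^i y^j/Q^k) = x^i y^j (jQ - kθ(Q))/Q^(k+1) has zero row. Without zero divisors a common
factor g of j and k can be cancelled. -/
lemma isDead_of_isDomain [IsDomain S] [CharZero S] {Q Qi : BiSeries S} (hQi : Q * Qi = 1)
    {k g : ℕ} (hg : g ≠ 0) {i j J : ℤ} {k' : ℕ} (hj : j = g * J) (hk : k = g * k') :
    IsDead Qi (k + 1) (BiSeries.mono i j * ((J : BiSeries S) * Q - (k' : BiSeries S) * theta Q)) := by
  intro n
  have h1 : theta (BiSeries.mono i j * Qi ^ k) = (g : BiSeries S) * (BiSeries.mono i j *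
      ((J : BiSeries S) * Q - (k' : BiSeries S) * theta Q) * Qi ^ (k + 1)) := by
    rw [Derivation.leibniz, Derivation.leibniz_pow, theta_inv hQi, theta_mono]
    rcases Nat.eq_zero_or_pos k with h0 | h0
    · have : k' = 0 := by
        rw [h0] at hk
        exact (mul_eq_zero.mp hk.symm).resolve_left hg
      subst h0; subst this
      rw [hj]
      push_cast
      simp only [smul_eq_mul, zero_smul]
      linear_combination (-(g : BiSeries S) * J * BiSeries.mono i (g * J)) * hQi
    · obtain ⟨l, rfl⟩ := Nat.exists_eq_add_of_le h0
      rw [Nat.add_sub_cancel_left, nsmul_eq_mul]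
      have e1 : ((1 + l : ℕ) : BiSeries S) = (g : BiSeries S) * k' := by rw [hk]; push_cast; ring
      have e2 : ((j : ℤ) : BiSeries S) = (g : BiSeries S) * J := by rw [hj]; push_cast; ring
      rw [e1, e2]
      simp only [smul_eq_mul]
      have e3 : Qi ^ (1 + l + 1) * Q = Qi ^ (1 + l) := by
        rw [pow_succ]; linear_combination Qi ^ (1 + l) * hQi
      linear_combination (-(g : BiSeries S) * J * BiSeries.mono i j) * e3
  have h2 := cf_theta_zero (BiSeries.mono i j * Qi ^ k) n
  rw [h1, cf_natCast_mul] at h2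
  exact (mul_eq_zero.mp h2).resolve_left (Nat.cast_ne_zero.mpr hg)

end Lift

variable {p α : ℕ} [hp : Fact p.Prime]

/-- The factor g may be divisible by p and then cannot be cancelled modulo p^α. Therefore Q is
lifted to the p-adic integers, where the relation holds, and the relation is reduced. -/
lemma isDead_theta (hα : α ≠ 0) {Q Qi : BiSeries (ZMod (p ^ α))}
    (hQi : Q * Qi = 1) (hQ : ∀ i j, cf Q i j ≠ 0 → 0 ≤ expo i j) (h0 : IsUnit (cf Q 0 0))
    {k g : ℕ} (hg : g ≠ 0) {i j J : ℤ} {k' : ℕ} (hj : j = g * J) (hk : k = g * k') :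
    IsDead Qi (k + 1) (BiSeries.mono i j *
      ((J : BiSeries (ZMod (p ^ α))) * Q - (k' : BiSeries (ZMod (p ^ α))) * theta Q)) := by
  set φ : ℤ_[p] →+* ZMod (p ^ α) := PadicInt.toZModPow α
  have hφ : Function.Surjective φ := ZMod.ringHom_surjective _
  obtain ⟨P, hP, hPA⟩ := exists_mapHom_eq hφ Q
  have : Nontrivial (ZMod (p ^ α)) := by
    have : Fact (1 < p ^ α) := ⟨Nat.one_lt_pow hα hp.out.one_lt⟩
    infer_instance
  have hloc : IsLocalHom φ := .of_surjective φ hφ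
  have hP0 : IsUnit (cf P 0 0) := by
    apply isUnit_of_map_unit φ
    rw [← cf_mapHom, hP]; exact h0
  have hPU : IsUnit P := by
    refine isUnit_of_cf_zero_zero ?_ hP0
    intro i j hij
    have := hPA {e | 0 ≤ expo e.1 e.2} (fun i j h => hQ i j h) i j hij
    exact this
  obtain ⟨Pi, hPi⟩ := hPU.exists_right_inv
  have hPiQi : mapHom φ Pi = Qi := by
    have h1 : Q * mapHom φ Pi = 1 := by rw [← hP, ← map_mul, hPi, map_one]
    calc mapHom φ Pi = (Q * Qi) * mapHom φ Pi := by rw [hQi, one_mul]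
      _ = (Q * mapHom φ Pi) * Qi := by ring
      _ = Qi := by rw [h1, one_mul]
  intro n
  have h1 := isDead_of_isDomain hPi hg (i := i) hj hk n
  have h2 := congrArg φ h1
  rw [← cf_mapHom, map_zero] at h2
  rw [← h2, map_mul, map_mul, map_pow, map_sub, map_mul, map_mul, mapHom_theta, mapHom_mono, hP,
    hPiQi, map_intCast, map_natCast]

lemma IsDenominator.expo_nonneg {R : Type*} [CommRing R] {h d : ℕ} {Q Qi : BiSeries R}
    (hQ : IsDenominator h d Q Qi) (i j : ℤ) (hij : cf Q i j ≠ 0) : 0 ≤ expo i j := by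
  obtain ⟨h1, h2, h3, h4, h5⟩ := hQ.suppIn i j hij
  simp only at h1 h2 h3 h4 h5
  rw [← expo_zero, expo_le]
  omega

/-- Relations that come from exact fractions, for numerators `x ^ i * y ^ j` with `(i, j)` in `X`,
where `x ^ v / y` is the first monomial of `Q` that involves `1 / y`. -/
lemma linearIndependent_theta (hα : α ≠ 0) {h d : ℕ} {Q Qi : BiSeries (ZMod (p ^ α))}
    (hQ : IsDenominator h d Q Qi) {v : ℤ} (hv : cf Q v (-1) ≠ 0)
    (hvmin : ∀ a < v, cf Q a (-1) = 0) {k : ℕ} (hk : k ≠ 0) (X : Finset (ℤ × ℤ))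
    (hX : ∀ e ∈ X, ∀ e' ∈ X, e' ≠ (e.1 + v, e.2 - 1)) :
    LinearIndependent (ZMod p) fun e : X =>
      mapHom (ZMod.castHom (dvd_pow_self p hα) (ZMod p)) (BiSeries.mono e.1.1 e.1.2 *
        (((e.1.2 / (e.1.2.gcd k : ℤ) : ℤ) : BiSeries (ZMod (p ^ α))) * Q -
          ((k / e.1.2.gcd k : ℕ) : BiSeries (ZMod (p ^ α))) * theta Q)) := by
  classical
  set π := ZMod.castHom (dvd_pow_self p hα) (ZMod p)
  have hπ : ∀ i j, cf Q i j ≠ 0 → π (cf Q i j) ≠ 0 := fun i j hij =>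
    ((hQ.isUnit i j hij).map π).ne_zero
  have hv1 : 1 ≤ v := by
    obtain ⟨h1, h2, h3, h4, h5⟩ := hQ.suppIn v (-1) hv
    simp only at h1 h2 h3 h4 h5
    omega
  have hcf : ∀ (i j J : ℤ) (k' : ℕ) (a b : ℤ), cf (mapHom π (BiSeries.mono i j *
      ((J : BiSeries (ZMod (p ^ α))) * Q - (k' : BiSeries (ZMod (p ^ α))) * theta Q))) a b =
      ((J : ZMod p) - k' * (b - j : ℤ)) * π (cf Q (a - i) (b - j)) := by
    intro i j J k' a b
    rw [cf_mapHom, cf_mono_mul, cf_sub, cf_intCast_mul, cf_natCast_mul, cf_theta, map_sub, map_mul,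
      map_mul, map_mul, map_intCast, map_natCast, map_intCast]
    ring
  -- The quotients of j and k by their gcd are coprime, so p cannot divide both.
  have hgcd : ∀ j : ℤ, ((j / (j.gcd k : ℤ) : ℤ) : ZMod p) = 0 → ((k / j.gcd k : ℕ) : ZMod p) ≠ 0 := by
    intro j h1 h2
    have hg : 0 < j.gcd k := Int.gcd_pos_of_ne_zero_right j (by exact_mod_cast hk)
    have h3 := Int.isCoprime_iff_gcd_eq_one.mpr (Int.gcd_ediv_gcd_ediv_gcd hg)
    rw [ZMod.intCast_zmod_eq_zero_iff_dvd] at h1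
    rw [ZMod.natCast_eq_zero_iff] at h2
    have h4 : (p : ℤ) ∣ (k : ℤ) / (j.gcd k : ℤ) := by
      rw [← Int.natCast_div]; exact_mod_cast h2
    have h5 := h3.isUnit_of_dvd' h1 h4
    exact (Nat.prime_iff_prime_int.mp hp.out).not_isUnit h5
  let J : X → ZMod p := fun e => ((e.1.2 / (e.1.2.gcd k : ℤ) : ℤ) : ZMod p)
  -- The weight a + v·b is zero at the monomials 1 and x^v/y of Q and positive at all others. So the
  -- lowest part of the series at (i, j) has, up to coefficients of Q, the entry J at (i, j) and J +
  -- k' at (i + v, j - 1). If J vanishes modulo p, then k' does not, and the second place is the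
  -- pivot. The condition on X prevents collisions.
  refine linearIndependent_of_pivot _ (fun e => e.1.1 + v * e.1.2)
    (fun e => if J e = 0 then (e.1.1 + v, e.1.2 - 1) else e.1) ?_ ?_
  · intro e
    by_cases hJ : J e = 0
    · simp only [hJ, if_true]
      rw [hcf, add_sub_cancel_left]
      have : e.1.2 - 1 - e.1.2 = -1 := by ring
      rw [this]
      refine mul_ne_zero ?_ (hπ _ _ hv)
      have h1 : ((e.1.2 / (e.1.2.gcd k : ℤ) : ℤ) : ZMod p) = 0 := hJ
      rw [h1]
      simpa using hgcd _ h1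
    · simp only [hJ, if_false]
      rw [hcf, sub_self, sub_self]
      refine mul_ne_zero ?_ (hπ _ _ hQ.ne_zero)
      simpa using hJ
  · intro t t' htt hω
    by_contra hne
    rw [hcf] at hne
    have h0 := right_ne_zero_of_mul hne
    have h1 : cf Q ((if J t = 0 then (t.1.1 + v, t.1.2 - 1) else t.1).1 - t'.1.1)
        ((if J t = 0 then (t.1.1 + v, t.1.2 - 1) else t.1).2 - t'.1.2) ≠ 0 := fun hz =>
      h0 (by rw [hz, map_zero])
    obtain ⟨a, ha⟩ : ∃ a, a = (if J t = 0 then (t.1.1 + v, t.1.2 - 1) else t.1).1 - t'.1.1 := ⟨_, rfl⟩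
    obtain ⟨b, hb⟩ : ∃ b, b = (if J t = 0 then (t.1.1 + v, t.1.2 - 1) else t.1).2 - t'.1.2 := ⟨_, rfl⟩
    rw [← ha, ← hb] at h1
    obtain ⟨g1, g2, g3, g4, g5⟩ := hQ.suppIn a b h1
    simp only at g1 g2 g3 g4 g5
    have hab : a + v * b = 0 := by
      have hω' : t.1.1 + v * t.1.2 ≤ t'.1.1 + v * t'.1.2 := hω
      have hle : a + v * b ≤ 0 := by
        rw [ha, hb]
        split_ifs
        · simp only; nlinarith
        · nlinarith
      have hge : 0 ≤ a + v * b := by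
        rcases lt_or_ge b 0 with hb0 | hb0
        · have hb1 : b = -1 := by omega
          rw [hb1] at h1 ⊢
          by_contra hc
          exact h1 (hvmin a (by linarith))
        · positivity
      exact le_antisymm hle hge
    have hcase : (a = 0 ∧ b = 0) ∨ (a = v ∧ b = -1) := by
      rcases lt_or_ge b 0 with hb0 | hb0
      · have hb1 : b = -1 := by omega
        right; refine ⟨?_, hb1⟩; rw [hb1] at hab; linarith
      · left
        have hb1 : b = 0 := by
          by_contra hc
          have : 1 ≤ b := by omega
          nlinarith
        exact ⟨by rw [hb1] at hab; linarith, hb1⟩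
    rcases hcase with ⟨ha0, hb0⟩ | ⟨ha0, hb0⟩
    · by_cases hJ : J t = 0
      · simp only [hJ, if_true] at ha hb
        apply hX t.1 t.2 t'.1 t'.2
        exact Prod.ext (by simp only; linarith) (by simp only; linarith)
      · simp only [hJ, if_false] at ha hb
        apply htt
        exact Subtype.ext (Prod.ext (by linarith) (by linarith))
    · by_cases hJ : J t = 0
      · simp only [hJ, if_true] at ha hb
        apply htt
        exact Subtype.ext (Prod.ext (by linarith) (by linarith))
      · simp only [hJ, if_false] at ha hb
        apply hX t'.1 t'.2 t.1 t.2
        exact Prod.ext (by simp only; linarith) (by simp only; linarith)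

/-- If `Q` does not involve `1 / y`, then all numerators `x ^ i * y ^ j` with `j > 0` are dead; if
`Q` involves only `x`, so are those with `j < 0`. -/
lemma isDead_mono {R : Type*} [CommRing R] {h d : ℕ} {Q Qi : BiSeries R}
    (hQ : IsDenominator h d Q Qi) (s : ℤ) (hs : SuppIn {e | 0 ≤ s * e.2} Q) (K : ℕ) {i j : ℤ}
    (hj : 0 < s * j) : IsDead Qi K (BiSeries.mono i j) := by
  have hQis : SuppIn {e : ℤ × ℤ | 0 ≤ s * e.2} Qi := by
    refine SuppIn.of_mul_eq_one hQ.mul_inv hQ.expo_nonneg (hQ.isUnit 0 0 hQ.ne_zero) hs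
      (by simp) ?_
    intro a b a' b' h1 h2
    simp only [Set.mem_ofPred_eq] at *
    rw [mul_add]; exact add_nonneg h1 h2
  have hpow : SuppIn {e : ℤ × ℤ | 0 ≤ s * e.2} (Qi ^ K) := by
    induction K with
    | zero => rw [pow_zero]; exact suppIn_one (by simp)
    | succ n ih =>
      rw [pow_succ]
      refine ih.mul hQis ?_
      intro a b a' b' h1 h2
      simp only [Set.mem_ofPred_eq] at *
      rw [mul_add]; exact add_nonneg h1 h2
  intro n
  rw [cf_mono_mul]
  by_contra hc
  have := hpow _ _ hc
  simp only [Set.mem_ofPred_eq] at this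
  nlinarith

lemma linearIndependent_mono (hα : α ≠ 0) (X : Finset (ℤ × ℤ)) :
    LinearIndependent (ZMod p) fun e : X =>
      mapHom (ZMod.castHom (dvd_pow_self p hα) (ZMod p)) (BiSeries.mono e.1.1 e.1.2) := by
  refine linearIndependent_of_pivot _ (fun _ => 0) (fun e => e.1) ?_ ?_
  · intro e
    rw [mapHom_mono, cf_mono]; simp
  · intro t t' htt _
    rw [mapHom_mono, cf_mono, if_neg]
    rintro ⟨h1, h2⟩
    exact htt (Subtype.ext (Prod.ext h1.symm h2.symm))

end BiSeries

/-! ### Lattice points of the boxes, and the supply of relations -/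

namespace BiSeries

/-- The number of points of `box h d K (-1) 0`. -/
def boxCount (h d K : ℕ) : ℕ := K ^ 2 * (h * d) - K * (K - 1) / 2

/-- The lattice points of a rectangle that violate the condition `0 ≤ i + j`. -/
def cornerFinset (K : ℕ) : Finset (ℤ × ℤ) :=
  ((Finset.range K).sigma fun s => Finset.range s).map
    ⟨fun x => ((x.2 : ℤ), -(x.1 : ℤ)), by
      rintro ⟨a, b⟩ ⟨c, e⟩ hab
      simp only [Prod.mk.injEq, neg_inj, Nat.cast_inj] at hab
      obtain ⟨rfl, rfl⟩ := hab
      rfl⟩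

lemma card_cornerFinset (K : ℕ) : (cornerFinset K).card = K * (K - 1) / 2 := by
  rw [cornerFinset, Finset.card_map, Finset.card_sigma]
  simp [Finset.sum_range_id]

lemma mem_cornerFinset {K : ℕ} {i j : ℤ} :
    (i, j) ∈ cornerFinset K ↔ 0 ≤ i ∧ -K < j ∧ i + j < 0 := by
  constructor
  · intro hx
    obtain ⟨⟨s, b⟩, h1, h2⟩ := Finset.mem_map.mp hx
    rw [Finset.mem_sigma, Finset.mem_range, Finset.mem_range] at h1
    simp only at h1
    have h3 : (b : ℤ) = i := congrArg Prod.fst h2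
    have h4 : -(s : ℤ) = j := congrArg Prod.snd h2
    omega
  · rintro ⟨h1, h2, h3⟩
    refine Finset.mem_map.mpr ⟨⟨(-j).toNat, i.toNat⟩, ?_, Prod.ext ?_ ?_⟩
    · rw [Finset.mem_sigma, Finset.mem_range, Finset.mem_range]
      simp only
      omega
    · exact Int.toNat_of_nonneg h1
    · change -((-j).toNat : ℤ) = j
      omega

/-- A, X and the K(K - 1)/2 points with i + j < 0 are disjoint subsets of a rectangle with Kh·Kd
points. The corner is missing because P(0,0) = 0 excludes the monomial 1/y from Q. -/
lemma ncard_add_corner_le {h d K : ℕ} (hh : 1 ≤ h) (hd : 1 ≤ d) {A : Set (ℤ × ℤ)} {X : Finset (ℤ × ℤ)}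
    (hA : ∀ i j : ℤ, (i, j) ∈ A → 0 ≤ i ∧ i < K * h ∧ -K < j ∧ j ≤ K * (d - 1) ∧ 0 ≤ i + j)
    (hX : ∀ i j : ℤ, (i, j) ∈ X → (i, j) ∉ A ∧ 0 ≤ i ∧ i < K * h ∧ -K < j ∧ j ≤ K * (d - 1) ∧ 0 ≤ i + j) :
    A.ncard + X.card ≤ boxCount h d K := by
  classical
  set Rect : Finset (ℤ × ℤ) := Finset.Ico 0 ((K : ℤ) * h) ×ˢ Finset.Ioc (-(K : ℤ)) (K * (d - 1))
    with hRect
  have hAfin : A.Finite := by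
    refine Rect.finite_toSet.subset fun e he => ?_
    obtain ⟨h1, h2, h3, h4, h5⟩ := hA e.1 e.2 he
    simp only [hRect, Finset.coe_product, Finset.coe_Ico, Finset.coe_Ioc]
    exact ⟨⟨h1, h2⟩, ⟨h3, h4⟩⟩
  have hcard : Rect.card = K ^ 2 * (h * d) := by
    rw [hRect, Finset.card_product, Int.card_Ico, Int.card_Ioc]
    have e1 : ((K : ℤ) * h - 0).toNat = K * h := by
      rw [sub_zero]; exact_mod_cast Int.toNat_natCast (K * h)
    have e2 : ((K : ℤ) * (d - 1) - -K).toNat = K * d := by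
      have : (K : ℤ) * (d - 1) - -K = ((K * d : ℕ) : ℤ) := by push_cast; ring
      rw [this, Int.toNat_natCast]
    rw [e1, e2]; ring
  have hsub : hAfin.toFinset ∪ X ∪ cornerFinset K ⊆ Rect := by
    rintro ⟨i, j⟩ he
    simp only [hRect, Finset.mem_product, Finset.mem_Ico, Finset.mem_Ioc]
    rw [Finset.mem_union, Finset.mem_union, Set.Finite.mem_toFinset] at he
    rcases he with (he | he) | he
    · obtain ⟨h1, h2, h3, h4, h5⟩ := hA _ _ he
      exact ⟨⟨h1, h2⟩, h3, h4⟩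
    · obtain ⟨-, h1, h2, h3, h4, h5⟩ := hX _ _ he
      exact ⟨⟨h1, h2⟩, h3, h4⟩
    · obtain ⟨h1, h2, h3⟩ := mem_cornerFinset.mp he
      have hh' : (1 : ℤ) ≤ h := by exact_mod_cast hh
      have hd' : (1 : ℤ) ≤ d := by exact_mod_cast hd
      refine ⟨⟨h1, by nlinarith⟩, h2, by nlinarith⟩
  have h1 := Finset.card_le_card hsub
  rw [Finset.card_union_of_disjoint, Finset.card_union_of_disjoint, hcard, card_cornerFinset,
    ← Set.ncard_eq_toFinset_card A hAfin] at h1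
  · rw [boxCount]; omega
  · rw [Finset.disjoint_left]
    rintro ⟨i, j⟩ h2 h3
    exact (hX _ _ h3).1 (by simpa using h2)
  · rw [Finset.disjoint_left]
    rintro ⟨i, j⟩ h2 h3
    obtain ⟨g1, g2, g3⟩ := mem_cornerFinset.mp h3
    rw [Finset.mem_union, Set.Finite.mem_toFinset] at h2
    rcases h2 with h2 | h2
    · obtain ⟨-, -, -, -, h5⟩ := hA _ _ h2
      omega
    · obtain ⟨-, -, -, -, -, h5⟩ := hX _ _ h2
      omega

lemma ncard_box_neg_one_le {h d : ℕ} (hh : 1 ≤ h) (hd : 1 ≤ d) (K : ℕ) :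
    (box h d K (-1) 0).ncard ≤ boxCount h d K := by
  have := ncard_add_corner_le (K := K) hh hd (A := box h d K (-1) 0) (X := ∅) ?_ (by simp)
  · simpa using this
  · rintro i j ⟨h1, h2, h3, h4, h5⟩
    simp only at *
    exact ⟨h1, by linarith, h3, by linarith, h5⟩

lemma ncard_box_zero_le {h d : ℕ} (hh : 1 ≤ h) (hd : 1 ≤ d) (K : ℕ) :
    (box h d K 0 0).ncard ≤ boxCount h d K + K * d := by
  classical
  let X : Finset (ℤ × ℤ) := {((K : ℤ) * h)} ×ˢ Finset.Ioc (-(K : ℤ)) (K * (d - 1))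
  have hX : X.card = K * d := by
    rw [Finset.card_product, Int.card_Ioc, Finset.card_singleton, one_mul]
    have : (K : ℤ) * (d - 1) - -K = ((K * d : ℕ) : ℤ) := by push_cast; ring
    rw [this, Int.toNat_natCast]
  have hsub : box h d K 0 0 ⊆ box h d K (-1) 0 ∪ X := by
    rintro ⟨i, j⟩ ⟨h1, h2, h3, h4, h5⟩
    simp only at *
    by_cases hi : i = K * h
    · right
      simp only [X, Finset.coe_product, Finset.coe_singleton, Finset.coe_Ioc]
      exact ⟨hi, h3, by simpa using h4⟩
    · left
      refine ⟨h1, ?_, h3, h4, h5⟩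
      simp only
      have : i < K * h := lt_of_le_of_ne (by simpa using h2) hi
      linarith
  calc _ ≤ (box h d K (-1) 0 ∪ X : Set (ℤ × ℤ)).ncard :=
        Set.ncard_le_ncard hsub ((box_finite _ _ _ _ _).union X.finite_toSet)
    _ ≤ (box h d K (-1) 0).ncard + (X : Set (ℤ × ℤ)).ncard := Set.ncard_union_le _ _
    _ ≤ _ := by
      rw [Set.ncard_coe_finset, hX]
      exact Nat.add_le_add_right (ncard_box_neg_one_le hh hd K) _

/-- The exponents of `box h d K 0 0` that do not lie on the left, right or top edge. -/
def innerBox (h d K : ℤ) : Set (ℤ × ℤ) :=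
  {e | 0 < e.1 ∧ e.1 < K * h ∧ -K < e.2 ∧ e.2 < K * (d - 1) ∧ 0 ≤ e.1 + e.2}

lemma innerBox_finite (h d K : ℤ) : (innerBox h d K).Finite := by
  refine (box_finite h d K 0 0).subset ?_
  rintro ⟨i, j⟩ ⟨h1, h2, h3, h4, h5⟩
  exact ⟨h1.le, by linarith, h3, by linarith, h5⟩

lemma ncard_innerBox_add_le {h d : ℕ} (hh : 1 ≤ h) (hd : 1 ≤ d) {K : ℕ} (hK : 1 ≤ K) :
    (innerBox h d K).ncard + K * (h + d - 1) ≤ boxCount h d K := by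
  classical
  have hh' : (1 : ℤ) ≤ h := by exact_mod_cast hh
  have hd' : (1 : ℤ) ≤ d := by exact_mod_cast hd
  have hK' : (1 : ℤ) ≤ K := by exact_mod_cast hK
  have hKd : (0 : ℤ) ≤ K * (d - 1) := by nlinarith
  have hKh : (1 : ℤ) ≤ K * h := by nlinarith
  -- K(d - 1) + 1 points of the left edge and Kh - 1 points of the top edge; the right edge does not
  -- enter `boxCount`.
  let X : Finset (ℤ × ℤ) := {(0 : ℤ)} ×ˢ Finset.Icc (0 : ℤ) (K * (d - 1)) ∪
    Finset.Ico (1 : ℤ) (K * h) ×ˢ {((K : ℤ) * (d - 1))}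
  have hX : X.card = K * (h + d - 1) := by
    rw [Finset.card_union_of_disjoint]
    · rw [Finset.card_product, Finset.card_product, Finset.card_singleton, Finset.card_singleton,
        Int.card_Icc, Int.card_Ico, one_mul, mul_one]
      obtain ⟨d', rfl⟩ := Nat.exists_eq_add_of_le hd
      have h1 : ((K * (h + (1 + d') - 1) : ℕ) : ℤ) = K * h + K * ((1 + d' : ℕ) - 1 : ℤ) := by
        rw [show h + (1 + d') - 1 = h + d' by omega]; push_cast; ring
      omega
    · rw [Finset.disjoint_left]
      rintro ⟨i, j⟩ h1 h2
      simp only [Finset.mem_product, Finset.mem_singleton, Finset.mem_Ico] at h1 h2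
      omega
  rw [← hX]
  refine ncard_add_corner_le hh hd ?_ ?_
  · rintro i j ⟨h1, h2, h3, h4, h5⟩
    exact ⟨h1.le, h2, h3, h4.le, h5⟩
  · intro i j hij
    simp only [X, Finset.mem_union, Finset.mem_product, Finset.mem_singleton, Finset.mem_Icc,
      Finset.mem_Ico] at hij
    rcases hij with ⟨h1, h2, h3⟩ | ⟨⟨h1, h2⟩, h3⟩
    · refine ⟨?_, by omega, by omega, by omega, h3, by omega⟩
      rintro ⟨g1, -⟩
      simp only at g1
      omega
    · refine ⟨?_, by omega, h2, by omega, h3.le, by omega⟩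
      rintro ⟨g1, g2, g3, g4, g5⟩
      simp only at g4
      omega

lemma suppIn_theta_relation {R : Type*} [CommRing R] {h d k ε : ℤ} {Q : BiSeries R}
    (hQ : SuppIn (newt h d 1) Q) {i j : ℤ} (hij : (i, j) ∈ box h d k ε 0) (J : ℤ) (k' : ℕ) :
    SuppIn (box h d (k + 1) ε 0) (BiSeries.mono i j *
      ((J : BiSeries R) * Q - (k' : BiSeries R) * theta Q)) :=
  (suppIn_mono hij).box_mul_newt ((hQ.intCast_mul J).sub (hQ.theta.natCast_mul k'))

lemma exists_first_monomial {R : Type*} [CommRing R] {h d : ℕ} {Q Qi : BiSeries R}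
    (hQ : IsDenominator h d Q Qi) (hne : ∃ a, cf Q a (-1) ≠ 0) :
    ∃ v : ℤ, 1 ≤ v ∧ v ≤ h ∧ cf Q v (-1) ≠ 0 ∧ ∀ a < v, cf Q a (-1) = 0 := by
  classical
  have hb : ∀ a, cf Q a (-1) ≠ 0 → 1 ≤ a ∧ a ≤ h := by
    intro a ha
    obtain ⟨h1, h2, h3, h4, h5⟩ := hQ.suppIn a (-1) ha
    simp only at h1 h2 h3 h4 h5
    omega
  have hex : ∃ n : ℕ, cf Q n (-1) ≠ 0 := by
    obtain ⟨a, ha⟩ := hne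
    refine ⟨a.toNat, ?_⟩
    rwa [Int.toNat_of_nonneg (by have := hb a ha; omega)]
  refine ⟨Nat.find hex, (hb _ (Nat.find_spec hex)).1, (hb _ (Nat.find_spec hex)).2,
    Nat.find_spec hex, fun a ha => ?_⟩
  by_contra hc
  have h1 := hb a hc
  have := Nat.find_min' hex (m := a.toNat) (by rwa [Int.toNat_of_nonneg (by omega)])
  omega

variable {p α : ℕ} [hp : Fact p.Prime] {h d : ℕ} {Q Qi : BiSeries (ZMod (p ^ α))}

lemma exists_relations_theta (hα : α ≠ 0) (hQ : IsDenominator h d Q Qi) {v : ℤ}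
    (hv : cf Q v (-1) ≠ 0) (hvmin : ∀ a < v, cf Q a (-1) = 0) {k : ℕ} (hk : k ≠ 0) {ε : ℤ}
    (X : Finset (ℤ × ℤ)) (hX : ∀ e ∈ X, ∀ e' ∈ X, e' ≠ (e.1 + v, e.2 - 1))
    (hXb : ∀ e ∈ X, e ∈ box h d k ε 0) :
    ∃ S : X → BiSeries (ZMod (p ^ α)), (∀ t, SuppIn (box h d (k + 1 : ℕ) ε 0) (S t)) ∧
      (∀ t, IsDead Qi (k + 1) (S t)) ∧ LinearIndependent (ZMod p) fun t =>
        mapHom (ZMod.castHom (dvd_pow_self p hα) (ZMod p)) (S t) := by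
  refine ⟨_, fun e => ?_, fun e => ?_, linearIndependent_theta hα hQ hv hvmin hk X hX⟩
  · rw [Nat.cast_add, Nat.cast_one]
    exact suppIn_theta_relation hQ.suppIn (hXb e.1 e.2) _ _
  · have hg : e.1.2.gcd k ≠ 0 := (Int.gcd_pos_of_ne_zero_right _ (by exact_mod_cast hk)).ne'
    refine isDead_theta hα hQ.mul_inv hQ.expo_nonneg (hQ.isUnit 0 0 hQ.ne_zero) hg ?_ ?_
    · exact (Int.mul_ediv_cancel' (Int.gcd_dvd_left ..)).symm
    · refine (Nat.mul_div_cancel' ?_).symm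
      exact_mod_cast Int.gcd_dvd_right e.1.2 (k : ℤ)

/-- The case without 1/y in Q, where monomials replace exact fractions. For d ≥ 2 the columns i = 0,
1 above the row y^0 supply 2K(d - 1) ≥ Kd dead numerators. For d = 1, Q depends on x alone and the
row j = -1 is dead. -/
lemma exists_relations_mono (hα : α ≠ 0) (hQ : IsDenominator h d Q Qi) (hd : 1 ≤ d)
    (hQ0 : ∀ a, cf Q a (-1) = 0) {K : ℕ} (hK : 2 ≤ K) {n : ℕ} {ε : ℤ} (hn : n ≤ K * d)
    (hn' : d = 1 → (n : ℤ) ≤ K * h + ε) (hKε : 1 ≤ K * h + ε) :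
    ∃ (X : Finset (ℤ × ℤ)) (S : X → BiSeries (ZMod (p ^ α))), n ≤ X.card ∧
      (∀ t, SuppIn (box h d K ε 0) (S t)) ∧ (∀ t, IsDead Qi K (S t)) ∧
      LinearIndependent (ZMod p) fun t =>
        mapHom (ZMod.castHom (dvd_pow_self p hα) (ZMod p)) (S t) := by
  have hsupp : ∀ i j, cf Q i j ≠ 0 → 0 ≤ j ∧ j ≤ d - 1 := by
    intro i j hij
    obtain ⟨h1, h2, h3, h4, h5⟩ := hQ.suppIn i j hij
    simp only at h1 h2 h3 h4 h5
    refine ⟨?_, by linarith⟩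
    by_contra hc
    have : j = -1 := by omega
    exact hij (this ▸ hQ0 i)
  have hK' : (2 : ℤ) ≤ K := by exact_mod_cast hK
  rcases Nat.lt_or_ge 1 d with hd1 | hd1
  · have hd' : (2 : ℤ) ≤ d := by exact_mod_cast hd1
    refine ⟨Finset.Icc (0 : ℤ) 1 ×ˢ Finset.Icc (1 : ℤ) (K * (d - 1)), fun e => mono e.1.1 e.1.2,
      ?_, ?_, ?_, linearIndependent_mono hα _⟩
    · rw [Finset.card_product, Int.card_Icc, Int.card_Icc]
      have h1 : ((K * (d - 1) : ℕ) : ℤ) = K * (d - 1 : ℤ) := by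
        push_cast [Nat.cast_sub hd]; ring
      have h2 : ((1 : ℤ) + 1 - 0).toNat = 2 := rfl
      rw [h2, ← h1, add_sub_cancel_right, Int.toNat_natCast]
      refine hn.trans ?_
      obtain ⟨d', rfl⟩ := Nat.exists_eq_add_of_le hd1
      have : 1 + 1 + d' - 1 = 1 + d' := by omega
      rw [Nat.succ_eq_add_one, this]
      nlinarith
    · rintro ⟨⟨i, j⟩, he⟩
      simp only [Finset.mem_product, Finset.mem_Icc] at he
      refine suppIn_mono ⟨?_, ?_, ?_, ?_, ?_⟩ <;> simp only <;> omega
    · rintro ⟨⟨i, j⟩, he⟩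
      simp only [Finset.mem_product, Finset.mem_Icc] at he
      refine isDead_mono hQ 1 (fun i j hij => ?_) K (by simp only; omega)
      simpa using (hsupp i j hij).1
  · have hd2 : d = 1 := by omega
    refine ⟨Finset.Icc (1 : ℤ) (K * h + ε) ×ˢ {-1}, fun e => mono e.1.1 e.1.2,
      ?_, ?_, ?_, linearIndependent_mono hα _⟩
    · rw [Finset.card_product, Int.card_Icc, Finset.card_singleton]
      have := hn' hd2
      omega
    · rintro ⟨⟨i, j⟩, he⟩
      simp only [Finset.mem_product, Finset.mem_Icc, Finset.mem_singleton] at he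
      rw [hd2]
      refine suppIn_mono ⟨?_, ?_, ?_, ?_, ?_⟩ <;> simp only <;> push_cast <;> omega
    · rintro ⟨⟨i, j⟩, he⟩
      simp only [Finset.mem_product, Finset.mem_Icc, Finset.mem_singleton] at he
      refine isDead_mono hQ (-1) (fun i j hij => ?_) K (by simp only; omega)
      have := hsupp i j hij
      simp only [Set.mem_ofPred_eq]
      rw [hd2] at this
      push_cast at this
      omega

/-- There are enough relations between the fractions with denominator `Q ^ 2`. -/
lemma exists_relations_two (hα : α ≠ 0) (hQ : IsDenominator h d Q Qi) (hh : 1 ≤ h) (hd : 1 ≤ d) :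
    ∃ (X : Finset (ℤ × ℤ)) (S : X → BiSeries (ZMod (p ^ α))), d ≤ X.card ∧
      (∀ t, SuppIn (box h d 2 (-1) 0) (S t)) ∧ (∀ t, IsDead Qi 2 (S t)) ∧
      LinearIndependent (ZMod p) fun t =>
        mapHom (ZMod.castHom (dvd_pow_self p hα) (ZMod p)) (S t) := by
  have hh' : (1 : ℤ) ≤ h := by exact_mod_cast hh
  have hd' : (1 : ℤ) ≤ d := by exact_mod_cast hd
  by_cases hne : ∃ a, cf Q a (-1) ≠ 0
  · obtain ⟨v, hv1, hvh, hv, hvmin⟩ := exists_first_monomial hQ hne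
    -- A single column i = 0, whence ε = -h: after multiplication by Q its numerators have x-degree
    -- at most h, to the left of the right edge i = 2h.
    let X : Finset (ℤ × ℤ) := {(0 : ℤ)} ×ˢ Finset.Icc (0 : ℤ) (d - 1)
    obtain ⟨S, h1, h2, h3⟩ := exists_relations_theta hα hQ hv hvmin one_ne_zero (ε := -h) X
      (by
        rintro ⟨i, j⟩ he ⟨i', j'⟩ he' hee
        simp only [X, Finset.mem_product, Finset.mem_singleton] at he he'
        rw [Prod.mk.injEq] at hee
        simp only at hee
        omega)
      (by
        rintro ⟨i, j⟩ he
        simp only [X, Finset.mem_product, Finset.mem_singleton, Finset.mem_Icc] at he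
        refine ⟨?_, ?_, ?_, ?_, ?_⟩ <;> simp only <;> push_cast <;> omega)
    refine ⟨X, S, ?_, fun t => (h1 t).mono ?_, h2, h3⟩
    · rw [Finset.card_product, Int.card_Icc, Finset.card_singleton]
      omega
    · rintro ⟨i, j⟩ ⟨g1, g2, g3, g4, g5⟩
      simp only at *
      refine ⟨g1, ?_, by simpa using g3, by simpa using g4, g5⟩
      push_cast at g2 ⊢
      linarith
  · push Not at hne
    exact exists_relations_mono hα hQ hd hne le_rfl (by nlinarith) (fun h1 => by
      rw [h1]; push_cast; omega) (by push_cast; omega)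

/-- There are enough relations between the fractions with denominator `Q ^ K` for `K ≥ 3`. -/
lemma exists_relations_of_three_le (hα : α ≠ 0) (hQ : IsDenominator h d Q Qi) (hh : 1 ≤ h)
    (hd : 1 ≤ d) {K : ℕ} (hK : 3 ≤ K) :
    ∃ (X : Finset (ℤ × ℤ)) (S : X → BiSeries (ZMod (p ^ α))), K * d ≤ X.card ∧
      (∀ t, SuppIn (box h d K 0 0) (S t)) ∧ (∀ t, IsDead Qi K (S t)) ∧
      LinearIndependent (ZMod p) fun t =>
        mapHom (ZMod.castHom (dvd_pow_self p hα) (ZMod p)) (S t) := by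
  have hh' : (1 : ℤ) ≤ h := by exact_mod_cast hh
  have hd' : (1 : ℤ) ≤ d := by exact_mod_cast hd
  by_cases hne : ∃ a, cf Q a (-1) ≠ 0
  · obtain ⟨v, hv1, hvh, hv, hvmin⟩ := exists_first_monomial hQ hne
    obtain ⟨k, rfl⟩ : ∃ k, K = k + 1 := ⟨K - 1, by omega⟩
    have hk : (2 : ℤ) ≤ k := by have : 2 ≤ k := by omega
                                exact_mod_cast this
    have hkh : (h : ℤ) < k * h := by nlinarith
    have hkd : (0 : ℤ) ≤ k * (d - 1) := by nlinarith
    have hkk : (k : ℤ) ≤ k * h := by nlinarith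
    -- The two columns are more than v apart since kh > h ≥ v for k ≥ 2, so no two points differ by
    -- (v, -1). The number of points exceeds (k + 1)d by (k - 1)(d - 1).
    let X : Finset (ℤ × ℤ) := {(0 : ℤ)} ×ˢ Finset.Icc (0 : ℤ) (k * (d - 1)) ∪
      {(k * h : ℤ)} ×ˢ Finset.Ioc (-k : ℤ) (k * (d - 1))
    obtain ⟨S, h1, h2, h3⟩ := exists_relations_theta hα hQ hv hvmin (k := k) (by omega) (ε := 0) X
      (by
        rintro ⟨i, j⟩ he ⟨i', j'⟩ he' hee
        simp only [X, Finset.mem_product, Finset.mem_singleton, Finset.mem_union] at he he'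
        rw [Prod.mk.injEq] at hee
        simp only at hee
        omega)
      (by
        rintro ⟨i, j⟩ he
        simp only [X, Finset.mem_product, Finset.mem_singleton, Finset.mem_Icc, Finset.mem_union,
          Finset.mem_Ioc] at he
        refine ⟨?_, ?_, ?_, ?_, ?_⟩ <;> simp only <;> omega)
    refine ⟨X, S, ?_, h1, h2, h3⟩
    rw [Finset.card_union_of_disjoint]
    · rw [Finset.card_product, Finset.card_product, Int.card_Icc, Int.card_Ioc,
        Finset.card_singleton, Finset.card_singleton, one_mul, one_mul]
      have e1 : (((k + 1) * d : ℕ) : ℤ) ≤ (k * (d - 1) + 1 - 0) + (k * (d - 1) - -k) := by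
        push_cast; nlinarith
      omega
    · rw [Finset.disjoint_left]
      rintro ⟨i, j⟩ g1 g2
      simp only [Finset.mem_product, Finset.mem_singleton] at g1 g2
      omega
  · push Not at hne
    have hK' : (3 : ℤ) ≤ K := by exact_mod_cast hK
    exact exists_relations_mono hα hQ hd hne (by omega) le_rfl (fun h1 => by
      rw [h1]; push_cast; nlinarith) (by nlinarith)

end BiSeries

/-! ### The number of rows of fractions -/

namespace BiSeries

/-- The sequence of the coefficients of the monomials `x ^ n`. -/
noncomputable def rowZero {R : Type*} [CommRing R] : BiSeries R →ₗ[R] (ℕ → R) where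
  toFun f n := cf f n 0
  map_add' f g := by ext n; simp
  map_smul' c f := by ext n; simp

lemma rowZero_apply {R : Type*} [CommRing R] (f : BiSeries R) (n : ℕ) :
    rowZero f n = cf f n 0 := rfl

lemma IsDead.rowZero_eq {R : Type*} [CommRing R] {Qi S : BiSeries R} {K : ℕ} (hS : IsDead Qi K S)
    (c : R) : rowZero (c • (S * Qi ^ K)) = 0 := by
  ext n
  rw [map_smul, Pi.smul_apply, rowZero_apply, hS, smul_zero, Pi.zero_apply]

variable {p α : ℕ} [hp : Fact p.Prime] {h d : ℕ} {Q Qi : BiSeries (ZMod (p ^ α))}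

omit hp in
lemma fracs_eq_bot {k K : ℕ} (hk : α ≤ k) (B : Set (ℤ × ℤ)) :
    fracs Qi ((p : ZMod (p ^ α)) ^ k) K B = ⊥ := by
  rw [eq_bot_iff, natCast_pow_eq_zero hk]
  exact fun f hf => eq_zero_of_mem_fracs_zero hf

lemma card_sup_map_fracs_le (hα : α ≠ 0) (H : Submodule (ZMod (p ^ α)) (BiSeries (ZMod (p ^ α))))
    {b : ℕ} (hH : Finite ↥(H.map rowZero) ∧ Nat.card ↥(H.map rowZero) ≤ b)
    (c : ZMod (p ^ α)) (K : ℕ) {B : Set (ℤ × ℤ)} (hB : B.Finite)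
    (hle : fracs Qi (p * c) K B ≤ H) {w : ℕ}
    (hrel : ∃ (X : Finset (ℤ × ℤ)) (S : X → BiSeries (ZMod (p ^ α))), B.ncard ≤ w + X.card ∧
      (∀ t, SuppIn B (S t)) ∧ (∀ t, IsDead Qi K (S t)) ∧ LinearIndependent (ZMod p) fun t =>
        mapHom (ZMod.castHom (dvd_pow_self p hα) (ZMod p)) (S t)) :
    Finite ↥((H ⊔ fracs Qi c K B).map rowZero) ∧
      Nat.card ↥((H ⊔ fracs Qi c K B).map rowZero) ≤ p ^ w * b := by
  obtain ⟨X, S, hX, h1, h2, h3⟩ := hrel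
  have := hH.1
  have key := card_sup_map_fracs_mul_le hα (H.map rowZero) rowZero Qi c K hB
    (fun f hf => Submodule.mem_map_of_mem (hle hf)) S h1
    (fun t => by rw [(h2 t).rowZero_eq]; exact Submodule.zero_mem _) h3
  rw [← Submodule.map_sup] at key
  refine ⟨key.1, ?_⟩
  have hpos : 0 < p ^ X.card := pow_pos hp.out.pos _
  refine Nat.le_of_mul_le_mul_right ?_ hpos
  calc _ ≤ p ^ B.ncard * Nat.card ↥(H.map rowZero) := by simpa using key.2
    _ ≤ p ^ (w + X.card) * b := Nat.mul_le_mul (Nat.pow_le_pow_right hp.out.pos hX) hH.2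
    _ = _ := by rw [pow_add]; ring

lemma exists_no_relations (hα : α ≠ 0) (B : Set (ℤ × ℤ)) (K : ℕ) {w : ℕ} (hw : B.ncard ≤ w) :
    ∃ (X : Finset (ℤ × ℤ)) (S : X → BiSeries (ZMod (p ^ α))), B.ncard ≤ w + X.card ∧
      (∀ t, SuppIn B (S t)) ∧ (∀ t, IsDead Qi K (S t)) ∧ LinearIndependent (ZMod p) fun t =>
        mapHom (ZMod.castHom (dvd_pow_self p hα) (ZMod p)) (S t) :=
  ⟨∅, fun t => absurd t.2 (Finset.notMem_empty _), by simpa using hw,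
    fun t => absurd t.2 (Finset.notMem_empty _), fun t => absurd t.2 (Finset.notMem_empty _),
    linearIndependent_empty_type⟩

/-- The fractions of the levels `j, j + 1, …`, with numerators of the level `k` in `B k`. -/
noncomputable def fracsFrom (Qi : BiSeries (ZMod (p ^ α))) (B : ℕ → Set (ℤ × ℤ)) (j : ℕ) :
    Submodule (ZMod (p ^ α)) (BiSeries (ZMod (p ^ α))) :=
  ⨆ i, fracs Qi ((p : ZMod (p ^ α)) ^ (j + i)) (j + i + 1) (B (j + i))

omit hp in
lemma fracsFrom_succ_sup (B : ℕ → Set (ℤ × ℤ)) (j : ℕ) :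
    fracsFrom Qi B (j + 1) ⊔ fracs Qi ((p : ZMod (p ^ α)) ^ j) (j + 1) (B j) = fracsFrom Qi B j := by
  rw [sup_comm, fracsFrom, fracsFrom,
    ← sup_iSup_nat_succ fun i => fracs Qi ((p : ZMod (p ^ α)) ^ (j + i)) (j + i + 1) (B (j + i))]
  simp only [add_zero, add_assoc, add_comm 1]

omit hp in
lemma le_fracsFrom (B : ℕ → Set (ℤ × ℤ)) {j k : ℕ} (hjk : j ≤ k) :
    fracs Qi ((p : ZMod (p ^ α)) ^ k) (k + 1) (B k) ≤ fracsFrom Qi B j := by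
  obtain ⟨i, rfl⟩ := Nat.exists_eq_add_of_le hjk
  exact le_iSup (fun i => fracs Qi ((p : ZMod (p ^ α)) ^ (j + i)) (j + i + 1) (B (j + i))) i

omit hp in
lemma fracsFrom_eq_bot {j : ℕ} (hj : α ≤ j) (B : ℕ → Set (ℤ × ℤ)) : fracsFrom Qi B j = ⊥ := by
  rw [fracsFrom, iSup_eq_bot]
  exact fun i => fracs_eq_bot (by omega) _

/-- Descending induction from level α, which is zero. Since p times level k lies in level k + 1,
level k contributes p to the number of its monomials minus the number of its relations. -/
lemma card_map_fracsFrom_le (hα : α ≠ 0) {B : ℕ → Set (ℤ × ℤ)} (hB : ∀ k, (B k).Finite)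
    {w : ℕ → ℕ} {j : ℕ}
    (hstep : ∀ k, j ≤ k → fracs Qi ((p : ZMod (p ^ α)) ^ (k + 1)) (k + 1) (B k) ≤
      fracs Qi ((p : ZMod (p ^ α)) ^ (k + 1)) (k + 2) (B (k + 1)))
    (hrel : ∀ k, j ≤ k → ∃ (X : Finset (ℤ × ℤ)) (S : X → BiSeries (ZMod (p ^ α))),
      (B k).ncard ≤ w k + X.card ∧ (∀ t, SuppIn (B k) (S t)) ∧ (∀ t, IsDead Qi (k + 1) (S t)) ∧
      LinearIndependent (ZMod p) fun t =>
        mapHom (ZMod.castHom (dvd_pow_self p hα) (ZMod p)) (S t)) :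
    Finite ↥((fracsFrom Qi B j).map rowZero) ∧
      Nat.card ↥((fracsFrom Qi B j).map rowZero) ≤ p ^ ∑ k ∈ Finset.Ico j α, w k := by
  induction hm : α - j generalizing j with
  | zero =>
    rw [fracsFrom_eq_bot (by omega), Submodule.map_bot]
    exact ⟨inferInstance, by simpa using Nat.one_le_pow _ _ hp.out.pos⟩
  | succ m ih =>
    have h1 := ih (j := j + 1) (fun k hk => hstep k (by omega)) (fun k hk => hrel k (by omega))
      (by omega)
    rw [← fracsFrom_succ_sup, Finset.sum_eq_sum_Ico_succ_bot (by omega), pow_add]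
    refine card_sup_map_fracs_le hα _ h1 _ _ (hB j) ?_ (hrel j le_rfl)
    rw [← pow_succ']
    exact (hstep j le_rfl).trans (le_fracsFrom B le_rfl)

/-- The number of the sequences of coefficients of the fractions that arise from the sections at
positive remainders. -/
lemma card_map_levelFracs_sup_excessFracs_le (hα : α ≠ 0) (hQ : IsDenominator h d Q Qi)
    (hh : 1 ≤ h) (hd : 1 ≤ d) :
    Finite ↥((levelFracs Qi (p : ZMod (p ^ α)) h d (-1) 0 ⊔
      excessFracs Qi (p : ZMod (p ^ α)) h d 0 0).map rowZero) ∧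
    Nat.card ↥((levelFracs Qi (p : ZMod (p ^ α)) h d (-1) 0 ⊔
      excessFracs Qi (p : ZMod (p ^ α)) h d 0 0).map rowZero) ≤
        p ^ ∑ k ∈ Finset.range α, boxCount h d (k + 1) := by
  have hup : ∀ (ε : ℤ) (k : ℕ) (c : ZMod (p ^ α)), fracs Qi c (k + 1) (box h d (k + 1 : ℕ) ε 0) ≤
      fracs Qi c (k + 2) (box h d (k + 2 : ℕ) ε 0) := fun ε k c =>
    fracs_le_add hQ.suppIn hQ.mul_inv c (k + 1) 1 ε 0
  have hbox : ∀ K : ℤ, box h d K (-1) 0 ⊆ box h d K 0 0 := by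
    rintro K ⟨i, j⟩ ⟨h1, h2, h3, h4, h5⟩
    exact ⟨h1, by simp only at *; linarith, h3, h4, h5⟩
  set B : ℕ → Set (ℤ × ℤ) := fun k => box h d (k + 1 : ℕ) 0 0
  let edge : Set (ℤ × ℤ) := {(h : ℤ)} ×ˢ Set.Icc (0 : ℤ) (d - 1)
  have hedge : edge = (({(h : ℤ)} ×ˢ Finset.Icc (0 : ℤ) (d - 1) : Finset (ℤ × ℤ)) : Set (ℤ × ℤ)) := by
    rw [Finset.coe_product, Finset.coe_singleton, Finset.coe_Icc]
  have hedge' : edge.Finite := hedge ▸ Finset.finite_toSet _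
  have hcard : edge.ncard ≤ d := by
    rw [hedge, Set.ncard_coe_finset, Finset.card_product, Int.card_Icc, Finset.card_singleton]
    omega
  -- The filtration T2 ≤ T1e ≤ T1 ≤ T0. Right edges are needed only for the excess fractions: (k +
  -- 1)d additional monomials at each level k ≥ 2, and d monomials for the numerators over Q with
  -- scalar p. Relations over Q^(k+1) pay for the former, d relations over Q^2 for the latter. Level
  -- 0 needs no edge.
  set T2 := fracsFrom Qi B 2
  set T1e := T2 ⊔ fracs Qi (p : ZMod (p ^ α)) 1 edge
  set T1 := T1e ⊔ fracs Qi (p : ZMod (p ^ α)) 2 (box h d (2 : ℕ) (-1) 0)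
  set T0 := T1 ⊔ fracs Qi (1 : ZMod (p ^ α)) 1 (box h d (1 : ℕ) (-1) 0)
  have hT2 : Finite ↥(T2.map rowZero) ∧
      Nat.card ↥(T2.map rowZero) ≤ p ^ ∑ k ∈ Finset.Ico 2 α, boxCount h d (k + 1) := by
    refine card_map_fracsFrom_le hα (fun k => box_finite _ _ _ _ _) (fun k _ => hup 0 k _)
      fun k hk => ?_
    obtain ⟨X, S, h1, h2, h3, h4⟩ := exists_relations_of_three_le hα hQ hh hd (K := k + 1) (by omega)
    exact ⟨X, S, (ncard_box_zero_le hh hd _).trans (Nat.add_le_add_left h1 _), h2, h3, h4⟩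
  have hedgeBox : edge ⊆ box h d (1 : ℕ) 0 0 := by
    rintro ⟨i, j⟩ ⟨h1, h2, h3⟩
    simp only [Set.mem_singleton_iff] at h1
    simp only at h2 h3
    refine ⟨?_, ?_, ?_, ?_, ?_⟩ <;> simp only <;> push_cast <;> omega
  have hT1 : Finite ↥(T1.map rowZero) ∧
      Nat.card ↥(T1.map rowZero) ≤ p ^ ∑ k ∈ Finset.Ico 1 α, boxCount h d (k + 1) := by
    by_cases hα1 : α = 1
    · have hp0 : (p : ZMod (p ^ α)) = 0 := by
        rw [← pow_one (p : ZMod (p ^ α))]; exact natCast_pow_eq_zero hα1.le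
      have h0 : T1 = ⊥ := by
        have e1 : T2 = ⊥ := fracsFrom_eq_bot (by omega) _
        have e2 : ∀ (K : ℕ) B', fracs Qi (p : ZMod (p ^ α)) K B' = ⊥ := fun K B' => by
          rw [← pow_one (p : ZMod (p ^ α))]; exact fracs_eq_bot hα1.le _
        simp only [T1, T1e, e1, e2, sup_bot_eq]
      rw [h0, Submodule.map_bot]
      exact ⟨inferInstance, by simpa using Nat.one_le_pow _ _ hp.out.pos⟩
    · have h1 := card_sup_map_fracs_le hα T2 hT2 (p : ZMod (p ^ α)) 1 hedge' (w := d) (by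
        rw [← pow_two]
        -- p^2 times an edge fraction over Q can be written over Q^3, hence lies in T2.
        exact (((fracs_mono _ _ _ hedgeBox).trans (hup 0 0 _)).trans (hup 0 1 _)).trans
          (le_fracsFrom B le_rfl)) (exists_no_relations hα _ _ hcard)
      obtain ⟨X, S, g1, g2, g3, g4⟩ := exists_relations_two hα hQ hh hd
      have hfin := h1.1
      have key := card_sup_map_fracs_mul_le hα (T1e.map rowZero) rowZero Qi (p : ZMod (p ^ α)) 2
        (box_finite h d (2 : ℕ) (-1) 0) (fun f hf => Submodule.mem_map_of_mem (by
          rw [← pow_two] at hf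
          exact Submodule.mem_sup_left (((fracs_mono _ _ _ (hbox _)).trans (hup 0 1 _)).trans
            (le_fracsFrom B le_rfl) hf))) S g2
        (fun t => by rw [(g3 t).rowZero_eq]; exact Submodule.zero_mem _) g4
      rw [← Submodule.map_sup] at key
      refine ⟨key.1, Nat.le_of_mul_le_mul_right ?_ (pow_pos hp.out.pos X.card)⟩
      rw [Finset.sum_eq_sum_Ico_succ_bot (by omega)]
      calc _ ≤ p ^ (box h d (2 : ℕ) (-1) 0).ncard * Nat.card ↥(T1e.map rowZero) := by
            have := key.2
            rwa [Fintype.card_coe] at this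
        _ ≤ p ^ boxCount h d 2 * (p ^ d * p ^ ∑ k ∈ Finset.Ico 2 α, boxCount h d (k + 1)) :=
          Nat.mul_le_mul (Nat.pow_le_pow_right hp.out.pos (ncard_box_neg_one_le hh hd 2)) h1.2
        _ ≤ p ^ boxCount h d 2 * (p ^ X.card * p ^ ∑ k ∈ Finset.Ico 2 α, boxCount h d (k + 1)) := by
          gcongr
          exact hp.out.pos
        _ = _ := by rw [pow_add]; ring
  have hT0 : Finite ↥(T0.map rowZero) ∧
      Nat.card ↥(T0.map rowZero) ≤ p ^ ∑ k ∈ Finset.range α, boxCount h d (k + 1) := by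
    rw [Finset.range_eq_Ico, Finset.sum_eq_sum_Ico_succ_bot (by omega), pow_add]
    refine card_sup_map_fracs_le hα T1 hT1 1 1 (box_finite _ _ _ _ _) ?_
      (exists_no_relations hα _ _ (ncard_box_neg_one_le hh hd 1))
    rw [mul_one]
    exact (hup (-1) 0 _).trans le_sup_right
  have hlast : levelFracs Qi (p : ZMod (p ^ α)) h d (-1) 0 ⊔
      excessFracs Qi (p : ZMod (p ^ α)) h d 0 0 ≤ T0 := by
    refine sup_le (iSup_le fun k => ?_) (sup_le ?_ (iSup_le fun k => ?_))
    · match k with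
      | 0 => rw [pow_zero]; exact le_sup_right
      | 1 => rw [pow_one]; exact le_sup_right.trans le_sup_left
      | k + 2 =>
        exact ((fracs_mono _ _ _ (hbox _)).trans (le_fracsFrom B (by omega))).trans
          ((le_sup_left.trans le_sup_left).trans le_sup_left)
    · rintro _ ⟨S, hS, rfl⟩
      -- The column i = h of the numerator is covered by T1e; the rest, multiplied by Q, is a
      -- numerator over Q^2 off the right edge.
      have hsplit : S = restrict edge S + restrict edgeᶜ S := by
        apply ext_cf
        intro i j
        rw [cf_add, cf_restrict, cf_restrict]
        by_cases hij : (i, j) ∈ edge <;> simp [hij]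
      rw [hsplit, add_mul, smul_add]
      refine Submodule.add_mem _ ?_ ?_
      · exact Submodule.mem_sup_left (Submodule.mem_sup_left (Submodule.mem_sup_right
          ⟨_, suppIn_restrict _ _, rfl⟩))
      · refine Submodule.mem_sup_left (Submodule.mem_sup_right (hup (-1) 0 _ ⟨_, ?_, rfl⟩))
        intro i j hij
        rw [cf_restrict] at hij
        by_cases he : (i, j) ∈ edge
        · simp [he] at hij
        · obtain ⟨h1, h2, h3, h4, h5⟩ := hS i j (by simpa [he] using hij)
          simp only at h1 h2 h3 h4 h5
          have he' : ¬ (i = h ∧ 0 ≤ j ∧ j ≤ d - 1) := fun hc => he ⟨hc.1, hc.2⟩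
          refine ⟨?_, ?_, ?_, ?_, ?_⟩ <;> simp only <;> push_cast <;> omega
    · exact (le_fracsFrom B (by omega)).trans ((le_sup_left.trans le_sup_left).trans le_sup_left)
  have hle : (levelFracs Qi (p : ZMod (p ^ α)) h d (-1) 0 ⊔
      excessFracs Qi (p : ZMod (p ^ α)) h d 0 0).map rowZero ≤ T0.map rowZero :=
    Submodule.map_mono hlast
  have := hT0.1
  exact ⟨Finite.of_injective _ (Submodule.inclusion_injective hle),
    (Nat.card_le_card_of_injective _ (Submodule.inclusion_injective hle)).trans hT0.2⟩

end BiSeries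

/-! ### Polynomials modulo p^α that divide X^(p^(e+m)) - X^(p^e) -/

/-- In a ring in which `p ^ α = 0`, a congruence modulo `p` and `r` becomes, after raising to a
power of `p`, a congruence modulo a power of `r`. -/
lemma pow_dvd_pow_sub_pow {A : Type*} [CommRing A] {p α : ℕ} (hp : p.Prime) (hα : α ≠ 0)
    (hA : (p : A) ^ α = 0) {x y r u v : A} (h : x - y = p * u + r * v) :
    r ^ p ^ (α - 1) ∣ x ^ p ^ (2 * (α - 1)) - y ^ p ^ (2 * (α - 1)) := by
  have : Fact p.Prime := ⟨hp⟩
  -- A first power p^(α-1) removes the term pu, since p^α = 0. A second one is then applied to y +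
  -- rv.
  have h1 : (p : A) ∣ x - (y + r * v) := ⟨u, by linear_combination h⟩
  have h2 := dvd_sub_pow_of_dvd_sub h1 (α - 1)
  rw [Nat.sub_add_cancel (Nat.one_le_iff_ne_zero.mpr hα), hA, zero_dvd_iff, sub_eq_zero] at h2
  rw [two_mul, pow_add, pow_mul, h2, ← pow_mul, ← pow_add, ← two_mul, add_comm y, add_pow,
    Finset.sum_range_succ', pow_zero, one_mul, Nat.sub_zero, Nat.choose_zero_right, Nat.cast_one,
    mul_one, add_sub_cancel_right]
  refine Finset.dvd_sum fun k hk => ?_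
  have hk' := Finset.mem_range.mp hk
  by_cases hkD : p ^ (α - 1) ≤ k + 1
  · refine Dvd.dvd.mul_right (Dvd.dvd.mul_right ?_ _) _
    rw [mul_pow]
    exact Dvd.dvd.mul_right (pow_dvd_pow r hkD) _
  -- For k + 1 < p^(α-1) the binomial coefficient has valuation 2(α - 1) - v_p(k + 1) ≥ α and
  -- vanishes.
  · have hf := Nat.factorization_choose_prime_pow (n := 2 * (α - 1)) hp (k := k + 1) (by omega)
      (by omega)
    have hlt : (k + 1).factorization p < α - 1 := by
      have := Nat.le_of_dvd (by omega) (Nat.ordProj_dvd (k + 1) p)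
      exact (Nat.pow_lt_pow_iff_right hp.one_lt).mp (this.trans_lt (by omega))
    have hdvd : p ^ α ∣ (p ^ (2 * (α - 1))).choose (k + 1) :=
      (pow_dvd_pow p (by rw [hf]; omega)).trans (Nat.ordProj_dvd _ p)
    obtain ⟨w, hw⟩ := hdvd
    rw [hw, Nat.cast_mul, Nat.cast_pow, hA, zero_mul, mul_zero]
    exact dvd_zero _

namespace Polynomial

variable {p : ℕ} [hp : Fact p.Prime]

/-- X^(p^(c+m)) - X^(p^c) is the p^c-th power of X^(p^m) - X. The latter is divisible by every
irreducible polynomial whose degree divides m, and f has at most deg f ≤ p^c irreducible factors. -/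
lemma dvd_X_pow_sub_X_pow_of_natDegree_dvd {f : (ZMod p)[X]} (hf : f ≠ 0) {c m : ℕ}
    (hc : f.natDegree ≤ p ^ c) (hm : ∀ g : (ZMod p)[X], Irreducible g → g ∣ f → g.natDegree ∣ m) :
    f ∣ X ^ p ^ (c + m) - X ^ p ^ c := by
  classical
  have h0 : ∀ s : Multiset (ZMod p)[X], (∀ g ∈ s, Irreducible g ∧ g ∣ f) →
      s.prod ∣ (X ^ p ^ m - X) ^ s.card := by
    intro s
    induction s using Multiset.induction_on with
    | empty => simp
    | cons g s ih =>
      intro hs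
      rw [Multiset.prod_cons, Multiset.card_cons, pow_succ']
      refine mul_dvd_mul ?_ (ih fun g hg => hs g (Multiset.mem_cons_of_mem hg))
      obtain ⟨h1, h2⟩ := hs g (Multiset.mem_cons_self g s)
      have := h1.natDegree_dvd_iff_dvd_X_pow_card_pow_sub_X.mp (hm g h1 h2)
      rwa [Nat.card_zmod] at this
  have hassoc := UniqueFactorizationMonoid.prod_normalizedFactors hf
  have hdeg : (UniqueFactorizationMonoid.normalizedFactors f).card ≤ f.natDegree := by
    rw [← natDegree_eq_of_degree_eq (degree_eq_degree_of_associated hassoc),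
      natDegree_multiset_prod _ (UniqueFactorizationMonoid.zero_notMem_normalizedFactors f),
      ← Multiset.card_map natDegree]
    refine (Multiset.card_nsmul_le_sum (a := 1) ?_).trans' (by simp)
    intro x hx
    obtain ⟨g, hg, rfl⟩ := Multiset.mem_map.mp hx
    exact (UniqueFactorizationMonoid.irreducible_of_normalized_factor g hg).natDegree_pos
  have h1 := h0 (UniqueFactorizationMonoid.normalizedFactors f) fun g hg =>
    ⟨UniqueFactorizationMonoid.irreducible_of_normalized_factor g hg,
      UniqueFactorizationMonoid.dvd_of_mem_normalizedFactors hg⟩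
  have h2 := (hassoc.dvd'.trans h1).trans (pow_dvd_pow _ (hdeg.trans hc))
  rwa [sub_pow_char_pow, ← pow_mul, ← pow_add, add_comm m] at h2

/-- The degrees of the irreducible factors of f form a partition of deg f. A constant f has no such
factors, and the partition of 1 serves. -/
lemma exists_partition_natDegree_dvd {f : (ZMod p)[X]} (hf : f ≠ 0) {n : ℕ} (hn : 1 ≤ n)
    (hfn : f.natDegree ≤ n) : ∃ i ∈ Finset.Icc 1 n, ∃ σ : Nat.Partition i,
      ∀ g : (ZMod p)[X], Irreducible g → g ∣ f → g.natDegree ∣ σ.parts.lcm := by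
  classical
  rcases Nat.eq_zero_or_pos f.natDegree with h0 | h0
  · refine ⟨1, by simpa using hn, Nat.Partition.indiscrete 1, fun g hg hgf => ?_⟩
    have hu : IsUnit f := isUnit_iff_degree_eq_zero.mpr (by
      rw [degree_eq_natDegree hf, h0, Nat.cast_zero])
    exact absurd (isUnit_of_dvd_unit hgf hu) hg.not_isUnit
  · have hassoc := UniqueFactorizationMonoid.prod_normalizedFactors hf
    refine ⟨f.natDegree, Finset.mem_Icc.mpr ⟨h0, hfn⟩,
      ⟨(UniqueFactorizationMonoid.normalizedFactors f).map natDegree, ?_, ?_⟩, ?_⟩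
    · intro i hi
      obtain ⟨g, hg, rfl⟩ := Multiset.mem_map.mp hi
      exact (UniqueFactorizationMonoid.irreducible_of_normalized_factor g hg).natDegree_pos
    · rw [← natDegree_multiset_prod _ (UniqueFactorizationMonoid.zero_notMem_normalizedFactors f)]
      exact natDegree_eq_of_degree_eq (degree_eq_degree_of_associated hassoc)
    · intro g hg hgf
      obtain ⟨g', hg', hgg'⟩ :=
        UniqueFactorizationMonoid.exists_mem_normalizedFactors_of_dvd hf hg hgf
      rw [natDegree_eq_of_degree_eq (degree_eq_degree_of_associated hgg')]
      exact Multiset.dvd_lcm (Multiset.mem_map_of_mem _ hg')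

lemma pow_dvd_X_pow_sub_X_pow {α : ℕ} (hα : α ≠ 0) {R : (ZMod (p ^ α))[X]} {c m e : ℕ}
    (h : R.map (ZMod.castHom (dvd_pow_self p hα) (ZMod p)) ∣ X ^ p ^ (c + m) - X ^ p ^ c)
    (he : c + 2 * (α - 1) ≤ e) : R ^ p ^ (α - 1) ∣ X ^ p ^ (e + m) - X ^ p ^ e := by
  set π := ZMod.castHom (dvd_pow_self p hα) (ZMod p)
  obtain ⟨v', hv⟩ := h
  obtain ⟨v, rfl⟩ := map_surjective π (ZMod.castHom_surjective (dvd_pow_self p hα)) v'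
  have h1 : ∀ i, (p : ZMod (p ^ α)) ∣ (X ^ p ^ (c + m) - X ^ p ^ c - R * v).coeff i := by
    intro i
    rw [BiSeries.dvd_iff_castHom_eq_zero hα, ← coeff_map]
    simp only [Polynomial.map_sub, Polynomial.map_mul, Polynomial.map_pow, map_X]
    rw [hv, sub_self, coeff_zero]
  obtain ⟨u, hu⟩ := (C_dvd_iff_dvd_coeff _ _).mpr h1
  have hA : (p : (ZMod (p ^ α))[X]) ^ α = 0 := by
    rw [← Nat.cast_pow, ← C_eq_natCast, ZMod.natCast_self, C_0]
  have h2 := pow_dvd_pow_sub_pow hp.out hα hA (x := X ^ p ^ (c + m)) (y := X ^ p ^ c) (r := R)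
    (u := u) (v := v) (by
      rw [← C_eq_natCast]; linear_combination hu)
  refine h2.trans ?_
  obtain ⟨k, rfl⟩ := Nat.exists_eq_add_of_le he
  have h3 := sub_dvd_pow_sub_pow ((X ^ p ^ (c + m)) ^ p ^ (2 * (α - 1)) : (ZMod (p ^ α))[X])
    ((X ^ p ^ c) ^ p ^ (2 * (α - 1))) (p ^ k)
  rw [← pow_mul, ← pow_mul, ← pow_mul, ← pow_mul, ← pow_add, ← pow_add, ← pow_add, ← pow_add] at h3
  rw [← pow_mul, ← pow_mul, ← pow_add, ← pow_add]
  rwa [show c + 2 * (α - 1) + k + m = c + m + 2 * (α - 1) + k by ring]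

end Polynomial

/-! ### Sections of rational functions on a line -/

namespace BiSeries

section Line

variable {R : Type*} [CommRing R]

/-- The substitution of the monomial `x ^ v.1 * y ^ v.2` into polynomials. -/
noncomputable def lineHom (v : ℤ × ℤ) : R[X] →+* BiSeries R :=
  eval₂RingHom HahnSeries.C (mono v.1 v.2)

lemma lineHom_X_pow (v : ℤ × ℤ) (n : ℕ) :
    (lineHom v (X ^ n) : BiSeries R) = mono (n * v.1) (n * v.2) := by
  rw [map_pow, lineHom, coe_eval₂RingHom, eval₂_X, mono_pow]

lemma lineHom_eq_sum (v : ℤ × ℤ) (f : R[X]) :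
    lineHom v f = ∑ k ∈ f.support, f.coeff k • mono (k * v.1) (k * v.2) := by
  rw [lineHom, coe_eval₂RingHom, eval₂_eq_sum, sum_def]
  refine Finset.sum_congr rfl fun k _ => ?_
  rw [mono_pow, HahnSeries.C_mul_eq_smul]

lemma suppIn_lineHom (v : ℤ × ℤ) {f : R[X]} {w : ℕ} (hf : f.natDegree ≤ w) :
    SuppIn {e | ∃ k : ℕ, k ≤ w ∧ e = (k * v.1, k * v.2)} (lineHom v f) := by
  intro i j hij
  by_contra hc
  apply hij
  rw [lineHom_eq_sum, cf_sum]
  refine Finset.sum_eq_zero fun k hk => ?_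
  rw [cf_smul, cf_mono, if_neg, mul_zero]
  rintro ⟨rfl, rfl⟩
  exact hc ⟨k, (le_natDegree_of_mem_supp k hk).trans hf, rfl⟩

lemma cf_lineHom {v : ℤ × ℤ} (hv : v ≠ 0) (f : R[X]) (k : ℕ) :
    cf (lineHom v f) (k * v.1) (k * v.2) = f.coeff k := by
  have key : ∀ m : ℕ, ((m : ℤ) * v.1 = k * v.1 ∧ (m : ℤ) * v.2 = k * v.2) ↔ m = k := by
    intro m
    constructor
    · rintro ⟨h1, h2⟩
      by_contra hmk
      have hmk' : (m : ℤ) ≠ k := by exact_mod_cast hmk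
      exact hv (Prod.ext (by simpa [hmk'] using h1) (by simpa [hmk'] using h2))
    · rintro rfl; exact ⟨rfl, rfl⟩
  rw [lineHom_eq_sum, cf_sum]
  simp only [cf_smul, cf_mono]
  rw [Finset.sum_eq_single k]
  · simp
  · intro m _ hm
    rw [if_neg, mul_zero]
    rw [eq_comm, @eq_comm _ ((k : ℤ) * v.2), key]
    exact hm
  · intro hk
    rw [notMem_support_iff.mp hk, zero_mul]

lemma exists_lineHom_eq {v : ℤ × ℤ} (hv : v ≠ 0) {w : ℕ} {w0 : ℤ × ℤ} {f : BiSeries R}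
    (hf : SuppIn {e | ∃ k : ℕ, k ≤ w ∧ e = (w0.1 + k * v.1, w0.2 + k * v.2)} f) :
    ∃ g : R[X], g.natDegree ≤ w ∧ f = mono w0.1 w0.2 * lineHom v g ∧
      ∀ k : ℕ, k ≤ w → g.coeff k = cf f (w0.1 + k * v.1) (w0.2 + k * v.2) := by
  let g : R[X] := ∑ k ∈ Finset.range (w + 1),
    Polynomial.monomial k (cf f (w0.1 + k * v.1) (w0.2 + k * v.2))
  have hdeg : g.natDegree ≤ w := by
    refine natDegree_sum_le_of_forall_le _ _ fun k hk => (natDegree_monomial_le _).trans ?_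
    exact Nat.lt_succ_iff.mp (Finset.mem_range.mp hk)
  have hcoeff : ∀ k : ℕ, k ≤ w → g.coeff k = cf f (w0.1 + k * v.1) (w0.2 + k * v.2) := by
    intro k hk
    simp only [g, finsetSum_coeff, coeff_monomial]
    rw [Finset.sum_ite_eq' , if_pos (Finset.mem_range.mpr (by omega))]
  refine ⟨g, hdeg, ?_, hcoeff⟩
  apply ext_cf
  intro i j
  rw [cf_mono_mul]
  by_cases hij : ∃ k : ℕ, k ≤ w ∧ (i, j) = (w0.1 + k * v.1, w0.2 + k * v.2)
  · obtain ⟨k, hk, he⟩ := hij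
    obtain ⟨rfl, rfl⟩ := Prod.mk.injEq .. ▸ he
    rw [add_sub_cancel_left, add_sub_cancel_left, cf_lineHom hv, hcoeff k hk]
  · have h1 : cf f i j = 0 := by
      by_contra hc
      exact hij (hf i j hc)
    rw [h1]
    by_contra hc
    obtain ⟨k, hk, he⟩ := suppIn_lineHom v hdeg _ _ (Ne.symm hc)
    rw [Prod.mk.injEq] at he
    exact hij ⟨k, hk, Prod.ext (by simp only; linarith [he.1]) (by simp only; linarith [he.2])⟩

lemma exists_inverse_lineHom {v : ℤ × ℤ} (hv : v = (0, 1) ∨ v = (1, 0)) {f : R[X]}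
    (hf : IsUnit (f.coeff 0)) : ∃ g : BiSeries R, lineHom v f * g = 1 ∧
      SuppIn {e | ∃ k : ℕ, e = (k * v.1, k * v.2)} g := by
  have hv0 : v ≠ 0 := by rcases hv with rfl | rfl <;> simp
  have h1 : ∀ i j, cf (lineHom v f) i j ≠ 0 → 0 ≤ expo i j := by
    intro i j hij
    obtain ⟨k, -, he⟩ := suppIn_lineHom v le_rfl i j hij
    obtain ⟨rfl, rfl⟩ := Prod.mk.injEq .. ▸ he
    rw [← expo_zero, expo_le]
    rcases hv with rfl | rfl
    · simp
    · simp only [mul_one, mul_zero]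
      omega
  have h2 : IsUnit (cf (lineHom v f) 0 0) := by
    have := cf_lineHom hv0 f 0
    simp only [Nat.cast_zero, zero_mul] at this
    rwa [this]
  obtain ⟨g, hg⟩ := (isUnit_of_cf_zero_zero h1 h2).exists_right_inv
  refine ⟨g, hg, SuppIn.of_mul_eq_one hg h1 h2 ((suppIn_lineHom v le_rfl).mono ?_) ⟨0, by simp⟩ ?_⟩
  · rintro e ⟨k, -, rfl⟩; exact ⟨k, rfl⟩
  · rintro a b a' b' ⟨k, hk⟩ ⟨k', hk'⟩
    rw [Prod.mk.injEq] at hk hk'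
    exact ⟨k + k', Prod.ext (by simp only; push_cast; rw [hk.1, hk'.1]; ring)
      (by simp only; push_cast; rw [hk.2, hk'.2]; ring)⟩

lemma natDegree_add_le_of_mul {f g : R[X]} (hf : IsUnit f.leadingCoeff) (hg : g ≠ 0) (D : ℕ) :
    g.natDegree + D * f.natDegree = (f ^ D * g).natDegree := by
  nontriviality R
  have h1 : f.leadingCoeff ^ D ≠ 0 := (hf.pow D).ne_zero
  rw [natDegree_mul', natDegree_pow' h1, add_comm]
  rw [leadingCoeff_pow' h1]
  intro h0
  exact hg (leadingCoeff_eq_zero.mp ((hf.pow D).mul_right_eq_zero.mp h0))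

/-- A rational function on a line whose denominator divides `X ^ b - X ^ a` has equal coefficients
at the multiples of `a` and at the multiples of `b`. -/
lemma sect_eq_sect_of_dvd {v : ℤ × ℤ} (hv : v = (0, 1) ∨ v = (1, 0)) {f n : R[X]}
    (hf0 : IsUnit (f.coeff 0)) (hfl : IsUnit f.leadingCoeff) {D l w : ℕ}
    (hw : l + f.natDegree ≤ w) (hn : n.natDegree ≤ D * w) {ψ : BiSeries R}
    (hψ : ψ * lineHom v f ^ D = mono (-(D * l : ℕ) * v.1) (-(D * l : ℕ) * v.2) * lineHom v n)
    {a b : ℕ} [NeZero a] [NeZero b] (ha : D * w < a) (hab : a ≤ b)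
    (hdvd : f ^ D ∣ X ^ b - X ^ a) : sect a 0 ψ = sect b 0 ψ := by
  have hv0 : v ≠ 0 := by rcases hv with rfl | rfl <;> simp
  obtain ⟨g, hg, hgs⟩ := exists_inverse_lineHom hv (f := f ^ D) (by
    rw [coeff_zero_eq_eval_zero, eval_pow, ← coeff_zero_eq_eval_zero]; exact hf0.pow D)
  rw [map_pow] at hg
  have hψs : SuppIn {e | ∃ k : ℤ, -(D * l : ℕ) ≤ k ∧ e = (k * v.1, k * v.2)} ψ := by
    have h1 : ψ = mono (-(D * l : ℕ) * v.1) (-(D * l : ℕ) * v.2) * lineHom v n * g := by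
      rw [← hψ, mul_assoc, hg, mul_one]
    rw [h1]
    refine SuppIn.mul (SuppIn.mul (A := {(-(D * l : ℕ) * v.1, -(D * l : ℕ) * v.2)})
      (suppIn_mono rfl) (suppIn_lineHom v hn)
      (C := {e | ∃ k : ℤ, -(D * l : ℕ) ≤ k ∧ e = (k * v.1, k * v.2)}) ?_) hgs ?_
    · rintro x y x' y' h0 ⟨k, -, hk⟩
      rw [Set.mem_singleton_iff, Prod.mk.injEq] at h0
      rw [Prod.mk.injEq] at hk
      refine ⟨-(D * l : ℕ) + k, by omega, Prod.ext ?_ ?_⟩ <;> simp only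
      · rw [h0.1, hk.1]; ring
      · rw [h0.2, hk.2]; ring
    · rintro x y x' y' ⟨k, hkl, h0⟩ ⟨k', hk⟩
      rw [Prod.mk.injEq] at h0 hk
      refine ⟨k + k', by omega, Prod.ext ?_ ?_⟩ <;> simp only
      · rw [h0.1, hk.1]; ring
      · rw [h0.2, hk.2]; ring
  -- f^D also divides X^(bk) - X^(ak), so the product of ψ with this binomial is a shifted
  -- polynomial. Its coefficient at ak + bk is the difference of the two sides, and ak > Dw puts
  -- this place beyond its degree.
  have hpos : ∀ k : ℕ, 0 < k → cf ψ ((a * k : ℕ) * v.1) ((a * k : ℕ) * v.2) =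
      cf ψ ((b * k : ℕ) * v.1) ((b * k : ℕ) * v.2) := by
    intro k hk
    obtain ⟨W, hW⟩ := hdvd.trans (sub_dvd_pow_sub_pow (X ^ b : R[X]) (X ^ a) k)
    rw [← pow_mul, ← pow_mul] at hW
    have h1 : ψ * lineHom v (X ^ (b * k) - X ^ (a * k)) =
        mono (-(D * l : ℕ) * v.1) (-(D * l : ℕ) * v.2) * lineHom v (n * W) := by
      rw [hW, map_mul, map_pow, ← mul_assoc, hψ, map_mul, mul_assoc]
    have h2 := congrArg (fun F => cf F ((a * k + b * k : ℕ) * v.1) ((a * k + b * k : ℕ) * v.2)) h1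
    rw [map_sub, lineHom_X_pow, lineHom_X_pow, mul_comm, sub_mul, cf_sub, cf_mono_mul, cf_mono_mul,
      cf_mono_mul] at h2
    have e1 : ∀ t : ℤ, ((a * k + b * k : ℕ) : ℤ) * t - (b * k : ℕ) * t = (a * k : ℕ) * t := by
      intro t; push_cast; ring
    have e2 : ∀ t : ℤ, ((a * k + b * k : ℕ) : ℤ) * t - (a * k : ℕ) * t = (b * k : ℕ) * t := by
      intro t; push_cast; ring
    have e3 : ∀ t : ℤ, ((a * k + b * k : ℕ) : ℤ) * t - -(D * l : ℕ) * t =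
        (a * k + b * k + D * l : ℕ) * t := by
      intro t; push_cast; ring
    rw [e1, e1, e2, e2, e3, e3, cf_lineHom hv0] at h2
    rw [← sub_eq_zero, h2]
    by_cases hW0 : W = 0
    · rw [hW0, mul_zero, coeff_zero]
    apply coeff_eq_zero_of_natDegree_lt
    have h3 := natDegree_add_le_of_mul hfl hW0 D
    have h4 : (f ^ D * W).natDegree ≤ b * k := by
      rw [← hW]
      refine (natDegree_sub_le _ _).trans (max_le (natDegree_X_pow_le _) ?_)
      exact (natDegree_X_pow_le _).trans (Nat.mul_le_mul_right k hab)
    have h5 := natDegree_mul_le (p := n) (q := W)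
    have h6 : a ≤ a * k := Nat.le_mul_of_pos_right a hk
    omega
  have hline : ∀ k : ℤ, cf ψ (a * (k * v.1)) (a * (k * v.2)) =
      cf ψ (b * (k * v.1)) (b * (k * v.2)) := by
    intro k
    -- ψ starts at the place -Dl, and Dl ≤ Dw < a.
    have hneg : ∀ c : ℕ, a ≤ c → k < 0 → cf ψ (c * (k * v.1)) (c * (k * v.2)) = 0 := by
      intro c hc hk
      by_contra hcon
      obtain ⟨m, hm, he⟩ := hψs _ _ hcon
      rw [Prod.mk.injEq] at he
      have h1 : (c : ℤ) * k = m := by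
        rcases hv with rfl | rfl
        · simpa using he.2
        · simpa using he.1
      have h2 : D * l ≤ D * w := Nat.mul_le_mul_left D (by omega)
      have h3 : (c : ℤ) * k ≤ -c := by nlinarith
      omega
    rcases lt_trichotomy k 0 with hk | rfl | hk
    · rw [hneg a le_rfl hk, hneg b hab hk]
    · simp
    · obtain ⟨k, rfl⟩ := Int.eq_ofNat_of_zero_le hk.le
      have := hpos k (by exact_mod_cast hk)
      push_cast at this
      simpa only [mul_assoc] using this
  apply ext_cf
  intro i j
  rw [cf_sect, cf_sect, add_zero, add_zero]
  by_cases hij : ∃ k : ℤ, (i, j) = (k * v.1, k * v.2)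
  · obtain ⟨k, hk⟩ := hij
    rw [Prod.mk.injEq] at hk
    rw [hk.1, hk.2]
    exact hline k
  · have hz : ∀ c : ℕ, c ≠ 0 → cf ψ (c * i) (c * j) = 0 := by
      intro c hc
      by_contra hcon
      obtain ⟨m, -, he⟩ := hψs _ _ hcon
      rw [Prod.mk.injEq] at he
      apply hij
      rcases hv with rfl | rfl
      · refine ⟨j, ?_⟩
        have : i = 0 := by simpa [hc] using he.1
        simp [this]
      · refine ⟨i, ?_⟩
        have : j = 0 := by simpa [hc] using he.2
        simp [this]
    rw [hz a (NeZero.ne a), hz b (NeZero.ne b)]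

/-- Splitting off the power of X leaves a unit constant term, which is needed to invert the
polynomial as a series on the line. -/
lemma exists_X_pow_mul {f : R[X]} (hf : f ≠ 0) (hu : ∀ k, f.coeff k ≠ 0 → IsUnit (f.coeff k)) :
    ∃ (l : ℕ) (g : R[X]), f = X ^ l * g ∧ IsUnit (g.coeff 0) ∧ IsUnit g.leadingCoeff ∧
      l + g.natDegree = f.natDegree := by
  have : Nontrivial R := by
    by_contra hc
    rw [not_nontrivial_iff_subsingleton] at hc
    exact hf (Subsingleton.elim _ _)
  obtain ⟨g, hg⟩ := X_pow_dvd_iff.mpr fun k (hk : k < f.natTrailingDegree) =>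
    coeff_eq_zero_of_lt_natTrailingDegree hk
  have hg0 : g ≠ 0 := by rintro rfl; exact hf (by rw [hg, mul_zero])
  have h1 : f.natDegree = f.natTrailingDegree + g.natDegree := by
    conv_lhs => rw [hg]
    rw [mul_comm, natDegree_mul_X_pow _ hg0, add_comm]
  have hc : ∀ k, g.coeff k = f.coeff (k + f.natTrailingDegree) := fun k =>
    ((congrArg (fun F => F.coeff (k + f.natTrailingDegree)) hg).trans (coeff_X_pow_mul ..)).symm
  refine ⟨f.natTrailingDegree, g, hg, ?_, ?_, h1.symm⟩
  · rw [hc, zero_add]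
    exact hu _ (by rw [← trailingCoeff]; exact trailingCoeff_nonzero_iff_nonzero.mpr hf)
  · rw [leadingCoeff, hc, add_comm, ← h1]
    exact hu _ (by rw [coeff_natDegree]; exact leadingCoeff_ne_zero.mpr hf)

end Line

variable {p α : ℕ} [hp : Fact p.Prime]

/-- The sections of a sequence of fractions on a line are periodic, with a period that depends on
the factorization of the denominator modulo `p`. -/
lemma exists_polynomial_sect_eq (hα : α ≠ 0) {v : ℤ × ℤ} (hv : v = (0, 1) ∨ v = (1, 0))
    {h d : ℤ} {ρ : BiSeries (ZMod (p ^ α))} (hρn : SuppIn (newt h d 1) ρ) {w : ℕ} {w0 : ℤ × ℤ}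
    (hρ : SuppIn {e | ∃ k : ℕ, k ≤ w ∧ e = (w0.1 + k * v.1, w0.2 + k * v.2)} ρ) (hρ0 : ρ ≠ 0)
    (hρu : ∀ i j, cf ρ i j ≠ 0 → IsUnit (cf ρ i j)) :
    ∃ f : (ZMod p)[X], f ≠ 0 ∧ f.natDegree ≤ w ∧
      ∀ c m e : ℕ, f ∣ X ^ p ^ (c + m) - X ^ p ^ c → c + 2 * (α - 1) ≤ e →
        p ^ (α - 1) * w < p ^ e →
        ∀ s : BiSeries (ZMod (p ^ α)), SuppIn {x | ∃ k : ℕ, k ≤ p ^ (α - 1) * w ∧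
          x = ((p ^ (α - 1) : ℕ) * w0.1 + k * v.1, (p ^ (α - 1) : ℕ) * w0.2 + k * v.2)} s →
        ∀ [NeZero (p ^ e)] [NeZero (p ^ (e + m))],
          sect (p ^ e) 0 (s * ρ ^ ((p ^ e - 1) * p ^ (α - 1))) =
            sect (p ^ (e + m)) 0 (s * ρ ^ ((p ^ (e + m) - 1) * p ^ (α - 1))) := by
  have hv0 : v ≠ 0 := by rcases hv with rfl | rfl <;> simp
  have : Fact (1 < p ^ α) := ⟨Nat.one_lt_pow hα hp.out.one_lt⟩
  obtain ⟨g0, hg0w, hg0ρ, hg0c⟩ := exists_lineHom_eq hv0 hρ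
  have hg00 : g0 ≠ 0 := by
    rintro rfl
    exact hρ0 (by rw [hg0ρ, map_zero, mul_zero])
  obtain ⟨l, g, rfl, hgu0, hgul, hgd⟩ := exists_X_pow_mul hg00 (fun k hk => by
    have hkw : k ≤ w := (le_natDegree_of_ne_zero hk).trans hg0w
    rw [hg0c k hkw] at hk ⊢
    exact hρu _ _ hk)
  set π := ZMod.castHom (dvd_pow_self p hα) (ZMod p)
  refine ⟨g.map π, ?_, natDegree_map_le.trans (by omega), ?_⟩
  · intro h0
    have h1 := congrArg (fun f => f.coeff 0) h0
    simp only [coeff_map, coeff_zero] at h1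
    exact (hgu0.map π).ne_zero h1
  intro c m e hdvd hce he s hs _ _
  obtain ⟨n, hnw, hns, -⟩ := exists_lineHom_eq
    (w0 := ((p ^ (α - 1) : ℕ) * w0.1, (p ^ (α - 1) : ℕ) * w0.2)) hv0 hs
  obtain ⟨gi, hgi, -⟩ := exists_inverse_lineHom hv hgu0
  set D := p ^ (α - 1)
  have hρg : ρ = mono (w0.1 + l * v.1) (w0.2 + l * v.2) * lineHom v g := by
    rw [hg0ρ, map_mul, lineHom_X_pow, ← mul_assoc, mono_mul_mono]
  set ρi := mono (-(w0.1 + l * v.1)) (-(w0.2 + l * v.2)) * gi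
  have hρi : ρ * ρi = 1 := by
    have h1 : (mono (w0.1 + l * v.1) (w0.2 + l * v.2) : BiSeries (ZMod (p ^ α))) *
        mono (-(w0.1 + l * v.1)) (-(w0.2 + l * v.2)) = 1 := by
      rw [mono_mul_mono, add_neg_cancel, add_neg_cancel, mono_zero]
    simp only [hρg, ρi]
    linear_combination (lineHom v g * gi) * h1 + hgi
  set ψ := s * ρi ^ D
  have hψ : ψ * lineHom v g ^ D =
      mono (-(D * l : ℕ) * v.1) (-(D * l : ℕ) * v.2) * lineHom v n := by
    have h1 : ρi * lineHom v g = mono (-(w0.1 + l * v.1)) (-(w0.2 + l * v.2)) := by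
      simp only [ρi]
      linear_combination mono (-(w0.1 + l * v.1)) (-(w0.2 + l * v.2)) * hgi
    rw [mul_assoc, ← mul_pow, h1, mono_pow, hns, mul_right_comm, mono_mul_mono]
    congr 2 <;> push_cast <;> ring
  -- ρ^(p^t·D) is the D-th power of ρ(x^(p^t), y^(p^t)) and leaves the section as ρ^D. What remains
  -- is a section of ψ = s/ρ^D, a series that does not depend on t.
  have hkey : ∀ (t : ℕ) [NeZero (p ^ t)], sect (p ^ t) 0 (s * ρ ^ ((p ^ t - 1) * D)) =
      ρ ^ D * sect (p ^ t) 0 ψ := by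
    intro t _
    have h1 : s * ρ ^ ((p ^ t - 1) * D) = expand (p ^ t) (ρ ^ D) * ψ := by
      rw [map_pow, ← pow_eq_expand_pow hα t hρn]
      have h2 : p ^ t * D = (p ^ t - 1) * D + D := by
        rw [← Nat.succ_mul, Nat.succ_eq_add_one, Nat.sub_add_cancel (Nat.one_le_pow _ _ hp.out.pos)]
      have h3 : ρ ^ D * ρi ^ D = 1 := by rw [← mul_pow, hρi, one_pow]
      simp only [ψ]
      change _ = ρ ^ (p ^ t * D) * _
      rw [h2, pow_add]
      linear_combination (-s * ρ ^ ((p ^ t - 1) * D)) * h3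
    rw [h1, sect_expand_mul]
  rw [hkey, hkey]
  congr 1
  exact sect_eq_sect_of_dvd hv hgu0 hgul (hgd.le.trans hg0w) hnw hψ he
    (Nat.pow_le_pow_right hp.out.pos (Nat.le_add_right e m))
    (pow_dvd_X_pow_sub_X_pow hα hdvd hce)

end BiSeries

/-! ### Faces of the polygon -/

namespace BiSeries

/-- The lattice points of the `n`th dilate of the line `a * i + b * j = c`. -/
def face (a b c n : ℤ) : Set (ℤ × ℤ) := {e | a * e.1 + b * e.2 = n * c}

/-- The line `a * i + b * j = c` supports the polygons `newt h d 1` and `box h d 1 0 0`. -/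
structure IsFace (h d a b c : ℤ) : Prop where
  le_newt : ∀ n i j : ℤ, (i, j) ∈ newt h d n → a * i + b * j ≤ n * c
  le_box : ∀ K i j : ℤ, (i, j) ∈ box h d K 0 0 → a * i + b * j ≤ K * c

lemma isFace_left (h d : ℤ) : IsFace h d (-1) 0 0 := by
  constructor <;> rintro n i j ⟨h1, -⟩ <;> simp only at h1 <;> linarith

lemma isFace_right (h d : ℤ) : IsFace h d 1 0 h := by
  constructor <;> rintro n i j ⟨-, h1, -⟩ <;> simp only at h1 <;> linarith

lemma isFace_top (h d : ℤ) : IsFace h d 0 1 (d - 1) := by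
  constructor <;> rintro n i j ⟨-, -, -, h1, -⟩ <;> simp only at h1 <;> linarith

lemma mem_innerBox_iff {h d K i j : ℤ} : (i, j) ∈ innerBox h d K ↔ (i, j) ∈ box h d K 0 0 ∧
    (i, j) ∉ face (-1) 0 0 K ∧ (i, j) ∉ face 1 0 h K ∧ (i, j) ∉ face 0 1 (d - 1) K := by
  simp only [innerBox, box, face, Set.mem_ofPred_eq]
  rw [add_zero, add_zero, mul_zero, zero_mul, zero_mul, add_zero, zero_add, one_mul, one_mul,
    add_zero]
  constructor
  · rintro ⟨h1, h2, h3, h4, h5⟩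
    exact ⟨⟨h1.le, h2.le, h3, h4.le, h5⟩, by omega, h2.ne, h4.ne⟩
  · rintro ⟨⟨h1, h2, h3, h4, h5⟩, h6, h7, h8⟩
    exact ⟨by omega, lt_of_le_of_ne h2 h7, h3, lt_of_le_of_ne h4 h8, h5⟩

section

variable {R : Type*} [CommRing R] {h d a b c : ℤ}

/-- The linear form a·i + b·j is bounded on both supports, and a sum of exponents attains the sum of
the bounds only if both summands attain theirs. -/
lemma IsFace.restrict_box_mul_newt (hF : IsFace h d a b c) {K n : ℤ} {f g : BiSeries R}
    (hf : SuppIn (box h d K 0 0) f) (hg : SuppIn (newt h d n) g) :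
    restrict (face a b c (K + n)) (f * g) = restrict (face a b c K) f * restrict (face a b c n) g := by
  refine restrict_mul hf hg fun i j i' j' h1 h2 => ?_
  have h3 := hF.le_box _ _ _ h1
  have h4 := hF.le_newt _ _ _ h2
  simp only [face, Set.mem_ofPred_eq]
  constructor
  · intro h5; constructor <;> nlinarith
  · rintro ⟨h5, h6⟩; linear_combination h5 + h6

lemma IsFace.restrict_newt_mul_newt (hF : IsFace h d a b c) {m n : ℤ} {f g : BiSeries R}
    (hf : SuppIn (newt h d m) f) (hg : SuppIn (newt h d n) g) :
    restrict (face a b c (m + n)) (f * g) = restrict (face a b c m) f * restrict (face a b c n) g := by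
  refine restrict_mul hf hg fun i j i' j' h1 h2 => ?_
  have h3 := hF.le_newt _ _ _ h1
  have h4 := hF.le_newt _ _ _ h2
  simp only [face, Set.mem_ofPred_eq]
  constructor
  · intro h5; constructor <;> nlinarith
  · rintro ⟨h5, h6⟩; linear_combination h5 + h6

lemma IsFace.restrict_pow (hF : IsFace h d a b c) {f : BiSeries R} (hf : SuppIn (newt h d 1) f)
    (n : ℕ) : restrict (face a b c n) (f ^ n) = restrict (face a b c 1) f ^ n := by
  induction n with
  | zero =>
    apply ext_cf
    intro i j
    rw [pow_zero, pow_zero, cf_restrict, ← mono_zero, cf_mono]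
    split_ifs with h1 h2 h2
    · rfl
    · rfl
    · rw [h2.1, h2.2] at h1
      simp [face] at h1
    · rfl
  | succ n ih =>
    have h1 := hF.restrict_newt_mul_newt (hf.pow_newt n) hf
    rw [mul_one] at h1
    rw [pow_succ, pow_succ, Nat.cast_add, Nat.cast_one, h1, ih]

lemma restrict_face_sect (a b c n : ℤ) (q : ℕ) [NeZero q] (f : BiSeries R) :
    restrict (face a b c n) (sect q 0 f) = sect q 0 (restrict (face a b c (q * n)) f) := by
  classical
  apply ext_cf
  intro i j
  rw [cf_sect, cf_restrict, cf_restrict, cf_sect, add_zero]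
  refine if_congr ?_ rfl rfl
  simp only [face, Set.mem_ofPred_eq]
  have hq : (q : ℤ) ≠ 0 := by exact_mod_cast NeZero.ne q
  constructor
  · intro h1; linear_combination (q : ℤ) * h1
  · intro h1; apply mul_left_cancel₀ hq; linear_combination h1

end

variable {p α : ℕ} [hp : Fact p.Prime] {h d : ℕ} {Q Qi : BiSeries (ZMod (p ^ α))}

lemma dvd_of_pow_mul_eq_zero {j : ℕ} (hj : j < α) {x : ZMod (p ^ α)}
    (hx : (p : ZMod (p ^ α)) ^ j * x = 0) : (p : ZMod (p ^ α)) ∣ x := by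
  obtain ⟨n, rfl⟩ := ZMod.natCast_zmod_surjective x
  rw [← Nat.cast_pow, ← Nat.cast_mul, ZMod.natCast_eq_zero_iff] at hx
  obtain ⟨k, rfl⟩ := Nat.exists_eq_add_of_lt hj
  rw [add_assoc, pow_add] at hx
  obtain ⟨m, hm⟩ := (dvd_pow_self p (Nat.succ_ne_zero k)).trans
    (Nat.dvd_of_mul_dvd_mul_left (pow_pos hp.out.pos j) hx)
  rw [hm, Nat.cast_mul]
  exact dvd_mul_right _ _

omit hp in
lemma exists_eq_smul_of_mem_fracsFrom {B : ℕ → Set (ℤ × ℤ)} {j : ℕ} {f : BiSeries (ZMod (p ^ α))}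
    (hf : f ∈ fracsFrom Qi B j) : ∃ g, f = (p : ZMod (p ^ α)) ^ j • g := by
  have h1 : fracsFrom Qi B j ≤
      LinearMap.range (((p : ZMod (p ^ α)) ^ j) • LinearMap.id (M := BiSeries (ZMod (p ^ α)))) := by
    refine iSup_le fun i => ?_
    rintro _ ⟨S, -, rfl⟩
    refine ⟨(p : ZMod (p ^ α)) ^ i • (S * Qi ^ (j + i + 1)), ?_⟩
    rw [LinearMap.smul_apply, LinearMap.id_apply, smul_smul, ← pow_add]
  obtain ⟨g, hg⟩ := h1 hf
  exact ⟨g, hg.symm⟩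

omit hp in
lemma pow_mul_inv_pow {R : Type*} [CommRing R] {Q Qi : R} (hQ : Q * Qi = 1) {K D : ℕ}
    (hK : K ≤ D) : Qi ^ K * Q ^ D = Q ^ (D - K) := by
  obtain ⟨m, rfl⟩ := Nat.exists_eq_add_of_le hK
  rw [pow_add, ← mul_assoc, ← mul_pow, mul_comm Qi, hQ, one_pow, one_mul, Nat.add_sub_cancel_left]

/-- The power Q^(p^(α-1)) is a common denominator of all nonzero levels, because α ≤ p^(α-1). -/
lemma suppIn_mul_pow_of_mem_fracsFrom (hQ : IsDenominator h d Q Qi)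
    {j : ℕ} {f : BiSeries (ZMod (p ^ α))}
    (hf : f ∈ fracsFrom Qi (fun k => box h d (k + 1 : ℕ) 0 0) j) :
    SuppIn (box h d (p ^ (α - 1) : ℕ) 0 0) (f * Q ^ p ^ (α - 1)) := by
  set D := p ^ (α - 1)
  let T : Submodule (ZMod (p ^ α)) (BiSeries (ZMod (p ^ α))) :=
    { carrier := {f | SuppIn (box h d (D : ℕ) 0 0) (f * Q ^ D)}
      zero_mem' := by simpa using suppIn_zero _
      add_mem' := fun {f g} hf hg => by
        rw [Set.mem_ofPred_eq, add_mul]; exact SuppIn.add hf hg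
      smul_mem' := fun c f hf => by
        rw [Set.mem_ofPred_eq, smul_mul_assoc]; exact SuppIn.smul hf c }
  have h1 : fracsFrom Qi (fun k => box h d (k + 1 : ℕ) 0 0) j ≤ T := by
    refine iSup_le fun i => ?_
    by_cases hi : α ≤ j + i
    · rw [fracs_eq_bot hi]; exact bot_le
    · rintro _ ⟨S, hS, rfl⟩
      have hK : j + i + 1 ≤ D := le_trans (by omega) le_pow_pred
      change SuppIn _ (_ • (S * Qi ^ (j + i + 1)) * Q ^ D)
      rw [smul_mul_assoc, mul_assoc, pow_mul_inv_pow hQ.mul_inv hK]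
      have h2 := hS.box_mul_newt (hQ.suppIn.pow_newt (D - (j + i + 1)))
      rw [mul_one, ← Nat.cast_add, Nat.add_sub_cancel' hK] at h2
      exact h2.smul _
  exact h1 hf

/-- The numerator of the leading level of a fraction without monomials on a face is divisible by
`p` on this face. -/
lemma dvd_cf_of_mem_face (hα : α ≠ 0) (hQ : IsDenominator h d Q Qi) {a b c : ℤ}
    (hF : IsFace h d a b c) (hFQ : restrict (face a b c 1) Q ≠ 0) {k : ℕ} (hk : k < α)
    {S g : BiSeries (ZMod (p ^ α))} (hS : SuppIn (box h d (k + 1 : ℕ) 0 0) S)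
    (hface : ∀ i j, (i, j) ∈ face a b c (p ^ (α - 1) : ℕ) →
      cf (((p : ZMod (p ^ α)) ^ k • (S * Qi ^ (k + 1)) + (p : ZMod (p ^ α)) ^ (k + 1) • g) *
        Q ^ p ^ (α - 1)) i j = 0)
    {i j : ℤ} (hij : (i, j) ∈ face a b c (k + 1 : ℕ)) : (p : ZMod (p ^ α)) ∣ cf S i j := by
  set D := p ^ (α - 1)
  set π := ZMod.castHom (dvd_pow_self p hα) (ZMod p)
  have hK : k + 1 ≤ D := le_trans (by omega) le_pow_pred
  -- After cancelling p^k, the part with g disappears modulo p, and the product of the face parts of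
  -- S and of a power of Q is zero. Over the field with p elements the series form a domain. The
  -- face part of Q is nonzero there since its nonzero coefficients are units.
  have h1 : mapHom π (restrict (face a b c D) (S * Q ^ (D - (k + 1)))) = 0 := by
    apply ext_cf
    intro i j
    rw [cf_mapHom, cf_restrict, cf_zero]
    split_ifs with hm
    · have h2 := hface i j hm
      rw [add_mul, smul_mul_assoc, mul_assoc, pow_mul_inv_pow hQ.mul_inv hK, smul_mul_assoc,
        cf_add, cf_smul, cf_smul, pow_succ, mul_assoc, ← mul_add] at h2
      have h3 := dvd_of_pow_mul_eq_zero hk h2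
      rw [← dvd_iff_castHom_eq_zero hα]
      exact (dvd_add_left (dvd_mul_right _ _)).mp h3
    · exact map_zero _
  have h2 := hF.restrict_box_mul_newt hS (hQ.suppIn.pow_newt (D - (k + 1)))
  rw [mul_one, ← Nat.cast_add, Nat.add_sub_cancel' hK, hF.restrict_pow hQ.suppIn] at h2
  rw [h2, map_mul, map_pow] at h1
  have h3 : mapHom π (restrict (face a b c 1) Q) ≠ 0 := by
    intro h0
    apply hFQ
    apply ext_cf
    intro i j
    have h4 := congrArg (fun f => cf f i j) h0
    simp only [cf_mapHom, cf_restrict, cf_zero] at h4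
    rw [cf_restrict, cf_zero]
    split_ifs with hm
    · rw [if_pos hm] at h4
      by_contra hne
      exact ((hQ.isUnit i j hne).map π).ne_zero h4
    · rfl
  have h4 := (mul_eq_zero.mp h1).resolve_right (pow_ne_zero _ h3)
  have h5 := congrArg (fun f => cf f i j) h4
  simp only [cf_mapHom, cf_zero] at h5
  rwa [cf_restrict_of_mem _ hij, ← dvd_iff_castHom_eq_zero hα] at h5

/-- A condition on the common numerator is carried over to each level: on every face the leading
numerator is divisible by p, so its part on the edges moves to the next level, and the argument
repeats. -/
lemma mem_fracsFrom_innerBox (hα : α ≠ 0) (hQ : IsDenominator h d Q Qi)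
    (hl : restrict (face (-1) 0 0 1) Q ≠ 0) (hr : restrict (face 1 0 h 1) Q ≠ 0)
    (ht : restrict (face 0 1 (d - 1) 1) Q ≠ 0) {k : ℕ} {f : BiSeries (ZMod (p ^ α))}
    (hf : f ∈ fracsFrom Qi (fun k => box h d (k + 1 : ℕ) 0 0) k)
    (hfi : SuppIn (innerBox h d (p ^ (α - 1) : ℕ)) (f * Q ^ p ^ (α - 1))) :
    f ∈ fracsFrom Qi (fun k => innerBox h d (k + 1 : ℕ)) k := by
  induction hm : α - k generalizing k f with
  | zero =>
    rw [fracsFrom_eq_bot (by omega)] at hf ⊢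
    exact hf
  | succ m ih =>
    have hk : k < α := by omega
    rw [← fracsFrom_succ_sup, sup_comm] at hf
    obtain ⟨_, ⟨S, hS, rfl⟩, f', hf', rfl⟩ := Submodule.mem_sup.mp hf
    obtain ⟨g, rfl⟩ := exists_eq_smul_of_mem_fracsFrom hf'
    have hdvd : ∀ i j, (i, j) ∉ innerBox h d (k + 1 : ℕ) → (p : ZMod (p ^ α)) ∣ cf S i j := by
      intro i j hij
      by_cases hb : (i, j) ∈ box h d (k + 1 : ℕ) 0 0
      · by_contra hnd
        refine hij (mem_innerBox_iff.mpr ⟨hb, fun hc => hnd ?_, fun hc => hnd ?_, fun hc => hnd ?_⟩)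
        · refine dvd_cf_of_mem_face (g := g) hα hQ (isFace_left _ _) hl hk hS (fun i j hij => ?_) hc
          by_contra h0
          exact (mem_innerBox_iff.mp (hfi i j h0)).2.1 hij
        · refine dvd_cf_of_mem_face (g := g) hα hQ (isFace_right _ _) hr hk hS (fun i j hij => ?_) hc
          by_contra h0
          exact (mem_innerBox_iff.mp (hfi i j h0)).2.2.1 hij
        · refine dvd_cf_of_mem_face (g := g) hα hQ (isFace_top _ _) ht hk hS (fun i j hij => ?_) hc
          by_contra h0
          exact (mem_innerBox_iff.mp (hfi i j h0)).2.2.2 hij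
      · have : cf S i j = 0 := by
          by_contra h0
          exact hb (hS i j h0)
        rw [this]
        exact dvd_zero _
    set I := innerBox h d (k + 1 : ℕ)
    obtain ⟨T, hT, hTs⟩ := exists_eq_smul (c := (p : ZMod (p ^ α))) (f := restrict Iᶜ S)
      (fun i j => by
        rw [cf_restrict]
        split_ifs with hij
        · exact hdvd i j hij
        · exact dvd_zero _)
    have hsplit : S = restrict I S + (p : ZMod (p ^ α)) • T := by
      rw [← hT]
      apply ext_cf
      intro i j
      rw [cf_add, cf_restrict, cf_restrict]
      by_cases hij : (i, j) ∈ I <;> simp [hij]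
    set f0 := (p : ZMod (p ^ α)) ^ k • (restrict I S * Qi ^ (k + 1))
    have hf0 : f0 ∈ fracs Qi ((p : ZMod (p ^ α)) ^ k) (k + 1) I := ⟨_, suppIn_restrict _ _, rfl⟩
    have hK : k + 1 ≤ p ^ (α - 1) := le_trans (by omega) le_pow_pred
    have hf0i : SuppIn (innerBox h d (p ^ (α - 1) : ℕ)) (f0 * Q ^ p ^ (α - 1)) := by
      simp only [f0]
      rw [smul_mul_assoc, mul_assoc, pow_mul_inv_pow hQ.mul_inv hK]
      refine SuppIn.smul ((suppIn_restrict I S).mul (hQ.suppIn.pow_newt _) ?_) _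
      obtain ⟨n, hn⟩ := Nat.exists_eq_add_of_le hK
      rw [hn, Nat.add_sub_cancel_left]
      rintro a b a' b' ⟨h1, h2, h3, h4, h5⟩ ⟨g1, g2, g3, g4, g5⟩
      simp only at h1 h2 h3 h4 h5 g1 g2 g3 g4 g5
      rw [mul_one] at g2 g3 g4
      push_cast at h2 h3 h4 ⊢
      refine ⟨?_, ?_, ?_, ?_, ?_⟩ <;> simp only <;> nlinarith
    set f1 := (p : ZMod (p ^ α)) ^ (k + 1) • (T * Qi ^ (k + 1)) + (p : ZMod (p ^ α)) ^ (k + 1) • g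
    have hsum : (p : ZMod (p ^ α)) ^ k • (S * Qi ^ (k + 1)) + (p : ZMod (p ^ α)) ^ (k + 1) • g =
        f0 + f1 := by
      simp only [f0, f1]
      rw [← add_assoc, pow_succ (p : ZMod (p ^ α)) k, mul_smul _ _ (T * _), ← smul_add,
        ← smul_mul_assoc (p : ZMod (p ^ α)) T, ← add_mul, ← hsplit]
    have hf1 : f1 ∈ fracsFrom Qi (fun k => box h d (k + 1 : ℕ) 0 0) (k + 1) := by
      refine Submodule.add_mem _ ?_ hf'
      refine le_fracsFrom (fun k => box h d (k + 1 : ℕ) 0 0) le_rfl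
        (fracs_le_add hQ.suppIn hQ.mul_inv _ (k + 1) 1 0 0 ⟨T, hTs _ ?_, rfl⟩)
      exact (suppIn_restrict_inter hS).mono Set.inter_subset_right
    rw [hsum] at hfi ⊢
    have hf1i : SuppIn (innerBox h d (p ^ (α - 1) : ℕ)) (f1 * Q ^ p ^ (α - 1)) := by
      have : f1 * Q ^ p ^ (α - 1) = (f0 + f1) * Q ^ p ^ (α - 1) - f0 * Q ^ p ^ (α - 1) := by ring
      rw [this]
      exact hfi.sub hf0i
    rw [← fracsFrom_succ_sup, sup_comm]
    exact Submodule.add_mem_sup hf0 (ih hf1 hf1i (by omega))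

/-- The sections of a fraction at the remainder `0` are periodic on a face. -/
lemma exists_polynomial_face_eq (hα : α ≠ 0) (hQ : IsDenominator h d Q Qi) {a b c : ℤ}
    (hF : IsFace h d a b c) (hFQ : restrict (face a b c 1) Q ≠ 0)
    {v : ℤ × ℤ} (hv : v = (0, 1) ∨ v = (1, 0)) {w : ℕ} {w0 : ℤ × ℤ}
    (hnewt : face a b c 1 ∩ newt h d 1 ⊆
      {e | ∃ k : ℕ, k ≤ w ∧ e = (w0.1 + k * v.1, w0.2 + k * v.2)})
    (hbox : face a b c (p ^ (α - 1) : ℕ) ∩ box h d (p ^ (α - 1) : ℕ) 0 0 ⊆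
      {e | ∃ k : ℕ, k ≤ p ^ (α - 1) * w ∧
          e = ((p ^ (α - 1) : ℕ) * w0.1 + k * v.1, (p ^ (α - 1) : ℕ) * w0.2 + k * v.2)}) :
    ∃ f : (ZMod p)[X], f ≠ 0 ∧ f.natDegree ≤ w ∧
      ∀ n m e : ℕ, f ∣ X ^ p ^ (n + m) - X ^ p ^ n → n + 2 * (α - 1) ≤ e →
        p ^ (α - 1) * w < p ^ e →
        ∀ g ∈ fracsFrom Qi (fun k => box h d (k + 1 : ℕ) 0 0) 0,
        ∀ [NeZero (p ^ e)] [NeZero (p ^ (e + m))],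
          restrict (face a b c (p ^ (α - 1) : ℕ)) (sect (p ^ e) 0 g * Q ^ p ^ (α - 1)) =
          restrict (face a b c (p ^ (α - 1) : ℕ)) (sect (p ^ (e + m)) 0 g * Q ^ p ^ (α - 1)) := by
  set D := p ^ (α - 1)
  set ρ := restrict (face a b c 1) Q
  obtain ⟨f, hf0, hfw, hf⟩ := exists_polynomial_sect_eq hα hv (ρ := ρ) (h := h) (d := d)
    ((suppIn_restrict_inter hQ.suppIn).mono Set.inter_subset_right)
    ((suppIn_restrict_inter hQ.suppIn).mono hnewt) hFQ (fun i j hij => by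
      have h1 : cf ρ i j = cf Q i j := cf_restrict_of_mem Q (suppIn_restrict _ Q i j hij)
      rw [h1] at hij ⊢
      exact hQ.isUnit i j hij)
  refine ⟨f, hf0, hfw, fun n m e hdvd hne he g hg _ _ => ?_⟩
  have hN := suppIn_mul_pow_of_mem_fracsFrom hQ hg
  -- With q = p^t, multiplying the section by Q^D amounts to multiplying g by Q(x^q, y^q)^D = Q^(qD)
  -- inside. This is the numerator gQ^D times Q^((q-1)D), and the face part is multiplicative.
  have key : ∀ (t : ℕ) [NeZero (p ^ t)],
      restrict (face a b c (D : ℕ)) (sect (p ^ t) 0 g * Q ^ D) =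
        sect (p ^ t) 0 (restrict (face a b c (D : ℕ)) (g * Q ^ D) * ρ ^ ((p ^ t - 1) * D)) := by
    intro t _
    have ht : p ^ t * D = D + (p ^ t - 1) * D := by
      rw [add_comm, ← Nat.succ_mul, Nat.succ_eq_add_one,
        Nat.sub_add_cancel (Nat.one_le_pow _ _ hp.out.pos)]
    rw [mul_comm, ← sect_expand_mul, map_pow, ← pow_eq_expand_pow hα t hQ.suppIn]
    change restrict _ (sect (p ^ t) 0 (Q ^ (p ^ t * D) * g)) = _
    rw [restrict_face_sect, ← hF.restrict_pow hQ.suppIn]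
    congr 1
    have h1 := hF.restrict_box_mul_newt hN (hQ.suppIn.pow_newt ((p ^ t - 1) * D))
    rw [mul_one] at h1
    rw [← h1]
    congr 1
    · rw [← Nat.cast_mul, ht, Nat.cast_add]
    · change Q ^ (p ^ t * D) * g = g * Q ^ D * _
      rw [ht, pow_add]
      ring
  rw [key, key]
  exact hf n m e hdvd hne he _ ((suppIn_restrict_inter hN).mono hbox)

end BiSeries

/-! ### The period at remainder 0 and the size of the kernel -/

lemma le_landauL {l m n i j k : ℕ} (hi : i ∈ Finset.Icc 1 l) (hj : j ∈ Finset.Icc 1 m)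
    (hk : k ∈ Finset.Icc 1 n) (σ₁ : Nat.Partition i) (σ₂ : Nat.Partition j) (σ₃ : Nat.Partition k) :
    Nat.lcm (Nat.lcm σ₁.parts.lcm σ₂.parts.lcm) σ₃.parts.lcm ≤ landauL l m n := by
  refine le_trans ?_ (Finset.le_sup (f := fun i => (Finset.Icc 1 m).sup fun j =>
    (Finset.Icc 1 n).sup fun k => (Finset.univ : Finset (Nat.Partition i)).sup fun σ₁ =>
      (Finset.univ : Finset (Nat.Partition j)).sup fun σ₂ =>
        (Finset.univ : Finset (Nat.Partition k)).sup fun σ₃ =>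
          Nat.lcm (Nat.lcm σ₁.parts.lcm σ₂.parts.lcm) σ₃.parts.lcm) hi)
  refine le_trans ?_ (Finset.le_sup (f := fun j => (Finset.Icc 1 n).sup fun k =>
    (Finset.univ : Finset (Nat.Partition i)).sup fun σ₁ =>
      (Finset.univ : Finset (Nat.Partition j)).sup fun σ₂ =>
        (Finset.univ : Finset (Nat.Partition k)).sup fun σ₃ =>
          Nat.lcm (Nat.lcm σ₁.parts.lcm σ₂.parts.lcm) σ₃.parts.lcm) hj)
  refine le_trans ?_ (Finset.le_sup (f := fun k => (Finset.univ : Finset (Nat.Partition i)).sup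
    fun σ₁ => (Finset.univ : Finset (Nat.Partition j)).sup fun σ₂ =>
        (Finset.univ : Finset (Nat.Partition k)).sup fun σ₃ =>
          Nat.lcm (Nat.lcm σ₁.parts.lcm σ₂.parts.lcm) σ₃.parts.lcm) hk)
  refine le_trans ?_ (Finset.le_sup (f := fun σ₁ : Nat.Partition i =>
    (Finset.univ : Finset (Nat.Partition j)).sup fun σ₂ =>
        (Finset.univ : Finset (Nat.Partition k)).sup fun σ₃ =>
          Nat.lcm (Nat.lcm σ₁.parts.lcm σ₂.parts.lcm) σ₃.parts.lcm) (Finset.mem_univ σ₁))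
  refine le_trans ?_ (Finset.le_sup (f := fun σ₂ : Nat.Partition j =>
        (Finset.univ : Finset (Nat.Partition k)).sup fun σ₃ =>
          Nat.lcm (Nat.lcm σ₁.parts.lcm σ₂.parts.lcm) σ₃.parts.lcm) (Finset.mem_univ σ₂))
  exact Finset.le_sup (f := fun σ₃ : Nat.Partition k =>
    Nat.lcm (Nat.lcm σ₁.parts.lcm σ₂.parts.lcm) σ₃.parts.lcm) (Finset.mem_univ σ₃)

lemma Nat.Partition.lcm_parts_pos {n : ℕ} (σ : Nat.Partition n) : 0 < σ.parts.lcm := by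
  rw [Nat.pos_iff_ne_zero, ne_eq, Multiset.lcm_eq_zero_iff]
  exact fun h => (σ.parts_pos h).ne' rfl

namespace BiSeries

section

variable {R : Type*} [CommRing R]

lemma box_mono {h d K ε η ε' η' : ℤ} (hε : ε ≤ ε') (hη : η ≤ η') :
    box h d K ε η ⊆ box h d K ε' η' := by
  rintro ⟨i, j⟩ ⟨h1, h2, h3, h4, h5⟩
  exact ⟨h1, by linarith, h3, by linarith, h5⟩

lemma levelFracs_mono (Qi : BiSeries R) (c : R) {h d ε η ε' η' : ℤ} (hε : ε ≤ ε') (hη : η ≤ η') :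
    levelFracs Qi c h d ε η ≤ levelFracs Qi c h d ε' η' :=
  iSup_mono fun _ => fracs_mono _ _ _ (box_mono hε hη)

lemma excessFracs_mono (Qi : BiSeries R) (c : R) {h d ε η ε' η' : ℤ} (hε : ε ≤ ε') (hη : η ≤ η') :
    excessFracs Qi c h d ε η ≤ excessFracs Qi c h d ε' η' :=
  sup_le_sup (fracs_mono _ _ _ (box_mono hε hη))
    (iSup_mono fun _ => fracs_mono _ _ _ (box_mono hε hη))

end

variable {p α : ℕ} [hp : Fact p.Prime] {h d : ℕ} {Q Qi : BiSeries (ZMod (p ^ α))}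

omit hp in
lemma levelFracs_eq_fracsFrom : levelFracs Qi (p : ZMod (p ^ α)) h d 0 0 =
    fracsFrom Qi (fun k => box h d (k + 1 : ℕ) 0 0) 0 := by
  simp only [levelFracs, fracsFrom, zero_add]

lemma sect_mem_fracsFrom (hα : α ≠ 0) (hQ : IsDenominator h d Q Qi)
    {g : BiSeries (ZMod (p ^ α))} (hg : g ∈ fracsFrom Qi (fun k => box h d (k + 1 : ℕ) 0 0) 0)
    (e : ℕ) [NeZero (p ^ e)] :
    sect (p ^ e) 0 g ∈ fracsFrom Qi (fun k => box h d (k + 1 : ℕ) 0 0) 0 := by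
  rw [← levelFracs_eq_fracsFrom] at hg ⊢
  have := sect_mem_levelFracs hα e hQ.suppIn hQ.mul_inv (r := 0)
    (by exact_mod_cast pow_pos hp.out.pos e) 0 0 hg
  simpa using this

/-- The sections at the remainder `0` are periodic up to fractions whose numerators lie in the
interior. -/
lemma exists_period (hα : α ≠ 0) (hQ : IsDenominator h d Q Qi) (hh : 1 ≤ h) (hd : 1 ≤ d)
    (hr : ∃ j, cf Q h j ≠ 0) (ht : ∃ i, cf Q i (d - 1) ≠ 0) {c : ℕ} (hch : h ≤ p ^ c)
    (hcd : d ≤ p ^ c) :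
    ∃ m, 1 ≤ m ∧ m ≤ landauL h d d ∧ ∀ e, c + max α (2 * (α - 1)) ≤ e →
      ∀ g ∈ fracsFrom Qi (fun k => box h d (k + 1 : ℕ) 0 0) 0,
        ∀ [NeZero (p ^ e)] [NeZero (p ^ (e + m))], sect (p ^ (e + m)) 0 g - sect (p ^ e) 0 g ∈
          fracsFrom Qi (fun k => innerBox h d (k + 1 : ℕ)) 0 := by
  have hh' : (1 : ℤ) ≤ h := by exact_mod_cast hh
  have hd' : (1 : ℤ) ≤ d := by exact_mod_cast hd
  set D := p ^ (α - 1)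
  have hD : (0 : ℤ) < D := by exact_mod_cast pow_pos hp.out.pos (α - 1)
  have hne : ∀ {a b c' i j : ℤ}, cf Q i j ≠ 0 → a * i + b * j = c' →
      restrict (face a b c' 1) Q ≠ 0 := by
    intro a b c' i j hij hf h0
    have h1 := congrArg (fun f => cf f i j) h0
    simp only [cf_zero] at h1
    rw [cf_restrict_of_mem _ (by simpa [face] using hf)] at h1
    exact hij h1
  have hl : restrict (face (-1) 0 0 1) Q ≠ 0 := hne hQ.ne_zero (by ring)
  have hr' : restrict (face 1 0 h 1) Q ≠ 0 := by
    obtain ⟨j, hj⟩ := hr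
    exact hne hj (by ring)
  have ht' : restrict (face 0 1 (d - 1) 1) Q ≠ 0 := by
    obtain ⟨i, hi⟩ := ht
    exact hne hi (by ring)
  -- The left edge has length d - 1 only; the bound d suffices for `landauL h d d`.
  obtain ⟨fl, fl0, flw, hfl⟩ := exists_polynomial_face_eq hα hQ (isFace_left _ _) hl
    (v := (0, 1)) (Or.inl rfl) (w := d) (w0 := (0, 0))
    (by
      rintro ⟨i, j⟩ ⟨h0, h1, h2, h3, h4, h5⟩
      simp only [face, Set.mem_ofPred_eq] at h0 h1 h2 h3 h4 h5
      exact ⟨j.toNat, by omega, Prod.ext (by simp only; omega) (by simp only; omega)⟩)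
    (by
      rintro ⟨i, j⟩ ⟨h0, h1, h2, h3, h4, h5⟩
      simp only [face, Set.mem_ofPred_eq] at h0 h1 h2 h3 h4 h5
      refine ⟨j.toNat, ?_, Prod.ext (by simp only; omega) (by simp only; omega)⟩
      change _ ≤ D * d
      zify
      rw [Int.toNat_of_nonneg (by omega)]
      rw [show ((p ^ (α - 1) : ℕ) : ℤ) = D from rfl] at h4
      nlinarith)
  obtain ⟨fr, fr0, frw, hfr⟩ := exists_polynomial_face_eq hα hQ (isFace_right _ _) hr'
    (v := (0, 1)) (Or.inl rfl) (w := d) (w0 := (h, -1))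
    (by
      rintro ⟨i, j⟩ ⟨h0, h1, h2, h3, h4, h5⟩
      simp only [face, Set.mem_ofPred_eq] at h0 h1 h2 h3 h4 h5
      exact ⟨(j + 1).toNat, by omega, Prod.ext (by simp only; omega) (by simp only; omega)⟩)
    (by
      rintro ⟨i, j⟩ ⟨h0, h1, h2, h3, h4, h5⟩
      simp only [face, Set.mem_ofPred_eq] at h0 h1 h2 h3 h4 h5
      refine ⟨(j + D).toNat, ?_, Prod.ext (by simp only; linarith) (by simp only; omega)⟩
      change _ ≤ D * d
      zify
      rw [Int.toNat_of_nonneg (by omega)]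
      rw [show ((p ^ (α - 1) : ℕ) : ℤ) = D from rfl] at h4
      nlinarith)
  obtain ⟨ft, ft0, ftw, hft⟩ := exists_polynomial_face_eq hα hQ (isFace_top _ _) ht'
    (v := (1, 0)) (Or.inr rfl) (w := h) (w0 := (0, d - 1))
    (by
      rintro ⟨i, j⟩ ⟨h0, h1, h2, h3, h4, h5⟩
      simp only [face, Set.mem_ofPred_eq] at h0 h1 h2 h3 h4 h5
      exact ⟨i.toNat, by omega, Prod.ext (by simp only; omega) (by simp only; omega)⟩)
    (by
      rintro ⟨i, j⟩ ⟨h0, h1, h2, h3, h4, h5⟩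
      simp only [face, Set.mem_ofPred_eq] at h0 h1 h2 h3 h4 h5
      refine ⟨i.toNat, ?_, Prod.ext (by simp only; omega) (by simp only; linarith)⟩
      zify
      rw [Int.toNat_of_nonneg (by omega)]
      push_cast at h2
      linarith)
  obtain ⟨i, hi, σ₁, hσ₁⟩ := exists_partition_natDegree_dvd ft0 hh ftw
  obtain ⟨j, hj, σ₂, hσ₂⟩ := exists_partition_natDegree_dvd fl0 hd flw
  obtain ⟨k, hk, σ₃, hσ₃⟩ := exists_partition_natDegree_dvd fr0 hd frw
  set m := Nat.lcm (Nat.lcm σ₁.parts.lcm σ₂.parts.lcm) σ₃.parts.lcm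
  refine ⟨m, Nat.lcm_pos (Nat.lcm_pos σ₁.lcm_parts_pos σ₂.lcm_parts_pos) σ₃.lcm_parts_pos,
    le_landauL hi hj hk σ₁ σ₂ σ₃, fun e he g hg _ _ => ?_⟩
  -- The two entries of max(α, 2(α - 1)) have different roles: α makes p^e exceed the numerator
  -- degrees p^(α-1)·w, while 2(α - 1) lifts the divisibility from modulo p to modulo p^α.
  have hlt : ∀ w, w ≤ p ^ c → D * w < p ^ e := fun w hw => by
    calc D * w ≤ p ^ (α - 1) * p ^ c := Nat.mul_le_mul_left _ hw
      _ = p ^ (α - 1 + c) := (pow_add _ _ _).symm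
      _ < p ^ e := Nat.pow_lt_pow_right hp.out.one_lt (by omega)
  have heα : c + 2 * (α - 1) ≤ e := by omega
  have el := hfl c m e (dvd_X_pow_sub_X_pow_of_natDegree_dvd fl0 (flw.trans hcd) fun f h1 h2 =>
    ((hσ₂ f h1 h2).trans (Nat.dvd_lcm_right _ _)).trans (Nat.dvd_lcm_left _ _)) heα (hlt _ hcd) g hg
  have er := hfr c m e (dvd_X_pow_sub_X_pow_of_natDegree_dvd fr0 (frw.trans hcd) fun f h1 h2 =>
    (hσ₃ f h1 h2).trans (Nat.dvd_lcm_right _ _)) heα (hlt _ hcd) g hg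
  have et := hft c m e (dvd_X_pow_sub_X_pow_of_natDegree_dvd ft0 (ftw.trans hch) fun f h1 h2 =>
    ((hσ₁ f h1 h2).trans (Nat.dvd_lcm_left _ _)).trans (Nat.dvd_lcm_left _ _)) heα (hlt _ hch) g hg
  have hmem := Submodule.sub_mem _ (sect_mem_fracsFrom hα hQ hg (e + m))
    (sect_mem_fracsFrom hα hQ hg e)
  refine mem_fracsFrom_innerBox hα hQ hl hr' ht' hmem fun i j hij => ?_
  have hoff : ∀ a b c' : ℤ, restrict (face a b c' (D : ℕ)) (sect (p ^ e) 0 g * Q ^ D) =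
      restrict (face a b c' (D : ℕ)) (sect (p ^ (e + m)) 0 g * Q ^ D) →
        (i, j) ∉ face a b c' (D : ℕ) := by
    intro a b c' heq hc
    apply hij
    have h1 := congrArg (fun f => cf f i j) heq
    simp only [cf_restrict_of_mem _ hc] at h1
    rw [sub_mul, cf_sub, h1, sub_self]
  exact mem_innerBox_iff.mpr ⟨suppIn_mul_pow_of_mem_fracsFrom hQ hmem i j hij, hoff _ _ _ el,
    hoff _ _ _ er, hoff _ _ _ et⟩

lemma card_map_innerBox_le (hα : α ≠ 0) (hQ : IsDenominator h d Q Qi) (hh : 1 ≤ h) (hd : 1 ≤ d) :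
    Finite ↥((fracsFrom Qi (fun k => innerBox h d (k + 1 : ℕ)) 0).map rowZero) ∧
      Nat.card ↥((fracsFrom Qi (fun k => innerBox h d (k + 1 : ℕ)) 0).map rowZero) ≤
        p ^ ∑ k ∈ Finset.range α, (boxCount h d (k + 1) - (k + 1) * (h + d - 1)) := by
  rw [Finset.range_eq_Ico]
  refine card_map_fracsFrom_le hα (fun k => innerBox_finite _ _ _) (fun k _ => ?_) fun k _ =>
    exists_no_relations hα _ _ (Nat.le_sub_of_add_le (ncard_innerBox_add_le hh hd (by omega)))
  rintro _ ⟨S, hS, rfl⟩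
  refine ⟨S * Q, hS.mul hQ.suppIn ?_, ?_⟩
  · rintro a b a' b' ⟨h1, h2, h3, h4, h5⟩ ⟨g1, g2, g3, g4, g5⟩
    simp only at h1 h2 h3 h4 h5 g1 g2 g3 g4 g5
    push_cast at h2 h3 h4 ⊢
    refine ⟨?_, ?_, ?_, ?_, ?_⟩ <;> simp only <;> nlinarith
  · rw [show k + 2 = k + 1 + 1 by ring, pow_succ Qi (k + 1)]
    congr 1
    linear_combination (-S * Qi ^ (k + 1)) * hQ.mul_inv

/-- The number of the sequences of coefficients of the sections at the remainder `0`. -/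
lemma ncard_sect_zero_le (hα : α ≠ 0) (hQ : IsDenominator h d Q Qi) (hh : 1 ≤ h) (hd : 1 ≤ d)
    (hr : ∃ j, cf Q h j ≠ 0) (ht : ∃ i, cf Q i (d - 1) ≠ 0) {c : ℕ} (hch : h ≤ p ^ c)
    (hcd : d ≤ p ^ c) {g : BiSeries (ZMod (p ^ α))}
    (hg : g ∈ fracsFrom Qi (fun k => box h d (k + 1 : ℕ) 0 0) 0) :
    (Set.range fun e : ℕ => rowZero (sect (p ^ e) 0 g)).Finite ∧
    (Set.range fun e : ℕ => rowZero (sect (p ^ e) 0 g)).ncard ≤ c + max α (2 * (α - 1)) +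
      landauL h d d *
        p ^ ∑ k ∈ Finset.range α, (boxCount h d (k + 1) - (k + 1) * (h + d - 1)) := by
  obtain ⟨m, hm1, hmL, hm⟩ := exists_period hα hQ hh hd hr ht hch hcd
  obtain ⟨hfin, hcard⟩ := card_map_innerBox_le hα hQ hh hd
  set T := (fracsFrom Qi (fun k => innerBox h d (k + 1 : ℕ)) 0).map rowZero
  set t := c + max α (2 * (α - 1))
  let s : ℕ → ℕ → ZMod (p ^ α) := fun e => rowZero (sect (p ^ e) 0 g)
  -- From index t on, a row is determined by the residue of e - t modulo m up to an element of T.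
  have hper : ∀ n r, s (t + r + m * n) - s (t + r) ∈ T := by
    intro n r
    induction n with
    | zero => rw [mul_zero, add_zero, sub_self]; exact Submodule.zero_mem _
    | succ n ih =>
      have h1 : s (t + r + m * n + m) - s (t + r + m * n) ∈ T := by
        simp only [s]
        rw [← map_sub]
        exact Submodule.mem_map_of_mem (hm _ (by omega) g hg)
      have := Submodule.add_mem _ h1 ih
      rw [sub_add_sub_cancel] at this
      rwa [mul_add, mul_one, ← add_assoc]
  let φ : Fin t ⊕ (Fin m × T) → (ℕ → ZMod (p ^ α)) :=
    Sum.elim (fun e => s e) (fun x => s (t + x.1) + x.2)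
  have hsub : Set.range s ⊆ Set.range φ := by
    rintro _ ⟨e, rfl⟩
    by_cases he : e < t
    · exact ⟨Sum.inl ⟨e, he⟩, rfl⟩
    · have h1 := hper ((e - t) / m) ((e - t) % m)
      rw [add_assoc, Nat.mod_add_div, Nat.add_sub_cancel' (by omega)] at h1
      exact ⟨Sum.inr ⟨⟨(e - t) % m, Nat.mod_lt _ hm1⟩, ⟨_, h1⟩⟩, add_sub_cancel _ _⟩
  refine ⟨(Set.finite_range φ).subset hsub, (Set.ncard_le_ncard hsub (Set.finite_range φ)).trans ?_⟩
  rw [← Nat.card_coe_set_eq]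
  refine (Finite.card_range_le φ).trans ?_
  rw [Nat.card_sum, Nat.card_prod, Nat.card_fin, Nat.card_fin]
  exact Nat.add_le_add_left (Nat.mul_le_mul hmL hcard) _

/-- A bound for the number of elements of the kernel of a sequence of coefficients of a
fraction. -/
lemma ncard_pKernel_le (hα : α ≠ 0) (hQ : IsDenominator h d Q Qi) (hh : 1 ≤ h) (hd : 1 ≤ d)
    (hr : ∃ j, cf Q h j ≠ 0) (ht : ∃ i, cf Q i (d - 1) ≠ 0) {c : ℕ} (hch : h ≤ p ^ c)
    (hcd : d ≤ p ^ c) {u : ℕ} (hu : u ≠ 0) {ε η : ℤ} (hη : 0 ≤ η)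
    (hεu : ε < (p ^ u : ℕ)) (hηu : η < (p ^ u : ℕ)) {g₀ g₁ : BiSeries (ZMod (p ^ α))}
    (hg₀ : g₀ ∈ fracs Qi (1 : ZMod (p ^ α)) 1 (box h d 1 0 1))
    (hg₁ : g₁ ∈ excessFracs Qi (p : ZMod (p ^ α)) h d ε η) {a : ℕ → ZMod (p ^ α)}
    (ha : ∀ n, a n = cf (g₀ + g₁) n 0) :
    (pKernel p a).Finite ∧ (pKernel p a).ncard ≤
      p ^ ∑ k ∈ Finset.range α, boxCount h d (k + 1) + (c + max α (2 * (α - 1)) + landauL h d d *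
        p ^ ∑ k ∈ Finset.range α, (boxCount h d (k + 1) - (k + 1) * (h + d - 1))) +
      ∑ e ∈ Finset.range u, p ^ e := by
  classical
  have hseq : ∀ e r : ℕ, (fun n => a (p ^ e * n + r)) = rowZero (sect (p ^ e) r (g₀ + g₁)) := by
    intro e r
    ext n
    rw [ha, rowZero_apply, cf_sect]
    push_cast
    rw [mul_zero]
  have hg₀' : g₀ ∈ levelFracs Qi (p : ZMod (p ^ α)) h d 0 1 := by
    refine Submodule.mem_iSup_of_mem 0 ?_
    rw [pow_zero]
    exact_mod_cast hg₀
  have hq : ∀ e, u ≤ e → (p ^ u : ℤ) ≤ p ^ e ∧ (2 : ℤ) ≤ p ^ e := by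
    intro e he
    refine ⟨by exact_mod_cast Nat.pow_le_pow_right hp.out.pos he, ?_⟩
    have h1 : p ^ 1 ≤ p ^ e := Nat.pow_le_pow_right hp.out.pos (by omega)
    have h2 := hp.out.two_le
    rw [pow_one] at h1
    exact_mod_cast h2.trans h1
  push_cast at hεu hηu
  -- As p^e exceeds ε and η, the quotients (ε - r)/p^e and η/p^e, rounded down, are at most 0.
  have hsect₁ : ∀ e r : ℕ, u ≤ e → r < p ^ e → sect (p ^ e) r g₁ ∈
      excessFracs Qi (p : ZMod (p ^ α)) h d 0 0 := by
    intro e r he hre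
    obtain ⟨h1, h2⟩ := hq e he
    have h3 := sect_mem_excessFracs hα e hQ.suppIn hQ.mul_inv (r := r) (by exact_mod_cast hre) ε η hg₁
    push_cast at h3
    refine excessFracs_mono Qi _ ?_ ?_ h3
    · exact Int.lt_add_one_iff.mp (Int.ediv_lt_of_lt_mul (by omega) (by omega))
    · exact (Int.ediv_eq_zero_of_lt hη (by omega)).le
  -- For 0 < r < p^e the quotient -r/p^e rounds down to -1: the right edge is lost. For the degree
  -- in y, 1/p^e rounds down to 0 because e ≥ u ≥ 1.
  have hsect₀ : ∀ e r : ℕ, u ≤ e → r < p ^ e → r ≠ 0 → sect (p ^ e) r g₀ ∈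
      levelFracs Qi (p : ZMod (p ^ α)) h d (-1) 0 := by
    intro e r he hre hr0
    obtain ⟨h1, h2⟩ := hq e he
    have h3 := sect_mem_levelFracs hα e hQ.suppIn hQ.mul_inv (r := r) (by exact_mod_cast hre) 0 1 hg₀'
    push_cast at h3
    refine levelFracs_mono Qi _ ?_ ?_ h3
    · exact Int.lt_add_one_iff.mp (Int.ediv_lt_of_lt_mul (by omega) (by omega))
    · exact (Int.ediv_eq_zero_of_lt (by omega) (by omega)).le
  -- All kernel elements with r = 0 and e ≥ u come from sections at 0 of this one fraction, which
  -- has no excess left.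
  have hg : sect (p ^ u) 0 (g₀ + g₁) ∈ fracsFrom Qi (fun k => box h d (k + 1 : ℕ) 0 0) 0 := by
    obtain ⟨h1, h2⟩ := hq u le_rfl
    rw [← levelFracs_eq_fracsFrom, map_add]
    refine Submodule.add_mem _ ?_ (excessFracs_le_levelFracs hQ.suppIn hQ.mul_inv _ _ _
      (by exact_mod_cast hsect₁ u 0 le_rfl (pow_pos hp.out.pos u)))
    have h3 := sect_mem_levelFracs hα u hQ.suppIn hQ.mul_inv (r := 0)
      (by exact_mod_cast pow_pos hp.out.pos u) 0 1 hg₀'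
    push_cast at h3
    refine levelFracs_mono Qi _ ?_ ?_ h3
    · simp
    · exact (Int.ediv_eq_zero_of_lt (by omega) (by omega)).le
  obtain ⟨hGfin, hGcard⟩ := card_map_levelFracs_sup_excessFracs_le hα hQ hh hd
  obtain ⟨hZfin, hZcard⟩ := ncard_sect_zero_le hα hQ hh hd hr ht hch hcd hg
  set G := (levelFracs Qi (p : ZMod (p ^ α)) h d (-1) 0 ⊔
    excessFracs Qi (p : ZMod (p ^ α)) h d 0 0).map rowZero
  set Z := Set.range fun e : ℕ => rowZero (sect (p ^ e) 0 (sect (p ^ u) 0 (g₀ + g₁)))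
  let A : Finset (ℕ → ZMod (p ^ α)) := ((Finset.range u).sigma fun e => Finset.range (p ^ e)).image
    fun x => fun n => a (p ^ x.1 * n + x.2)
  have hA : A.card ≤ ∑ e ∈ Finset.range u, p ^ e := by
    refine Finset.card_image_le.trans ?_
    rw [Finset.card_sigma]
    simp
  have hsub : pKernel p a ⊆ (G : Set (ℕ → ZMod (p ^ α))) ∪ Z ∪ A := by
    rintro _ ⟨e, r, hre, rfl⟩
    by_cases he : e < u
    · right
      exact Finset.mem_coe.mpr (Finset.mem_image.mpr ⟨⟨e, r⟩, Finset.mem_sigma.mpr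
        ⟨Finset.mem_range.mpr he, Finset.mem_range.mpr hre⟩, rfl⟩)
    · left
      rw [hseq]
      push Not at he
      by_cases hr0 : r = 0
      · right
        obtain ⟨k, rfl⟩ := Nat.exists_eq_add_of_le he
        refine ⟨k, ?_⟩
        ext n
        simp only [rowZero_apply, cf_sect]
        rw [hr0]
        push_cast
        congr 1; ring
      · left
        refine Submodule.mem_map_of_mem ?_
        rw [map_add]
        exact Submodule.add_mem_sup (hsect₀ e r he hre hr0) (hsect₁ e r he hre)
  have hfin : ((G : Set (ℕ → ZMod (p ^ α))) ∪ Z ∪ A).Finite :=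
    ((Set.toFinite _).union hZfin).union A.finite_toSet
  refine ⟨hfin.subset hsub, (Set.ncard_le_ncard hsub hfin).trans ?_⟩
  refine (Set.ncard_union_le _ _).trans (Nat.add_le_add ((Set.ncard_union_le _ _).trans
    (Nat.add_le_add ?_ hZcard)) ?_)
  · exact hGcard
  · rw [Set.ncard_coe_finset]
    exact hA

end BiSeries

/-! ### From the polynomial P to the denominator Q -/

namespace BiPoly

variable {R S : Type*} [CommRing R] [CommRing S]

lemma coeff_mapCoeff (φ : R →+* S) (P : BiPoly R) (i j : ℕ) :
    ((P.mapCoeff φ).coeff j).coeff i = φ ((P.coeff j).coeff i) := by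
  rw [mapCoeff, coeff_map, coe_mapRingHom, coeff_map]

lemma mapCoeff_mapCoeff {T : Type*} [CommRing T] (φ : R →+* S) (ψ : S →+* T) (P : BiPoly R) :
    (P.mapCoeff φ).mapCoeff ψ = P.mapCoeff (ψ.comp φ) := by
  rw [mapCoeff, mapCoeff, mapCoeff, Polynomial.map_map, mapRingHom_comp]

lemma le_degX {P : BiPoly R} {i j : ℕ} (h : (P.coeff j).coeff i ≠ 0) : i ≤ P.degX := by
  have hj : j ∈ P.support := by
    rw [mem_support_iff]
    intro h0
    exact h (by rw [h0, coeff_zero])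
  exact (le_natDegree_of_ne_zero h).trans
    (Finset.le_sup (f := fun j => (P.coeff j).natDegree) hj)

lemma le_degY {P : BiPoly R} {i j : ℕ} (h : (P.coeff j).coeff i ≠ 0) : j ≤ P.degY :=
  le_natDegree_of_ne_zero fun h0 => h (by rw [h0, coeff_zero])

lemma exists_coeff_degX_ne_zero {P : BiPoly R} (hP : P ≠ 0) :
    ∃ j, (P.coeff j).coeff P.degX ≠ 0 := by
  obtain ⟨j, hj, he⟩ := Finset.exists_mem_eq_sup P.support (support_nonempty.mpr hP)
    fun j => (P.coeff j).natDegree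
  refine ⟨j, ?_⟩
  rw [degX, he, coeff_natDegree]
  exact leadingCoeff_ne_zero.mpr (mem_support_iff.mp hj)

lemma exists_coeff_degY_ne_zero {P : BiPoly R} (hP : P ≠ 0) :
    ∃ i, (P.coeff P.degY).coeff i ≠ 0 := by
  refine ⟨(P.coeff P.degY).natDegree, ?_⟩
  rw [coeff_natDegree]
  exact leadingCoeff_ne_zero.mpr (leadingCoeff_ne_zero.mpr hP)

lemma degX_mapCoeff_le (φ : R →+* S) (P : BiPoly R) : (P.mapCoeff φ).degX ≤ P.degX := by
  by_cases h0 : P.mapCoeff φ = 0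
  · rw [h0, degX, support_zero, Finset.sup_empty]
    exact Nat.zero_le _
  · obtain ⟨j, hj⟩ := exists_coeff_degX_ne_zero h0
    refine le_degX (j := j) fun h1 => hj ?_
    rw [coeff_mapCoeff, h1, map_zero]

lemma degY_mapCoeff_le (φ : R →+* S) (P : BiPoly R) : (P.mapCoeff φ).degY ≤ P.degY :=
  natDegree_map_le

lemma coeff_divY (P : BiPoly R) (j : ℕ) : P.divY.coeff ((j : ℤ) - 1) = P.coeff j := by
  rw [divY, LaurentPolynomial.T, AddMonoidAlgebra.coeff_mul_single_eq_coeff_mul (m₂ := (j : ℤ)),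
    mul_one, LaurentPolynomial.coeff_toLaurent]
  · exact Finsupp.mapDomain_apply Nat.castEmbedding.injective _ j
  · intro m _
    omega

lemma evalSeries_mapCoeff (φ : R →+* S) (P : BiPoly R) (F : PowerSeries R) :
    (P.mapCoeff φ).evalSeries (F.map φ) = (P.evalSeries F).map φ := by
  rw [evalSeries, evalSeries, hom_eval₂, mapCoeff, eval₂_map]
  congr 1
  refine RingHom.ext fun f => PowerSeries.ext fun n => ?_
  simp

lemma evalEval_zero (P : BiPoly R) : P.evalEval 0 0 = (P.coeff 0).coeff 0 := by
  rw [evalEval, ← coeff_zero_eq_eval_zero, C_0, ← coeff_zero_eq_eval_zero]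

end BiPoly

lemma ZMod.isUnit_of_castHom_ne_zero {p α : ℕ} [hp : Fact p.Prime] (hα : α ≠ 0) {x : ZMod (p ^ α)}
    (hx : ZMod.castHom (dvd_pow_self p hα) (ZMod p) x ≠ 0) : IsUnit x := by
  obtain ⟨n, rfl⟩ := ZMod.natCast_zmod_surjective x
  rw [map_natCast, ne_eq, ZMod.natCast_eq_zero_iff] at hx
  exact (ZMod.isUnit_iff_coprime n _).mpr
    (((Nat.Prime.coprime_iff_not_dvd hp.out).mpr hx).symm.pow_right α)

lemma PadicInt.castHom_comp_toZModPow {p α : ℕ} [hp : Fact p.Prime] (hα : α ≠ 0) :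
    (ZMod.castHom (dvd_pow_self p hα) (ZMod p)).comp (PadicInt.toZModPow α) =
      (PadicInt.toZMod : ℤ_[p] →+* ZMod p) := by
  ext x
  obtain ⟨n, hn⟩ := ZMod.natCast_zmod_surjective (PadicInt.toZModPow α x)
  have h1 : x - n ∈ RingHom.ker (PadicInt.toZModPow (p := p) α) := by
    rw [RingHom.mem_ker, map_sub, map_natCast, hn, sub_self]
  have h2 : x - n ∈ RingHom.ker (PadicInt.toZMod (p := p)) := by
    rw [PadicInt.ker_toZMod, PadicInt.maximalIdeal_eq_span_p]
    rw [PadicInt.ker_toZModPow] at h1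
    exact Ideal.span_singleton_le_span_singleton.mpr (dvd_pow_self _ hα) h1
  rw [RingHom.mem_ker, map_sub, map_natCast, sub_eq_zero] at h2
  rw [RingHom.comp_apply, ← hn, map_natCast, h2]

namespace BiSeries

variable {p α : ℕ} [hp : Fact p.Prime]

/-- A polynomial divided by `y` differs by a multiple of `p` from a support-preserving lift of its
reduction modulo `p`. -/
lemma exists_isDenominator (hα : α ≠ 0) {P : BiPoly (ZMod (p ^ α))} {P₁ : BiPoly (ZMod p)}
    (hPP : P₁ = P.mapCoeff (ZMod.castHom (dvd_pow_self p hα) (ZMod p)))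
    (h00 : (P.coeff 0).coeff 0 = 0) (h10 : (P₁.coeff 1).coeff 0 ≠ 0)
    {Q₀ : BiLaurent (ZMod (p ^ α))}
    (hQ₀ : Q₀.IsSupportPreservingLift (ZMod.castHom (dvd_pow_self p hα) (ZMod p)) P₁.divY) :
    ∃ Q Qi E : BiSeries (ZMod (p ^ α)), ofDivY P = Q + (p : ZMod (p ^ α)) • E ∧
      IsDenominator P₁.degX P₁.degY Q Qi ∧ SuppIn (newt P.degX P.degY 1) E ∧
      (∃ j, cf Q P₁.degX j ≠ 0) ∧ ∃ i, cf Q i (P₁.degY - 1) ≠ 0 := by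
  classical
  set π := ZMod.castHom (dvd_pow_self p hα) (ZMod p)
  set h := P₁.degX
  set d := P₁.degY
  have hcoeff : ∀ i j : ℕ, (P₁.coeff j).coeff i = π ((P.coeff j).coeff i) := fun i j => by
    rw [hPP, BiPoly.coeff_mapCoeff]
  have hP₁ : P₁ ≠ 0 := by
    rintro h0
    rw [h0] at h10
    exact h10 (by simp)
  have hne : ∀ i j : ℕ, (P₁.coeff j).coeff i ≠ 0 → (P.coeff j).coeff i ≠ 0 := by
    intro i j hij h0
    exact hij (by rw [hcoeff, h0, map_zero])
  have hQc : ∀ i j : ℕ, π ((Q₀.coeff ((j : ℤ) - 1)).coeff i) = (P₁.coeff j).coeff i ∧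
      ((Q₀.coeff ((j : ℤ) - 1)).coeff i ≠ 0 ↔ (P₁.coeff j).coeff i ≠ 0) := by
    intro i j
    have := hQ₀ i ((j : ℤ) - 1)
    rwa [BiPoly.coeff_divY] at this
  -- Cutting down to the support of P/y only serves to make the support well-ordered. No coefficient
  -- is lost: a monomial of Q₀ occurs in P/y modulo p, hence in P/y.
  let Q : BiSeries (ZMod (p ^ α)) :=
    ⟨fun e => if (ofDivY P).coeff e = 0 then 0 else (Q₀.coeff (ofLex e).2).coeff (ofLex e).1.toNat,
      (ofDivY P).isPWO_support.mono fun e he h0 => he (if_pos h0)⟩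
  have hQcf : ∀ i j : ℕ, cf Q i ((j : ℤ) - 1) = (Q₀.coeff ((j : ℤ) - 1)).coeff i := by
    intro i j
    change (if cf (ofDivY P) i ((j : ℤ) - 1) = 0 then 0 else
      (Q₀.coeff ((j : ℤ) - 1)).coeff (i : ℤ).toNat) = _
    rw [cf_ofDivY, Int.toNat_natCast]
    split_ifs with h0
    · by_contra hc
      exact hne i j ((hQc i j).2.mp (Ne.symm hc)) h0
    · rfl
  have hQs : SuppIn {e | 0 ≤ e.1 ∧ -1 ≤ e.2} Q := by
    intro i j hij
    refine suppIn_ofDivY P i j fun h0 => hij ?_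
    exact if_pos h0
  have hnat : ∀ {f : BiSeries (ZMod (p ^ α))} {A : Set (ℤ × ℤ)}, SuppIn {e | 0 ≤ e.1 ∧ -1 ≤ e.2} f →
      (∀ i j : ℕ, cf f i ((j : ℤ) - 1) ≠ 0 → ((i : ℤ), (j : ℤ) - 1) ∈ A) → SuppIn A f := by
    intro f A hf hA i j hij
    obtain ⟨h1, h2⟩ := hf i j hij
    simp only at h1 h2
    obtain ⟨i, rfl⟩ := Int.eq_ofNat_of_zero_le h1
    obtain ⟨k, hk⟩ := Int.eq_ofNat_of_zero_le (show 0 ≤ j + 1 by omega)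
    obtain rfl : j = (k : ℤ) - 1 := by omega
    exact hA i k hij
  have hQne : ∀ i j : ℕ, cf Q i ((j : ℤ) - 1) ≠ 0 ↔ (P₁.coeff j).coeff i ≠ 0 := fun i j => by
    rw [hQcf]; exact (hQc i j).2
  have hnewt : ∀ {H D i j : ℕ}, i ≤ H → j ≤ D → ¬ (i = 0 ∧ j = 0) →
      ((i : ℤ), (j : ℤ) - 1) ∈ newt H D 1 := by
    intro H D i j h1 h2 h3
    refine ⟨?_, ?_, ?_, ?_, ?_⟩ <;> simp only <;> omega
  have hQn : SuppIn (newt h d 1) Q := hnat hQs fun i j hij => by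
    have h1 := (hQne i j).mp hij
    refine hnewt (BiPoly.le_degX h1) (BiPoly.le_degY h1) ?_
    rintro ⟨rfl, rfl⟩
    exact hne 0 0 h1 h00
  have hQP : ∀ H D : ℕ, P.degX ≤ H → P.degY ≤ D → SuppIn (newt H D 1) (ofDivY P - Q) := by
    intro H D hH hD
    refine hnat ((suppIn_ofDivY P).sub hQs) fun i j hij => ?_
    have h1 : (P.coeff j).coeff i ≠ 0 := by
      intro h0
      apply hij
      have h2 : cf Q i ((j : ℤ) - 1) = 0 := by
        by_contra hc
        exact hne i j ((hQne i j).mp hc) h0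
      rw [cf_sub, cf_ofDivY, h0, h2, sub_self]
    refine hnewt ((BiPoly.le_degX h1).trans hH) ((BiPoly.le_degY h1).trans hD) ?_
    rintro ⟨rfl, rfl⟩
    exact h1 h00
  obtain ⟨E, hE, hEs⟩ := exists_eq_smul (c := (p : ZMod (p ^ α))) (f := ofDivY P - Q) (by
    intro i j
    by_cases hij : 0 ≤ i ∧ -1 ≤ j
    · obtain ⟨i, rfl⟩ := Int.eq_ofNat_of_zero_le hij.1
      obtain ⟨k, hk⟩ := Int.eq_ofNat_of_zero_le (show 0 ≤ j + 1 by omega)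
      obtain rfl : j = (k : ℤ) - 1 := by omega
      rw [dvd_iff_castHom_eq_zero hα, cf_sub, map_sub, hQcf, (hQc i k).1, cf_ofDivY, hcoeff,
        sub_self]
    · have : cf (ofDivY P - Q) i j = 0 := by
        by_contra hc
        exact hij (((suppIn_ofDivY P).sub hQs) i j hc)
      rw [this]
      exact dvd_zero _)
  have hunit : ∀ i j, cf Q i j ≠ 0 → IsUnit (cf Q i j) := by
    refine fun i j => hnat (A := {e | IsUnit (cf Q e.1 e.2)}) hQs (fun i j hij => ?_) i j
    simp only [Set.mem_ofPred_eq]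
    refine ZMod.isUnit_of_castHom_ne_zero hα ?_
    rw [hQcf] at hij ⊢
    change π _ ≠ 0
    rw [(hQc i j).1]
    exact (hQc i j).2.mp hij
  have hQ0 : cf Q 0 0 ≠ 0 := by
    have := (hQne 0 1).mpr h10
    simpa using this
  obtain ⟨Qi, hQi⟩ := (isUnit_of_cf_zero_zero (fun i j hij => by
    obtain ⟨h1, h2, h3, h4, h5⟩ := hQn i j hij
    simp only at h1 h5
    rw [← expo_zero, expo_le]
    omega) (hunit 0 0 hQ0)).exists_right_inv
  refine ⟨Q, Qi, E, ?_, ⟨hQn, hQi, hunit, hQ0⟩, hEs _ (hQP _ _ le_rfl le_rfl), ?_, ?_⟩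
  · rw [← hE, add_sub_cancel]
  · obtain ⟨j, hj⟩ := BiPoly.exists_coeff_degX_ne_zero hP₁
    exact ⟨(j : ℤ) - 1, (hQne _ _).mpr hj⟩
  · obtain ⟨i, hi⟩ := BiPoly.exists_coeff_degY_ne_zero hP₁
    exact ⟨i, (hQne _ _).mpr hi⟩

end BiSeries

/-! ### Automata and kernels -/

namespace DFAO

variable {p : ℕ} {Δ σ τ : Type*}

/-- Transport an automaton along a bijection of its states. -/
def congrState (e : σ ≃ τ) (M : DFAO p Δ σ) : DFAO p Δ τ where
  step x z := e (M.step (e.symm x) z)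
  start := e M.start
  output x := M.output (e.symm x)

lemma run_congrState (e : σ ≃ τ) (M : DFAO p Δ σ) (w : List (Fin p)) :
    (M.congrState e).run w = M.run w := by
  have h : ∀ (w : List (Fin p)) (x : σ), w.foldl (M.congrState e).step (e x) =
      e (w.foldl M.step x) := by
    intro w
    induction w with
    | nil => exact fun _ => rfl
    | cons z w ih =>
      intro x
      rw [List.foldl_cons, List.foldl_cons, ← ih]
      simp [congrState]
  have h1 := h w M.start
  change M.output (e.symm (w.foldl (M.congrState e).step (e M.start))) = M.output _
  rw [h1, e.symm_apply_apply]

/-- The automaton whose states are the elements of the kernel of a sequence. -/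
def ofKernel (p : ℕ) (a : ℕ → Δ) : DFAO p Δ (pKernel p a) where
  step b z := ⟨fun n => b.1 (p * n + z), by
    obtain ⟨e, r, hr, hb⟩ := b.2
    refine ⟨e + 1, p ^ e * z + r, ?_, ?_⟩
    · calc p ^ e * z + r < p ^ e * z + p ^ e := Nat.add_lt_add_left hr _
        _ = p ^ e * (z + 1) := by ring
        _ ≤ p ^ e * p := Nat.mul_le_mul_left _ z.2
        _ = p ^ (e + 1) := (pow_succ _ _).symm
    · rw [hb]
      funext n
      exact congrArg a (by ring)⟩
  start := ⟨a, 0, 0, by simp, by simp⟩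
  output b := b.1 0

lemma run_ofKernel (p : ℕ) (a : ℕ → Δ) (w : List (Fin p)) :
    (ofKernel p a).run w = a (Nat.ofDigits p (w.map Fin.val)) := by
  have h : ∀ (w : List (Fin p)) (b : pKernel p a),
      (w.foldl (ofKernel p a).step b).1 0 = b.1 (Nat.ofDigits p (w.map Fin.val)) := by
    intro w
    induction w with
    | nil => exact fun _ => rfl
    | cons z w ih =>
      intro b
      rw [List.foldl_cons, ih, List.map_cons, Nat.ofDigits_cons, Nat.add_comm]
      rfl
  exact h w _

lemma generates_ofKernel (p : ℕ) (a : ℕ → Δ) : (ofKernel p a).Generates a := by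
  intro n w hw
  rw [run_ofKernel, hw, Nat.ofDigits_digits]

lemma ignoresLeadingZeros_ofKernel (p : ℕ) (a : ℕ → Δ) : (ofKernel p a).IgnoresLeadingZeros := by
  intro w z hz
  rw [run_ofKernel, run_ofKernel, List.map_append, Nat.ofDigits_append]
  simp [hz]

/-- A sequence with a finite kernel has a minimal automaton, and the number of its states is at
most the number of elements of the kernel. -/
lemma exists_isMinimalFor {a : ℕ → Δ} (h : (pKernel p a).Finite) :
    ∃ (m : ℕ) (M : DFAO p Δ (Fin m)), M.IsMinimalFor a ∧ m ≤ (pKernel p a).ncard := by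
  classical
  have hex : ∃ m, ∃ M : DFAO p Δ (Fin m), M.Generates a ∧ M.IgnoresLeadingZeros := by
    have := h.to_subtype
    refine ⟨(pKernel p a).ncard, (ofKernel p a).congrState
      (Finite.equivFinOfCardEq (Nat.card_coe_set_eq _)), ?_, ?_⟩
    · intro n w hw
      rw [run_congrState, generates_ofKernel p a n w hw]
    · intro w z hz
      rw [run_congrState, run_congrState, ignoresLeadingZeros_ofKernel p a w z hz]
  obtain ⟨M, hM⟩ := Nat.find_spec hex
  refine ⟨Nat.find hex, M, ⟨hM, fun m' M' h1 h2 => Nat.find_min' hex ⟨M', h1, h2⟩⟩,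
    Nat.find_min' hex ?_⟩
  have := h.to_subtype
  refine ⟨(ofKernel p a).congrState
    (Finite.equivFinOfCardEq (Nat.card_coe_set_eq _)), ?_, ?_⟩
  · intro n w hw
    rw [run_congrState, generates_ofKernel p a n w hw]
  · intro w z hz
    rw [run_congrState, run_congrState, ignoresLeadingZeros_ofKernel p a w z hz]

end DFAO

/-! ### Evaluation of the bound and the theorem -/

namespace BiSeries

lemma sum_boxCount {h d : ℕ} (hh : 1 ≤ h) (hd : 1 ≤ d) (α : ℕ) :
    ((∑ k ∈ Finset.range α, boxCount h d (k + 1) : ℕ) : ℝ) =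
      1 / 6 * α * (α + 1) * ((2 * h * d - 1) * α + h * d + 1) := by
  have hcast : ∀ k : ℕ, (boxCount h d (k + 1) : ℝ) =
      (k + 1) ^ 2 * (h * d) - (k + 1) * k / 2 := by
    intro k
    have h1 : 2 ∣ (k + 1) * k := by
      rw [mul_comm]; exact (Nat.even_mul_succ_self k).two_dvd
    have h2 : (k + 1) * k / 2 ≤ (k + 1) ^ 2 * (h * d) := by
      have h3 : (k + 1) * k / 2 ≤ (k + 1) * k := Nat.div_le_self _ _
      have h4 : 1 ≤ h * d := Nat.mul_pos hh hd
      nlinarith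
    rw [boxCount, Nat.add_sub_cancel, Nat.cast_sub h2, Nat.cast_div h1 (by norm_num)]
    push_cast
    ring
  induction α with
  | zero => simp
  | succ n ih =>
    rw [Finset.sum_range_succ, Nat.cast_add, ih, hcast]
    push_cast
    ring

lemma sum_boxCount_sub {h d : ℕ} (hh : 1 ≤ h) (hd : 1 ≤ d) (α : ℕ) :
    ((∑ k ∈ Finset.range α, (boxCount h d (k + 1) - (k + 1) * (h + d - 1)) : ℕ) : ℝ) =
      (∑ k ∈ Finset.range α, boxCount h d (k + 1) : ℕ) - α * (α + 1) * (h + d - 1) / 2 := by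
  have hcast : ∀ k : ℕ, ((boxCount h d (k + 1) - (k + 1) * (h + d - 1) : ℕ) : ℝ) =
      boxCount h d (k + 1) - (k + 1) * (h + d - 1) := by
    intro k
    have h1 := ncard_innerBox_add_le hh hd (K := k + 1) (by omega)
    rw [Nat.cast_sub (by omega), Nat.cast_mul, Nat.cast_sub (by omega)]
    push_cast
    ring
  induction α with
  | zero => simp
  | succ n ih =>
    rw [Finset.sum_range_succ, Nat.cast_add, ih, hcast, Finset.sum_range_succ]
    push_cast
    ring

end BiSeries

lemma Real.lt_pow_floor_logb_add_one {p : ℕ} (hp : 1 < p) {x : ℝ} (hx : 1 ≤ x) :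
    0 ≤ ⌊Real.logb p x⌋ ∧ x < (p : ℝ) ^ (⌊Real.logb p x⌋.toNat + 1) := by
  have hp' : (1 : ℝ) < p := by exact_mod_cast hp
  have h0 : 0 ≤ ⌊Real.logb p x⌋ := Int.floor_nonneg.mpr (Real.logb_nonneg hp' hx)
  refine ⟨h0, ?_⟩
  have h1 := Int.lt_floor_add_one (Real.logb p x)
  rw [Real.logb_lt_iff_lt_rpow hp' (by linarith)] at h1
  obtain ⟨n, hn⟩ := Int.eq_ofNat_of_zero_le h0
  rw [hn] at h1 ⊢
  rw [Int.toNat_natCast]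
  rw [Int.cast_natCast] at h1
  exact_mod_cast h1

lemma Real.le_pow_ceil_logb {p : ℕ} (hp : 1 < p) {x : ℝ} (hx : 1 ≤ x) :
    0 ≤ ⌈Real.logb p x⌉ ∧ x ≤ (p : ℝ) ^ ⌈Real.logb p x⌉.toNat := by
  have hp' : (1 : ℝ) < p := by exact_mod_cast hp
  have h0 : 0 ≤ ⌈Real.logb p x⌉ := Int.ceil_nonneg (Real.logb_nonneg hp' hx)
  refine ⟨h0, ?_⟩
  have h1 := Int.le_ceil (Real.logb p x)
  rw [Real.logb_le_iff_le_rpow hp' (by linarith)] at h1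
  obtain ⟨n, hn⟩ := Int.eq_ofNat_of_zero_le h0
  rw [hn] at h1 ⊢
  rw [Int.toNat_natCast]
  rw [Int.cast_natCast] at h1
  exact_mod_cast h1

namespace BiSeries

/-- The Furstenberg series modulo `p ^ α` as a sequence of coefficients of a fraction with a small
denominator. -/
lemma exists_fraction {p α : ℕ} [hp : Fact p.Prime] (hα : α ≠ 0) {P : BiPoly ℤ_[p]}
    (hP : IsFurstenbergPoly p P) {F : PowerSeries ℤ_[p]} (hF : IsFurstenbergSeries p P F)
    {Q₀ : BiLaurent (ZMod (p ^ α))}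
    (hQ₀ : Q₀.IsSupportPreservingLift (ZMod.castHom (dvd_pow_self p hα) (ZMod p))
      (P.mapCoeff PadicInt.toZMod).divY) {h d H D : ℕ}
    (hh : h = (P.mapCoeff PadicInt.toZMod).degX) (hd : d = (P.mapCoeff PadicInt.toZMod).degY)
    (hH : H = (P.mapCoeff (PadicInt.toZModPow α)).degX)
    (hD : D = (P.mapCoeff (PadicInt.toZModPow α)).degY) :
    1 ≤ d ∧ h ≤ H ∧ d ≤ D ∧ ∃ Q Qi g₀ g₁ : BiSeries (ZMod (p ^ α)), IsDenominator h d Q Qi ∧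
      (∃ j, cf Q h j ≠ 0) ∧ (∃ i, cf Q i (d - 1) ≠ 0) ∧
      g₀ ∈ fracs Qi (1 : ZMod (p ^ α)) 1 (box h d 1 0 1) ∧
      g₁ ∈ excessFracs Qi (p : ZMod (p ^ α)) h d (α * (H - h)) (α * (D - d) + 1) ∧
      ∀ n : ℕ, PadicInt.toZModPow α (PowerSeries.coeff n F) = cf (g₀ + g₁) n 0 := by
  set P₁ := P.mapCoeff (PadicInt.toZMod (p := p)) with hP₁
  set Pα := P.mapCoeff (PadicInt.toZModPow (p := p) α) with hPα
  set π := ZMod.castHom (dvd_pow_self p hα) (ZMod p)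
  have hPP : P₁ = Pα.mapCoeff π := by
    rw [hPα, BiPoly.mapCoeff_mapCoeff, PadicInt.castHom_comp_toZModPow hα]
  have h00 : (Pα.coeff 0).coeff 0 = 0 := by
    rw [hPα, BiPoly.coeff_mapCoeff, ← BiPoly.evalEval_zero, hP.1, map_zero]
  have h10 : (P₁.coeff 1).coeff 0 ≠ 0 := by
    have := hP.2
    rw [BiPoly.evalEval_zero, coeff_derivative] at this
    rw [hP₁, BiPoly.coeff_mapCoeff]
    simpa using this
  have h10' : IsUnit ((Pα.coeff 1).coeff 0) := by
    refine ZMod.isUnit_of_castHom_ne_zero hα ?_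
    rwa [← BiPoly.coeff_mapCoeff, ← hPP]
  have hhH : h ≤ H := by
    rw [hh, hH, hPP]; exact BiPoly.degX_mapCoeff_le _ _
  have hdD : d ≤ D := by
    rw [hd, hD, hPP]; exact BiPoly.degY_mapCoeff_le _ _
  obtain ⟨Q, Qi, E, hQE, hQ, hE, hr, ht⟩ := exists_isDenominator hα hPP h00 h10 hQ₀
  rw [← hh, ← hd] at hQ
  rw [← hh] at hr
  rw [← hd] at ht
  rw [← hH, ← hD] at hE
  have hpα : (p : ZMod (p ^ α)) ^ α = 0 := natCast_pow_eq_zero le_rfl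
  have hnil : IsNilpotent ((p : ZMod (p ^ α)) • E) :=
    ⟨α, by rw [_root_.smul_pow, hpα, zero_smul]⟩
  -- Q + pE is a unit as the sum of a unit and a nilpotent element.
  obtain ⟨G, hG⟩ := (hnil.isUnit_add_left_of_commute (IsUnit.of_mul_eq_one Qi hQ.mul_inv)
    (Commute.all _ _)).exists_right_inv
  refine ⟨hd ▸ BiPoly.le_degY h10, hhH, hdD, Q, Qi, mono 0 1 * theta Q * Qi,
    excessPart Q Qi E (p : ZMod (p ^ α)) α, hQ, hr, ht, mul_theta_mul_mem_fracs hQ.suppIn,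
    excessPart_mem hα hQ.suppIn hQ.mul_inv (by exact_mod_cast hhH) (by exact_mod_cast hdD) hE,
    fun n => ?_⟩
  rw [← cf_add_smul_theta (Nat.one_le_iff_ne_zero.mpr hα) hpα hQ.mul_inv hG, ← hQE,
    cf_theta_ofDivY Pα (F.map (PadicInt.toZModPow α)) ?_ ?_ h10' (by rw [hQE]; exact hG),
    PowerSeries.coeff_map]
  · rw [← PowerSeries.coeff_zero_eq_constantCoeff_apply, PowerSeries.coeff_map,
      PowerSeries.coeff_zero_eq_constantCoeff_apply, hF.1, map_zero]
  · rw [hPα, BiPoly.evalSeries_mapCoeff, hF.2, map_zero]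

end BiSeries

theorem theorem2 (p : ℕ) [Fact p.Prime] (α : ℕ) (hα : 1 ≤ α)
    (P : BiPoly ℤ_[p]) (hP : IsFurstenbergPoly p P)
    (F : PowerSeries ℤ_[p]) (hF : IsFurstenbergSeries p P F)
    (a : ℕ → ZMod (p ^ α))
    (ha : ∀ n, a n = PadicInt.toZModPow α (PowerSeries.coeff n F))
    (h d : ℕ)
    (hh : h = (P.mapCoeff PadicInt.toZMod).degX) (hh1 : 1 ≤ h)
    (hd : d = (P.mapCoeff PadicInt.toZMod).degY)
    (N : ℝ) (hN : N = 1 / 6 * α * (α + 1) * ((2 * h * d - 1) * α + h * d + 1))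
    (u : ℤ)
    (hu : u = ⌊Real.logb p (max
        (α * (((P.mapCoeff (PadicInt.toZModPow α)).degX : ℝ) - h))
        (α * (((P.mapCoeff (PadicInt.toZModPow α)).degY : ℝ) - d) + 1))⌋ + 1)
    (Q : BiLaurent (ZMod (p ^ α)))
    (hQ : Q.IsSupportPreservingLift
      (ZMod.castHom (dvd_pow_self p (Nat.one_le_iff_ne_zero.mp hα)) (ZMod p))
      (P.mapCoeff PadicInt.toZMod).divY)
    (u_l u_r u_t : ℤ)
    (hul : u_l = ⌊Real.logb p (max
        ((p : ℝ) ^ (α - 1) * ((d : ℝ) - 1 - laurentDeg (Q.projX 0))) 1)⌋ + 1)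
    (hur : u_r = ⌊Real.logb p (max
        ((p : ℝ) ^ (α - 1) * ((d : ℝ) - 1 - laurentDeg (Q.projX h))) 1)⌋ + 1)
    (hut : u_t = ⌊Real.logb p (max
        ((p : ℝ) ^ (α - 1) * ((h : ℝ) - (Q.projY ((d : ℤ) - 1)).natDegree)) 1)⌋ + 1)
    (B : ℝ)
    (hB : B = (p : ℝ) ^ N
      + (p : ℝ) ^ (N - α * (α + 1) * (h + d - 1) / 2) * landauL h d d
      + max u_l (max u_r u_t)
      + ⌈Real.logb p (max (h : ℝ) ((d : ℝ) - 1))⌉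
      + max (α : ℝ) (2 * ((α : ℝ) - 1))
      + ((p : ℝ) ^ u - 1) / ((p : ℝ) - 1)) :
    (∃ (m : ℕ) (M : DFAO p (ZMod (p ^ α)) (Fin m)), M.IsMinimalFor a ∧ (m : ℝ) ≤ B) ∧
      (pKernel p a).Finite ∧ ((pKernel p a).ncard : ℝ) ≤ B := by
  have hp := (Fact.out : p.Prime)
  have hα0 : α ≠ 0 := Nat.one_le_iff_ne_zero.mp hα
  obtain ⟨hd1, hhH, hdD, Qs, Qi, g₀, g₁, hQs, hr, ht, hg₀, hg₁, hg⟩ :=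
    BiSeries.exists_fraction hα0 hP hF hQ hh hd rfl rfl
  set H := (P.mapCoeff (PadicInt.toZModPow α)).degX
  set D := (P.mapCoeff (PadicInt.toZModPow α)).degY
  have hα' : (1 : ℝ) ≤ α := by exact_mod_cast hα
  have hh' : (1 : ℝ) ≤ h := by exact_mod_cast hh1
  have hD' : (d : ℝ) ≤ D := by exact_mod_cast hdD
  obtain ⟨hu0, hu1⟩ := Real.lt_pow_floor_logb_add_one hp.one_lt
    (x := max (α * ((H : ℝ) - h)) (α * ((D : ℝ) - d) + 1))
    (le_max_of_le_right (by nlinarith))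
  set u₀ := ⌊Real.logb p (max (α * ((H : ℝ) - h)) (α * ((D : ℝ) - d) + 1))⌋.toNat + 1
  have huu : u = u₀ := by rw [hu, Nat.cast_add, Nat.cast_one, Int.toNat_of_nonneg hu0]
  obtain ⟨hC0, hC1⟩ := Real.le_pow_ceil_logb hp.one_lt
    (x := max (h : ℝ) ((d : ℝ) - 1)) (le_max_of_le_left hh')
  set C := ⌈Real.logb p (max (h : ℝ) ((d : ℝ) - 1))⌉.toNat
  have hCC : ((C : ℕ) : ℝ) = ⌈Real.logb p (max (h : ℝ) ((d : ℝ) - 1))⌉ := by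
    rw [← Int.cast_natCast, Int.toNat_of_nonneg hC0]
  have hch : h ≤ p ^ C := by
    exact_mod_cast (le_max_left (h : ℝ) ((d : ℝ) - 1)).trans hC1
  have hcd : d ≤ p ^ C + 1 := by
    have h1 := (le_max_right (h : ℝ) ((d : ℝ) - 1)).trans hC1
    rw [sub_le_iff_le_add] at h1
    exact_mod_cast h1
  have hpC : p ^ C + 1 ≤ p ^ (C + 1) := by
    have h1 : 1 ≤ p ^ C := Nat.one_le_pow _ _ hp.pos
    have h2 := Nat.mul_le_mul_left (p ^ C) hp.two_le
    rw [pow_succ]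
    omega
  -- The rounded logarithm C bounds only h and d - 1 by p^C; the exponent C + 1 is taken to bound d
  -- as well.
  obtain ⟨hfin, hcard⟩ := BiSeries.ncard_pKernel_le hα0 hQs hh1 hd1 hr ht (c := C + 1)
    (by omega) (by omega) (u := u₀) (by omega) (ε := α * (H - h)) (η := α * (D - d) + 1)
    (by
      have : (0 : ℤ) ≤ D - d := by omega
      positivity)
    (by exact_mod_cast (le_max_left _ _).trans_lt hu1)
    (by exact_mod_cast (le_max_right _ _).trans_lt hu1) hg₀ hg₁
    (fun n => (ha n).trans (hg n))
  -- The additional 1 in C + 1 is absorbed by max(u_ℓ, u_r, u_t), which is at least 1 since each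
  -- logarithm is of a number ≥ 1.
  have hul1 : 1 ≤ max u_l (max u_r u_t) := by
    refine le_max_of_le_left ?_
    rw [hul]
    have := (Real.lt_pow_floor_logb_add_one hp.one_lt (le_max_right
      ((p : ℝ) ^ (α - 1) * ((d : ℝ) - 1 - laurentDeg (Q.projX 0))) 1)).1
    omega
  have hbound : ((pKernel p a).ncard : ℝ) ≤ B := by
    have h1 : (1 : ℝ) ≤ ((max u_l (max u_r u_t) : ℤ) : ℝ) := by exact_mod_cast hul1
    have hN' := BiSeries.sum_boxCount hh1 hd1 α
    rw [← hN] at hN'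
    have hN'' := BiSeries.sum_boxCount_sub hh1 hd1 α
    rw [hN'] at hN''
    have hgeom : ((∑ e ∈ Finset.range u₀, p ^ e : ℕ) : ℝ) =
        ((p : ℝ) ^ u - 1) / ((p : ℝ) - 1) := by
      have hp1 : (p : ℝ) ≠ 1 := by exact_mod_cast hp.one_lt.ne'
      rw [huu, zpow_natCast, ← geom_sum_eq hp1]
      push_cast
      rfl
    have hM : ((max α (2 * (α - 1)) : ℕ) : ℝ) = max (α : ℝ) (2 * ((α : ℝ) - 1)) := by
      rw [Nat.cast_max, Nat.cast_mul, Nat.cast_sub hα]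
      norm_num
    have h2 : ((pKernel p a).ncard : ℝ) ≤ _ := Nat.cast_le.mpr hcard
    rw [Nat.cast_add, Nat.cast_add, Nat.cast_add, Nat.cast_mul, hgeom, Nat.cast_add, hM,
      Nat.cast_pow, Nat.cast_pow, ← Real.rpow_natCast, ← Real.rpow_natCast, hN', hN'',
      Nat.cast_add, hCC, Nat.cast_one] at h2
    rw [hB]
    push_cast at h1 ⊢
    linarith
  obtain ⟨m, M, hM, hm⟩ := DFAO.exists_isMinimalFor hfin
  exact ⟨⟨m, M, hM, (Nat.cast_le.mpr hm).trans hbound⟩, hfin, hbound⟩
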